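/- For an integer $q\ge 1$, an integer $a$ and a real $x\ge 2$, let $\pi(x)$ be the number of primes $p\le x$ and $\pi(x;q,a)$ the number of primes $p\le x$ with $p\equiv a \pmod q$, and let $\varphi$ be Euler's totient function. The Elliott–Halberstam conjecture asserts that for every $0<\theta<1$ and every $A>0$ there is a constant $C$, depending only on $\theta$ and $A$, such that for all $x\ge 2$ $$\sum_{1\le q\le x^{\theta}}\ \max_{\gcd(a,q)=1}\left|\pi(x;q,a)-\frac{\pi(x)}{\varphi(q)}\right|\ \le\ C\,\frac{x}{(\log x)^{A}}.$$ A nonzero integer is called $5$-smooth if all of its prime factors are at most $5$. **Theorem.** Assume the Elliott–Halberstam conjecture. Then there are infinitely many pairs of primes $(p,q)$ with $p>q$ such that $p-q$ is $5$-smooth. -/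

import Mathlib

/-- An integer `n` is `y`-smooth if it is nonzero and all its prime factors are at most `y`. -/
def IsSmooth (y : ℝ) (n : ℤ) : Prop :=
  n ≠ 0 ∧ ∀ p : ℕ, p.Prime → (p : ℤ) ∣ n → (p : ℝ) ≤ y

/-- `π(x; q, a)`: the number of primes `p ≤ x` with `p ≡ a (mod q)`. -/
noncomputable def primesInClass (x : ℝ) (q : ℕ) (a : ZMod q) : ℕ :=
  ((Finset.Icc 1 ⌊x⌋₊).filter (fun p : ℕ => p.Prime ∧ (p : ZMod q) = a)).card

/-- `E(x; q) = max_{(a, q) = 1} |π(x; q, a) - π(x) / φ(q)|`. For `q ≥ 1` the index type is finite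
and nonempty, so that the supremum is a maximum. -/
noncomputable def maxPrimeError (x : ℝ) (q : ℕ) : ℝ :=
  ⨆ a : (ZMod q)ˣ,
    |(primesInClass x q (a : ZMod q) : ℝ) - (Nat.primeCounting ⌊x⌋₊ : ℝ) / (Nat.totient q : ℝ)|

/-- The primes have level of distribution `θ`: for every `A > 0`,
`∑_{q ≤ x ^ θ} E(x; q) ≪_A x / (log x) ^ A` for `x ≥ 2`, with an implied constant that may also
depend on `θ`. -/
def PrimesHaveLevelOfDistribution (θ : ℝ) : Prop :=
  ∀ A : ℝ, 0 < A → ∃ C : ℝ, ∀ x : ℝ, 2 ≤ x →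
    ∑ q ∈ Finset.Icc 1 ⌊x ^ θ⌋₊, maxPrimeError x q ≤ C * (x / (Real.log x) ^ A)

/-- The Elliott–Halberstam conjecture: the primes have level of distribution `θ` for every
`θ < 1`. -/
def ElliottHalberstamConjecture : Prop :=
  ∀ θ : ℝ, 0 < θ → θ < 1 → PrimesHaveLevelOfDistribution θ

/-! The differences of the six shifts 0, 4, 6, 10, 12, 16 all divide 240 = 2^4·3·5, so it suffices
that infinitely many translates of this sextuple contain two primes
(`exists_two_primes_in_translate`). This is the argument of Goldston, Pintz and Yıldırım for six
forms and a level of distribution close to 1.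

Let W be the product of the primes up to 3000 and ν a class modulo W in which all six n + h are
coprime to W. An integer n ≤ N in this class gets the weight w(n), the square of the sum of λ_d over
the squarefree d ≤ x = N^0.495 that are coprime to W and divide ∏ (n + h). If no translate beyond N₀
contained two primes, the six sums of w(n) over n + h prime would together not exceed the sum of
w(n) over all n (`sum_sieveWeight_prime_le`). Opening the squares turns the sums into quadratic
forms in λ, of density 6/p for all n and 5/(p - 1) for n + h prime. The Elliott–Halberstam
conjecture controls the errors over primes, the moduli being at most N^0.995
(`eventually_EH_error`).

Selberg's diagonalisation (`quadratic_form_diagonal`) treats both forms. The λ_d are chosen so that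
the first has the diagonal variables y_m = 1 + 12 log(x/m)/log x, up to explicit factors
(`quadratic_form_all`). Those of the second are sums of y against 1/φ, and the classical lower bound
for the sum of μ²/φ is all that is needed (`le_quadratic_form_omit_one`).

There remain moments of log(x/r) against κ^ω(r)/∏ (p - 6) for κ = 6 and κ = 5. Mertens' estimate
gives their ratios (`exists_moment_recursion`), and 6 = 5 + 1 compares the two dimensions
(`moment_six_le`), so that no such sum has to be evaluated. In the ideal limit the two sides compare
as 6·(1/2)·23 = 69 to 67. The surplus pays for the exponent 0.495, for the finite W and for all
errors. Of the prime number theorem only θ(N) ≥ 0.997 N for arbitrarily large N is used, and that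
follows from Mertens' estimate (`exists_le_theta`). -/

namespace SmoothGaps
-- Multiplicative functions on squarefree integers and the diagonalised sieve
open Finset

/-- The multiplicative function on squarefree numbers with prescribed values at primes. -/
noncomputable def primeProd (f : ℕ → ℝ) (n : ℕ) : ℝ := ∏ p ∈ n.primeFactors, f p

/-- The squarefree integers in `[1, x]` that are coprime to `W`. -/
noncomputable def sqfCoprime (W : ℕ) (x : ℝ) : Finset ℕ :=
  (Icc 1 ⌊x⌋₊).filter fun d => Squarefree d ∧ d.Coprime W

theorem mem_sqfCoprime {W d : ℕ} {x : ℝ} :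
    d ∈ sqfCoprime W x ↔ 1 ≤ d ∧ (d : ℝ) ≤ x ∧ Squarefree d ∧ d.Coprime W := by
  unfold sqfCoprime
  rw [mem_filter, mem_Icc]
  constructor
  · rintro ⟨⟨h1, h2⟩, h3, h4⟩
    exact ⟨h1, (Nat.le_floor_iff' (by omega)).1 h2, h3, h4⟩
  · rintro ⟨h1, h2, h3, h4⟩
    exact ⟨⟨h1, (Nat.le_floor_iff' (by omega)).2 h2⟩, h3, h4⟩

theorem sqfCoprime_of_dvd {W d m : ℕ} {x : ℝ} (hm : m ∈ sqfCoprime W x) (h : d ∣ m) :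
    d ∈ sqfCoprime W x := by
  rw [mem_sqfCoprime] at *
  obtain ⟨h1, h2, h3, h4⟩ := hm
  refine ⟨Nat.pos_of_dvd_of_pos h h1, le_trans ?_ h2, h3.squarefree_of_dvd h,
    h4.coprime_dvd_left h⟩
  exact_mod_cast Nat.le_of_dvd h1 h

theorem one_mem_sqfCoprime {W : ℕ} {x : ℝ} (hx : 1 ≤ x) : 1 ∈ sqfCoprime W x := by
  simp [mem_sqfCoprime, hx]

theorem not_dvd_of_mem_primeFactors {W d p : ℕ} (h : d.Coprime W) (hp : p ∈ d.primeFactors) :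
    ¬ p ∣ W := by
  intro hpW
  have := Nat.dvd_gcd (Nat.dvd_of_mem_primeFactors hp) hpW
  rw [h] at this
  exact (Nat.prime_of_mem_primeFactors hp).one_lt.ne' (Nat.dvd_one.1 this)

@[simp] theorem primeProd_one (f : ℕ → ℝ) : primeProd f 1 = 1 := by simp [primeProd]

theorem primeProd_prime (f : ℕ → ℝ) {p : ℕ} (hp : p.Prime) : primeProd f p = f p := by
  simp [primeProd, hp.primeFactors]

theorem primeProd_mul_of_coprime (f : ℕ → ℝ) {m n : ℕ} (h : m.Coprime n) :
    primeProd f (m * n) = primeProd f m * primeProd f n := by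
  unfold primeProd
  rw [h.primeFactors_mul, prod_union h.disjoint_primeFactors]

theorem primeProd_mul_fun (f g : ℕ → ℝ) (n : ℕ) :
    primeProd (fun p => f p * g p) n = primeProd f n * primeProd g n := by
  simp [primeProd, prod_mul_distrib]

theorem primeProd_const (c : ℝ) (n : ℕ) : primeProd (fun _ => c) n = c ^ n.primeFactors.card := by
  simp [primeProd]

theorem primeProd_congr {W d : ℕ} {f g : ℕ → ℝ} (hd : d.Coprime W)
    (h : ∀ p, p.Prime → ¬ p ∣ W → f p = g p) : primeProd f d = primeProd g d :=
  prod_congr rfl fun p hp =>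
    h p (Nat.prime_of_mem_primeFactors hp) (not_dvd_of_mem_primeFactors hd hp)

theorem primeProd_pos {W d : ℕ} {f : ℕ → ℝ} (hd : d.Coprime W)
    (h : ∀ p, p.Prime → ¬ p ∣ W → 0 < f p) : 0 < primeProd f d :=
  prod_pos fun p hp => h p (Nat.prime_of_mem_primeFactors hp) (not_dvd_of_mem_primeFactors hd hp)

theorem primeProd_nonneg {W d : ℕ} {f : ℕ → ℝ} (hd : d.Coprime W)
    (h : ∀ p, p.Prime → ¬ p ∣ W → 0 ≤ f p) : 0 ≤ primeProd f d :=
  prod_nonneg fun p hp =>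
    h p (Nat.prime_of_mem_primeFactors hp) (not_dvd_of_mem_primeFactors hd hp)

theorem primeProd_le_primeProd {W d : ℕ} {f g : ℕ → ℝ} (hd : d.Coprime W)
    (h0 : ∀ p, p.Prime → ¬ p ∣ W → 0 ≤ f p)
    (h : ∀ p, p.Prime → ¬ p ∣ W → f p ≤ g p) : primeProd f d ≤ primeProd g d :=
  prod_le_prod
    (fun p hp => h0 p (Nat.prime_of_mem_primeFactors hp) (not_dvd_of_mem_primeFactors hd hp))
    (fun p hp => h p (Nat.prime_of_mem_primeFactors hp) (not_dvd_of_mem_primeFactors hd hp))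

/-- Divisors of a squarefree `n` correspond to sets of primes dividing `n`; this is the expansion of
the product over subsets. -/
theorem sum_divisors_primeProd (f : ℕ → ℝ) {n : ℕ} (hn : Squarefree n) :
    ∑ d ∈ n.divisors, primeProd f d = primeProd (fun p => 1 + f p) n := by
  have h1 : ∑ d ∈ n.divisors, primeProd f d
      = ∑ d ∈ n.divisors with Squarefree d, primeProd f d := by
    rw [Nat.divisors_filter_squarefree_of_squarefree hn]
  have h2 : (UniqueFactorizationMonoid.normalizedFactors n).toFinset = n.primeFactors := by
    rw [Nat.factors_eq]
    rfl
  rw [h1, Nat.sum_divisors_filter_squarefree hn.ne_zero, h2]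
  unfold primeProd
  rw [prod_one_add]
  refine sum_congr rfl fun t ht => ?_
  have : (∏ p ∈ t, p).primeFactors = t := by
    apply Nat.primeFactors_prod
    intro p hp
    exact Nat.prime_of_mem_primeFactors (mem_powerset.1 ht hp)
  rw [prod_val, show t.prod id = ∏ p ∈ t, p from rfl, this]

theorem sum_divisors_filter_dvd {m r : ℕ} (hm : m ≠ 0) (hr : r ∣ m) (F : ℕ → ℝ) :
    ∑ d ∈ m.divisors with r ∣ d, F d = ∑ e ∈ (m / r).divisors, F (r * e) := by
  obtain ⟨k, rfl⟩ := hr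
  have hr0 : r ≠ 0 := left_ne_zero_of_mul hm
  have hk0 : k ≠ 0 := right_ne_zero_of_mul hm
  rw [Nat.mul_div_cancel_left _ (Nat.pos_of_ne_zero hr0)]
  symm
  refine sum_bij (fun e _ => r * e) ?_ ?_ ?_ ?_
  · intro e he
    simp only [mem_filter, Nat.mem_divisors] at *
    exact ⟨⟨Nat.mul_dvd_mul_left _ he.1, hm⟩, dvd_mul_right _ _⟩
  · intro a _ b _ hab
    exact Nat.eq_of_mul_eq_mul_left (Nat.pos_of_ne_zero hr0) hab
  · intro d hd
    simp only [mem_filter, Nat.mem_divisors] at hd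
    obtain ⟨⟨hd1, _⟩, ⟨e, rfl⟩⟩ := hd
    exact ⟨e, Nat.mem_divisors.2 ⟨Nat.dvd_of_mul_dvd_mul_left (Nat.pos_of_ne_zero hr0) hd1, hk0⟩,
      rfl⟩
  · intros; rfl

theorem sum_divisors_filter_primeProd (f : ℕ → ℝ) {m r : ℕ} (hm : Squarefree m) (hr : r ∣ m) :
    ∑ d ∈ m.divisors with r ∣ d, primeProd f d
      = primeProd f r * primeProd (fun p => 1 + f p) (m / r) := by
  rw [sum_divisors_filter_dvd hm.ne_zero hr]
  obtain ⟨k, rfl⟩ := hr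
  have hr0 : r ≠ 0 := left_ne_zero_of_mul hm.ne_zero
  rw [Nat.mul_div_cancel_left _ (Nat.pos_of_ne_zero hr0)]
  have hrk := Nat.coprime_of_squarefree_mul hm
  rw [← sum_divisors_primeProd f (hm.squarefree_of_dvd (dvd_mul_left _ _)), mul_sum]
  refine sum_congr rfl fun e he => primeProd_mul_of_coprime f ?_
  exact hrk.coprime_dvd_right (Nat.dvd_of_mem_divisors he)

theorem primeProd_lcm_mul_gcd (f : ℕ → ℝ) {d e : ℕ} (hd : d ≠ 0) (he : e ≠ 0) :
    primeProd f (d.lcm e) * primeProd f (d.gcd e) = primeProd f d * primeProd f e := by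
  unfold primeProd
  have h : (d.lcm e).primeFactors = d.primeFactors ∪ e.primeFactors := by
    ext p
    simp only [mem_union, Nat.mem_primeFactors, ne_eq, Nat.lcm_eq_zero_iff, hd, he]
    constructor
    · rintro ⟨hp, hdvd, _⟩
      rcases (hp.dvd_lcm).1 hdvd with h | h
      · exact Or.inl ⟨hp, h, not_false⟩
      · exact Or.inr ⟨hp, h, not_false⟩
    · rintro (⟨hp, h, _⟩ | ⟨hp, h, _⟩)
      · exact ⟨hp, h.trans (Nat.dvd_lcm_left _ _), by simp⟩
      · exact ⟨hp, h.trans (Nat.dvd_lcm_right _ _), by simp⟩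
  rw [h, Nat.primeFactors_gcd hd he, prod_union_inter]

/-- Selberg's diagonalisation of the quadratic form of a sieve. -/
theorem quadratic_form_diagonal {W : ℕ} {x : ℝ} (g : ℕ → ℝ)
    (hg : ∀ p, p.Prime → ¬ p ∣ W → g p ≠ 0) (l : ℕ → ℝ) :
    ∑ d ∈ sqfCoprime W x, ∑ e ∈ sqfCoprime W x, l d * l e * primeProd g (d.lcm e)
      = ∑ r ∈ sqfCoprime W x, primeProd (fun p => (g p)⁻¹ - 1) r *
          (∑ d ∈ sqfCoprime W x with r ∣ d, l d * primeProd g d) ^ 2 := by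
  set D := sqfCoprime W x
  -- Here g(lcm) g(gcd) = g(d) g(e), and 1/g(gcd) is the sum of ∏ (1/g(p) - 1) over the common
  -- divisors r of d and e.
  have key : ∀ d ∈ D, ∀ e ∈ D, primeProd g (d.lcm e)
      = ∑ r ∈ D, if r ∣ d ∧ r ∣ e then
          primeProd (fun p => (g p)⁻¹ - 1) r * (primeProd g d * primeProd g e) else 0 := by
    intro d hd e he
    have hd' := mem_sqfCoprime.1 hd
    have he' := mem_sqfCoprime.1 he
    rw [← sum_filter, ← sum_mul, ← primeProd_lcm_mul_gcd g (by omega) (by omega)]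
    have hset : D.filter (fun r => r ∣ d ∧ r ∣ e) = (d.gcd e).divisors := by
      ext r
      simp only [mem_filter, Nat.mem_divisors]
      constructor
      · rintro ⟨_, h1, h2⟩
        exact ⟨Nat.dvd_gcd h1 h2, (Nat.gcd_pos_of_pos_left _ hd'.1).ne'⟩
      · rintro ⟨h, _⟩
        exact ⟨sqfCoprime_of_dvd hd (h.trans (Nat.gcd_dvd_left _ _)),
          h.trans (Nat.gcd_dvd_left _ _), h.trans (Nat.gcd_dvd_right _ _)⟩
    have hcop : (d.gcd e).Coprime W := hd'.2.2.2.coprime_dvd_left (Nat.gcd_dvd_left _ _)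
    rw [hset, sum_divisors_primeProd _ (hd'.2.2.1.squarefree_of_dvd (Nat.gcd_dvd_left _ _)),
      mul_left_comm, ← primeProd_mul_fun]
    rw [primeProd_congr (g := fun _ => 1) hcop, primeProd_const, one_pow, mul_one]
    intro p hp hpW
    have := hg p hp hpW
    field_simp
    ring
  calc _ = ∑ d ∈ D, ∑ e ∈ D, ∑ r ∈ D, if r ∣ d ∧ r ∣ e then
          primeProd (fun p => (g p)⁻¹ - 1) r *
            ((l d * primeProd g d) * (l e * primeProd g e)) else 0 := by
        refine sum_congr rfl fun d hd => sum_congr rfl fun e he => ?_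
        rw [key d hd e he, mul_sum]
        refine sum_congr rfl fun r _ => ?_
        split_ifs <;> ring
    _ = ∑ r ∈ D, ∑ d ∈ D, ∑ e ∈ D, if r ∣ d ∧ r ∣ e then
          primeProd (fun p => (g p)⁻¹ - 1) r *
            ((l d * primeProd g d) * (l e * primeProd g e)) else 0 := by
        exact sum_comm_cycle
    _ = _ := by
        refine sum_congr rfl fun r _ => ?_
        rw [sq, sum_mul_sum, mul_sum, sum_filter]
        refine sum_congr rfl fun d _ => ?_
        split_ifs with h
        · rw [mul_sum, sum_filter]
          refine sum_congr rfl fun e _ => ?_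
          simp [h]
        · simp [h]

/-- The coefficients of a Selberg sieve with density `g`, in terms of the diagonal variables. -/
noncomputable def sieveCoeff (W : ℕ) (x : ℝ) (g h y : ℕ → ℝ) (d : ℕ) : ℝ :=
  primeProd (fun _ => -1) d / primeProd g d *
    ∑ m ∈ sqfCoprime W x with d ∣ m, primeProd h m * y m

/-- These are the diagonal variables of the form of density `g'`. After the sums are exchanged, the
sum over r ∣ d ∣ m is an Euler product. For `g' = g` the factors `1 - g' p / g p` vanish and only m
= r survives; for another density a genuine weighted sum of `y` remains. Both cases occur below. -/
theorem sum_sieveCoeff {W : ℕ} {x : ℝ} {g h y : ℕ → ℝ} (g' : ℕ → ℝ) {r : ℕ} :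
    ∑ d ∈ sqfCoprime W x with r ∣ d, sieveCoeff W x g h y d * primeProd g' d
      = primeProd (fun p => - (g' p / g p)) r * ∑ m ∈ sqfCoprime W x with r ∣ m,
          primeProd h m * y m * primeProd (fun p => 1 - g' p / g p) (m / r) := by
  set D := sqfCoprime W x
  have h1 : ∀ d, sieveCoeff W x g h y d * primeProd g' d
      = ∑ m ∈ D with d ∣ m, primeProd (fun p => - (g' p / g p)) d * (primeProd h m * y m) := by
    intro d
    unfold sieveCoeff
    rw [← mul_sum]
    have : primeProd (fun p => - (g' p / g p)) d
        = primeProd (fun _ => -1) d / primeProd g d * primeProd g' d := by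
      unfold primeProd
      rw [← prod_div_distrib, ← prod_mul_distrib]
      refine prod_congr rfl fun p _ => ?_
      ring
    rw [this]; ring
  calc _ = ∑ d ∈ D with r ∣ d, ∑ m ∈ D with d ∣ m,
          primeProd (fun p => - (g' p / g p)) d * (primeProd h m * y m) :=
        sum_congr rfl fun d _ => h1 d
    _ = ∑ m ∈ D with r ∣ m, ∑ d ∈ m.divisors with r ∣ d,
          primeProd (fun p => - (g' p / g p)) d * (primeProd h m * y m) := by
        refine sum_comm' fun d m => ?_
        simp only [mem_filter, Nat.mem_divisors]
        constructor
        · rintro ⟨⟨hd, hr⟩, hm, hdm⟩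
          exact ⟨⟨⟨hdm, by have := mem_sqfCoprime.1 hm; omega⟩, hr⟩, hm, hr.trans hdm⟩
        · rintro ⟨⟨⟨hdm, _⟩, hr⟩, hm, _⟩
          exact ⟨⟨sqfCoprime_of_dvd hm hdm, hr⟩, hm, hdm⟩
    _ = _ := by
        rw [mul_sum]
        refine sum_congr rfl fun m hm => ?_
        rw [mem_filter] at hm
        rw [← sum_mul, sum_divisors_filter_primeProd _ (mem_sqfCoprime.1 hm.1).2.2.1 hm.2]
        simp only [sub_eq_add_neg]
        ring

end SmoothGaps

/-! ### Partial summation and the sum of 1/φ over squarefree integers -/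

namespace SmoothGaps
open Finset

/-- Partial summation against a power of `log (x / n)`, from a lower bound for the partial sums. -/
theorem le_sum_mul_log_pow (a : ℕ → ℝ) {c C x : ℝ} (hx : 1 ≤ x)
    (h : ∀ u, 1 ≤ u → u ≤ x → c * Real.log u - C ≤ ∑ n ∈ Icc 1 ⌊u⌋₊, a n) (j : ℕ) :
    c * Real.log x ^ (j + 1) / (j + 1) - C * Real.log x ^ j
      ≤ ∑ n ∈ Icc 1 ⌊x⌋₊, a n * (Real.log x - Real.log n) ^ j := by
  rcases j with _ | j
  · simpa using h x hx le_rfl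
  set L := Real.log x with hL
  -- Abel summation starts at index 0, where the value is set to 0.
  set b : ℕ → ℝ := fun n => if n = 0 then 0 else a n with hb
  have hsum : ∀ (N : ℕ) (F : ℕ → ℝ), ∑ n ∈ Icc 0 N, F n * b n = ∑ n ∈ Icc 1 N, a n * F n := by
    intro N F
    rw [← add_sum_Ioc_eq_sum_Icc (Nat.zero_le _)]
    simp only [hb, if_true, mul_zero, zero_add]
    refine sum_congr (by ext; simp; omega) fun n hn => ?_
    have := (mem_Icc.1 hn).1
    rw [if_neg (by omega), mul_comm]
  have hsum1 : ∀ N : ℕ, ∑ n ∈ Icc 0 N, b n = ∑ n ∈ Icc 1 N, a n := by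
    intro N
    simpa using hsum N (fun _ => 1)
  have hder : ∀ t : ℝ, 0 < t → HasDerivAt (fun t => (L - Real.log t) ^ (j + 1))
      (-((j + 1) * (L - Real.log t) ^ j * t⁻¹)) t := by
    intro t ht
    have := ((Real.hasDerivAt_log ht.ne').const_sub L).pow (j + 1)
    refine this.congr_deriv ?_
    push_cast
    simp
  have hcont : ContinuousOn (fun t : ℝ => -((j + 1) * (L - Real.log t) ^ j * t⁻¹))
      (Set.Icc 1 x) := by
    have h0 : ∀ t ∈ Set.Icc 1 x, t ≠ 0 := fun t ht => (zero_lt_one.trans_le ht.1).ne'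
    have h1 : ContinuousOn Real.log (Set.Icc 1 x) :=
      Real.continuousOn_log.mono fun t ht => h0 t ht
    have h2 : ContinuousOn (fun t : ℝ => t⁻¹) (Set.Icc 1 x) := continuousOn_inv₀.mono h0
    fun_prop
  have hint : MeasureTheory.IntegrableOn (deriv fun t => (L - Real.log t) ^ (j + 1))
      (Set.Icc 1 x) := by
    refine (hcont.integrableOn_Icc).congr_fun (fun t ht => ?_) measurableSet_Icc
    exact ((hder t (zero_lt_one.trans_le ht.1)).deriv).symm
  have habel := sum_mul_eq_sub_integral_mul₀ (f := fun t => (L - Real.log t) ^ (j + 1)) b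
    (by simp [hb]) x (fun t ht => (hder t (zero_lt_one.trans_le ht.1)).differentiableAt) hint
  rw [hsum _ (fun n => (L - Real.log n) ^ (j + 1))] at habel
  simp only [hsum1] at habel
  -- The boundary term vanishes because the weight is zero at t = x.
  rw [habel, ← hL, sub_self, zero_pow (by omega), zero_mul, zero_sub,
    ← MeasureTheory.integral_neg]
  have hint2 : MeasureTheory.IntegrableOn (fun t => (deriv fun t => (L - Real.log t) ^ (j + 1)) t *
      ∑ k ∈ Icc 1 ⌊t⌋₊, a k) (Set.Icc 1 x) :=
    integrableOn_mul_sum_Icc a zero_le_one hint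
  -- This antiderivative, found by parts, is zero at t = x; its value at t = 1 gives the whole
  -- bound.
  have hF : ∀ t ∈ Set.uIcc 1 x, HasDerivAt
      (fun t => -((L - Real.log t) ^ (j + 1) * (c * Real.log t - C))
        - c * (L - Real.log t) ^ (j + 2) / (j + 2))
      ((j + 1) * (L - Real.log t) ^ j * t⁻¹ * (c * Real.log t - C)) t := by
    intro t ht
    rw [Set.uIcc_of_le hx] at ht
    have ht0 := zero_lt_one.trans_le ht.1
    have h1 := hder t ht0
    have h2 : HasDerivAt (fun t => (L - Real.log t) ^ (j + 2))
        (-((j + 2) * (L - Real.log t) ^ (j + 1) * t⁻¹)) t := by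
      have := ((Real.hasDerivAt_log ht0.ne').const_sub L).pow (j + 2)
      refine this.congr_deriv ?_
      push_cast
      simp
    have h3 := ((Real.hasDerivAt_log ht0.ne').const_mul c).sub_const C
    refine ((h1.mul h3).neg.sub ((h2.const_mul c).div_const ((j : ℝ) + 2))).congr_deriv ?_
    have : (j : ℝ) + 2 ≠ 0 := by positivity
    field_simp
    ring
  have hcont2 : ContinuousOn
      (fun t : ℝ => (j + 1) * (L - Real.log t) ^ j * t⁻¹ * (c * Real.log t - C))
      (Set.Icc 1 x) := by
    have h0 : ∀ t ∈ Set.Icc 1 x, t ≠ 0 := fun t ht => (zero_lt_one.trans_le ht.1).ne'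
    have h1 : ContinuousOn Real.log (Set.Icc 1 x) :=
      Real.continuousOn_log.mono fun t ht => h0 t ht
    have h2 : ContinuousOn (fun t : ℝ => t⁻¹) (Set.Icc 1 x) := continuousOn_inv₀.mono h0
    fun_prop
  have hftc := intervalIntegral.integral_eq_sub_of_hasDerivAt hF
    (ContinuousOn.intervalIntegrable (by rwa [Set.uIcc_of_le hx]))
  rw [intervalIntegral.integral_of_le hx] at hftc
  have hval : c * L ^ (j + 1 + 1) / ((j + 1 : ℕ) + 1) - C * L ^ (j + 1)
      = ∫ t in Set.Ioc 1 x, (j + 1) * (L - Real.log t) ^ j * t⁻¹ * (c * Real.log t - C) := by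
    rw [hftc, ← hL]
    simp
    ring
  rw [hval]
  refine MeasureTheory.setIntegral_mono_on (hcont2.integrableOn_Icc.mono_set Set.Ioc_subset_Icc_self)
    (hint2.mono_set Set.Ioc_subset_Icc_self).neg measurableSet_Ioc fun t ht => ?_
  have ht0 := zero_lt_one.trans ht.1
  rw [(hder t ht0).deriv, neg_mul, neg_neg]
  refine mul_le_mul_of_nonneg_left (h t ht.1.le ht.2) ?_
  have : 0 ≤ L - Real.log t := sub_nonneg.2 (Real.log_le_log ht0 ht.2)
  positivity

theorem sum_mul_log_pow_le (a : ℕ → ℝ) {c C x : ℝ} (hx : 1 ≤ x)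
    (h : ∀ u, 1 ≤ u → u ≤ x → ∑ n ∈ Icc 1 ⌊u⌋₊, a n ≤ c * Real.log u + C) (j : ℕ) :
    ∑ n ∈ Icc 1 ⌊x⌋₊, a n * (Real.log x - Real.log n) ^ j
      ≤ c * Real.log x ^ (j + 1) / (j + 1) + C * Real.log x ^ j := by
  have := le_sum_mul_log_pow (fun n => - a n) (c := -c) (C := C) hx (fun u h1 h2 => by
    have := h u h1 h2
    rw [sum_neg_distrib]
    linarith) j
  simp only [neg_mul, sum_neg_distrib, neg_div] at this
  linarith

theorem log_le_sum_inv {x : ℝ} (hx : 0 ≤ x) :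
    Real.log x ≤ ∑ n ∈ Icc 1 ⌊x⌋₊, (n : ℝ)⁻¹ := by
  have := log_le_harmonic_floor x hx
  rw [harmonic_eq_sum_Icc] at this
  push_cast at this
  exact this

theorem sum_inv_le_one_add_log {x : ℝ} (hx : 1 ≤ x) :
    ∑ n ∈ Icc 1 ⌊x⌋₊, (n : ℝ)⁻¹ ≤ 1 + Real.log x := by
  have := harmonic_floor_le_one_add_log x hx
  rw [harmonic_eq_sum_Icc] at this
  push_cast at this
  exact this

/-- The reciprocals of the integers composed of the primes dividing `m`. -/
theorem sum_inv_le_of_primeFactors_subset {m : ℕ} (T : Finset ℕ)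
    (hT : ∀ n ∈ T, n ≠ 0 ∧ n.primeFactors ⊆ m.primeFactors) :
    ∑ n ∈ T, (n : ℝ)⁻¹ ≤ (primeProd (fun p => 1 - (p : ℝ)⁻¹) m)⁻¹ := by
  let f : ℕ →* ℝ := ⟨⟨fun n => (n : ℝ)⁻¹, by simp⟩, by intros; simp [mul_comm]⟩
  have hf : ∀ {p : ℕ}, p.Prime → ‖f p‖ < 1 := by
    intro p hp
    show ‖(p : ℝ)⁻¹‖ < 1
    rw [norm_inv, RCLike.norm_natCast]
    exact inv_lt_one_of_one_lt₀ (by exact_mod_cast hp.one_lt)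
  have h := (EulerProduct.summable_and_hasSum_factoredNumbers_prod_filter_prime_geometric hf
    m.primeFactors).2
  have hprod : ∏ p ∈ m.primeFactors with p.Prime, (1 - f p)⁻¹
      = (primeProd (fun p => 1 - (p : ℝ)⁻¹) m)⁻¹ := by
    unfold primeProd
    rw [filter_true_of_mem (fun p hp => Nat.prime_of_mem_primeFactors hp), prod_inv_distrib]
    rfl
  rw [hprod] at h
  have h2 := (hasSum_subtype_iff_indicator (f := fun n => f n)).1 h
  have h3 := sum_le_hasSum T (fun n _ => by
    refine Set.indicator_nonneg (fun n _ => ?_) n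
    show (0 : ℝ) ≤ (n : ℝ)⁻¹
    positivity) h2
  refine le_trans (le_of_eq ?_) h3
  refine sum_congr rfl fun n hn => ?_
  rw [Set.indicator_of_mem]
  · rfl
  · exact Nat.mem_factoredNumbers_of_primeFactors_subset (hT n hn).1 (hT n hn).2

theorem one_sub_inv_pos {p : ℕ} (hp : p.Prime) : (0 : ℝ) < 1 - (p : ℝ)⁻¹ :=
  sub_pos.2 (inv_lt_one_of_one_lt₀ (by exact_mod_cast hp.one_lt))

theorem primeProd_one_sub_inv_pos (m : ℕ) : 0 < primeProd (fun p => 1 - (p : ℝ)⁻¹) m :=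
  prod_pos fun _ hp => one_sub_inv_pos (Nat.prime_of_mem_primeFactors hp)

theorem primeProd_one_sub_inv_eq (m : ℕ) (hm : m ≠ 0) :
    primeProd (fun p => 1 - (p : ℝ)⁻¹) m = (m.totient : ℝ) / m := by
  have h : (m.totient : ℝ) = m * ∏ p ∈ m.primeFactors, (1 - (p : ℝ)⁻¹) := by
    have := congrArg (fun q : ℚ => (q : ℝ)) (Nat.totient_eq_mul_prod_factors m)
    push_cast at this
    exact this
  have : (m : ℝ) ≠ 0 := by exact_mod_cast hm
  rw [h]
  unfold primeProd
  field_simp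

theorem primeProd_natCast {s : ℕ} (hs : Squarefree s) : primeProd (fun p => (p : ℝ)) s = s := by
  rw [primeProd, ← Nat.cast_prod, Nat.prod_primeFactors_of_squarefree hs]

/-- The classical lower bound for the sum of `μ(s)² / φ(s)` over `s ≤ x` coprime to `q`. -/
theorem log_le_sum_inv_totient {q : ℕ} (hq : q ≠ 0) {x : ℝ} (hx : 0 ≤ x) :
    primeProd (fun p => 1 - (p : ℝ)⁻¹) q * Real.log x
      ≤ ∑ s ∈ sqfCoprime q x, primeProd (fun p => ((p : ℝ) - 1)⁻¹) s := by
  -- ρ(n) is the part of the radical of n coprime to q. If ρ(n) = s, then n is s times an integer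
  -- composed of primes dividing sq, so such n contribute at most (1/s) ∏ (1 - 1/p)⁻¹ over p ∣ sq,
  -- which is (q/φ(q))/φ(s).
  set ρ : ℕ → ℕ := fun n => ∏ p ∈ n.primeFactors with ¬ p ∣ q, p with hρ
  have hρdvd : ∀ n, ρ n ∣ n := fun n =>
    (prod_dvd_prod_of_subset _ _ _ (filter_subset _ _)).trans (Nat.prod_primeFactors_dvd n)
  have hρpf : ∀ n, (ρ n).primeFactors = n.primeFactors.filter (fun p => ¬ p ∣ q) := fun n =>
    Nat.primeFactors_prod fun p hp => Nat.prime_of_mem_primeFactors (mem_filter.1 hp).1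
  have hmaps : ∀ n ∈ Icc 1 ⌊x⌋₊, ρ n ∈ sqfCoprime q x := by
    intro n hn
    rw [mem_Icc] at hn
    have hle := Nat.le_of_dvd (by omega) (hρdvd n)
    refine mem_sqfCoprime.2 ⟨Nat.pos_of_dvd_of_pos (hρdvd n) (by omega), ?_, ?_, ?_⟩
    · exact (Nat.le_floor_iff hx).1 (hle.trans hn.2)
    · refine (Finset.squarefree_prod_of_pairwise_isCoprime ?_ ?_)
      · intro a ha b hb hab
        simp only [coe_filter, Set.mem_ofPred_eq] at ha hb
        have := (Nat.coprime_primes (Nat.prime_of_mem_primeFactors ha.1)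
          (Nat.prime_of_mem_primeFactors hb.1)).2 hab
        exact Nat.coprime_iff_isRelPrime.1 this
      · intro p hp
        exact (Nat.prime_of_mem_primeFactors (mem_filter.1 hp).1).squarefree
    · refine Nat.Coprime.prod_left fun p hp => ?_
      rw [mem_filter] at hp
      exact ((Nat.prime_of_mem_primeFactors hp.1).coprime_iff_not_dvd).2 hp.2
  have hc := primeProd_one_sub_inv_pos q
  have h1 : ∑ n ∈ Icc 1 ⌊x⌋₊, (n : ℝ)⁻¹
      ≤ ∑ s ∈ sqfCoprime q x, (primeProd (fun p => 1 - (p : ℝ)⁻¹) q)⁻¹ *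
        primeProd (fun p => ((p : ℝ) - 1)⁻¹) s := by
    rw [← sum_fiberwise_of_maps_to hmaps]
    refine sum_le_sum fun s hs => ?_
    have hs' := mem_sqfCoprime.1 hs
    have hs0 : 0 < s := hs'.1
    have hsR : (s : ℝ) ≠ 0 := by exact_mod_cast hs0.ne'
    have hval : (primeProd (fun p => 1 - (p : ℝ)⁻¹) q)⁻¹ *
        primeProd (fun p => ((p : ℝ) - 1)⁻¹) s
        = (s : ℝ)⁻¹ * (primeProd (fun p => 1 - (p : ℝ)⁻¹) (s * q))⁻¹ := by
      rw [primeProd_mul_of_coprime _ hs'.2.2.2, mul_inv]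
      have : primeProd (fun p => ((p : ℝ) - 1)⁻¹) s
          = (s : ℝ)⁻¹ * (primeProd (fun p => 1 - (p : ℝ)⁻¹) s)⁻¹ := by
        rw [← primeProd_natCast hs'.2.2.1]
        unfold primeProd
        rw [← prod_inv_distrib, ← prod_inv_distrib, ← prod_mul_distrib]
        refine prod_congr rfl fun p hp => ?_
        have : (p : ℝ) ≠ 0 := by exact_mod_cast (Nat.prime_of_mem_primeFactors hp).ne_zero
        rw [← mul_inv, mul_sub, mul_one, mul_inv_cancel₀ this]
      rw [this]; ring
    rw [hval]
    set F := (Icc 1 ⌊x⌋₊).filter (fun n => ρ n = s)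
    have hF : ∀ n ∈ F, s ∣ n ∧ n ≠ 0 ∧ n.primeFactors ⊆ (s * q).primeFactors := by
      intro n hn
      obtain ⟨hn1, hn2⟩ := mem_filter.1 hn
      rw [mem_Icc] at hn1
      refine ⟨hn2 ▸ hρdvd n, by omega, fun p hp => ?_⟩
      rw [Nat.primeFactors_mul hs0.ne' hq, mem_union]
      by_cases hpq : p ∣ q
      · exact Or.inr (Nat.mem_primeFactors.2 ⟨Nat.prime_of_mem_primeFactors hp, hpq, hq⟩)
      · left
        rw [← hn2, hρpf]
        exact mem_filter.2 ⟨hp, hpq⟩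
    have h2 : ∑ n ∈ F, (n : ℝ)⁻¹ = (s : ℝ)⁻¹ * ∑ k ∈ F.image (· / s), (k : ℝ)⁻¹ := by
      rw [sum_image, mul_sum]
      · refine sum_congr rfl fun n hn => ?_
        obtain ⟨k, rfl⟩ := (hF n hn).1
        rw [Nat.mul_div_cancel_left _ hs0]
        push_cast
        rw [mul_inv]
      · intro a ha b hb hab
        have h1 := Nat.mul_div_cancel' (hF a ha).1
        have h2 := Nat.mul_div_cancel' (hF b hb).1
        rw [← h1, ← h2]
        exact congrArg _ hab
    rw [h2]
    refine mul_le_mul_of_nonneg_left (sum_inv_le_of_primeFactors_subset _ ?_) (by positivity)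
    intro k hk
    obtain ⟨n, hn, rfl⟩ := mem_image.1 hk
    obtain ⟨hsn, hn0, hpf⟩ := hF n hn
    have hdvd : n / s ∣ n := Nat.div_dvd_of_dvd hsn
    exact ⟨fun h => hn0 (Nat.eq_zero_of_zero_dvd (h ▸ hdvd)),
      (Nat.primeFactors_mono hdvd hn0).trans hpf⟩
  rw [← mul_sum] at h1
  calc _ ≤ primeProd (fun p => 1 - (p : ℝ)⁻¹) q * ∑ n ∈ Icc 1 ⌊x⌋₊, (n : ℝ)⁻¹ :=
        mul_le_mul_of_nonneg_left (log_le_sum_inv hx) hc.le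
    _ ≤ _ := by
        refine (mul_le_mul_of_nonneg_left h1 hc.le).trans (le_of_eq ?_)
        rw [← mul_assoc, mul_inv_cancel₀ hc.ne', one_mul]

end SmoothGaps

/-! ### The two quadratic forms of the sieve for six linear forms -/

namespace SmoothGaps
open Finset

theorem sum_sqfCoprime_filter_dvd {W r : ℕ} {x : ℝ} (hr : r ∈ sqfCoprime W x) (F : ℕ → ℝ) :
    ∑ m ∈ sqfCoprime W x with r ∣ m, F m = ∑ s ∈ sqfCoprime (r * W) (x / r), F (r * s) := by
  have hr' := mem_sqfCoprime.1 hr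
  have hr0 : 0 < r := hr'.1
  have hrR : (0 : ℝ) < r := by exact_mod_cast hr0
  symm
  refine sum_bij (fun s _ => r * s) ?_ ?_ ?_ ?_
  · intro s hs
    obtain ⟨h1, h2, h3, h4⟩ := mem_sqfCoprime.1 hs
    rw [Nat.coprime_mul_iff_right] at h4
    refine mem_filter.2 ⟨mem_sqfCoprime.2 ⟨Nat.mul_pos hr0 h1, ?_, ?_, ?_⟩, dvd_mul_right _ _⟩
    · push_cast
      rw [le_div_iff₀ hrR] at h2
      linarith
    · exact (Nat.squarefree_mul h4.1.symm).2 ⟨hr'.2.2.1, h3⟩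
    · exact Nat.Coprime.mul_left hr'.2.2.2 h4.2
  · intro a _ b _ hab
    exact Nat.eq_of_mul_eq_mul_left hr0 hab
  · intro m hm
    obtain ⟨hm, ⟨s, rfl⟩⟩ := mem_filter.1 hm
    obtain ⟨h1, h2, h3, h4⟩ := mem_sqfCoprime.1 hm
    refine ⟨s, mem_sqfCoprime.2 ⟨Nat.pos_of_mul_pos_left h1, ?_, ?_, ?_⟩, rfl⟩
    · rw [le_div_iff₀ hrR]
      push_cast at h2
      linarith
    · exact h3.squarefree_of_dvd (dvd_mul_left _ _)
    · exact Nat.Coprime.mul_right (Nat.coprime_of_squarefree_mul h3).symm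
        (h4.coprime_dvd_left (dvd_mul_left _ _))
  · intros; rfl

theorem sum_sqfCoprime_eq (W : ℕ) (x : ℝ) (F : ℕ → ℝ) :
    ∑ s ∈ sqfCoprime W x, F s
      = ∑ s ∈ Icc 1 ⌊x⌋₊, if Squarefree s ∧ s.Coprime W then F s else 0 :=
  sum_filter _ _

theorem le_sum_sqfCoprime_mul_log_pow (W : ℕ) (a : ℕ → ℝ) {c C x : ℝ} (hx : 1 ≤ x)
    (h : ∀ u, 1 ≤ u → u ≤ x → c * Real.log u - C ≤ ∑ n ∈ sqfCoprime W u, a n) (j : ℕ) :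
    c * Real.log x ^ (j + 1) / (j + 1) - C * Real.log x ^ j
      ≤ ∑ n ∈ sqfCoprime W x, a n * (Real.log x - Real.log n) ^ j := by
  simp only [sum_sqfCoprime_eq] at *
  refine (le_sum_mul_log_pow _ hx h j).trans (le_of_eq (sum_congr rfl fun n _ => ?_))
  split_ifs <;> simp

/-- The weight function of the diagonal variables. -/
noncomputable def diagWeight (x : ℝ) (m : ℕ) : ℝ :=
  1 + 12 * ((Real.log x - Real.log m) / Real.log x)

/-- The sieve coefficients for a set of six linear forms. -/
noncomputable def tupleCoeff (W : ℕ) (x : ℝ) : ℕ → ℝ :=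
  sieveCoeff W x (fun p => 6 / p) (fun p => 6 / ((p : ℝ) - 6)) (diagWeight x)

/-- The coefficients are built from the density 6/p itself, so the diagonal variable at r is ± h(r)
y(r) with h(p) = 6/(p - 6), and h is the inverse of the weight 1/g - 1 of the diagonal form. -/
theorem quadratic_form_all {W : ℕ} {x : ℝ} (hW : ∀ p, p.Prime → ¬ p ∣ W → 42 < p) :
    ∑ d ∈ sqfCoprime W x, ∑ e ∈ sqfCoprime W x,
        tupleCoeff W x d * tupleCoeff W x e * primeProd (fun p => 6 / (p : ℝ)) (d.lcm e)
      = ∑ r ∈ sqfCoprime W x, primeProd (fun p => 6 / ((p : ℝ) - 6)) r * diagWeight x r ^ 2 := by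
  have hW' : ∀ p, p.Prime → ¬ p ∣ W → (42 : ℝ) < p := fun p hp hpW => by
    exact_mod_cast hW p hp hpW
  rw [quadratic_form_diagonal _ (fun p hp hpW => by have := hW' p hp hpW; positivity)]
  refine sum_congr rfl fun r hr => ?_
  have hr' := mem_sqfCoprime.1 hr
  unfold tupleCoeff
  rw [sum_sieveCoeff, sum_sqfCoprime_filter_dvd hr, sum_eq_single 1]
  · have hid : primeProd (fun p => 6 / ((p : ℝ) - 6)) r
        = primeProd (fun p => (6 / (p : ℝ))⁻¹ - 1) r *
          (primeProd (fun p => -(6 / p / (6 / (p : ℝ)))) r) ^ 2 *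
          primeProd (fun p => 6 / ((p : ℝ) - 6)) r ^ 2 := by
      simp only [sq, ← primeProd_mul_fun]
      refine primeProd_congr hr'.2.2.2 fun p hp hpW => ?_
      have := hW' p hp hpW
      have h1 : (p : ℝ) - 6 ≠ 0 := by linarith
      have h2 : (p : ℝ) ≠ 0 := by linarith
      field_simp
    rw [mul_one, Nat.div_self hr'.1, primeProd_one, mul_one, hid]
    nth_rewrite 2 [hid]
    ring
  · intro s hs hs1
    obtain ⟨h1, h2, h3, h4⟩ := mem_sqfCoprime.1 hs
    rw [Nat.mul_div_cancel_left _ hr'.1]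
    rw [Nat.coprime_mul_iff_right] at h4
    have : primeProd (fun p => 1 - 6 / p / (6 / (p : ℝ))) s = 0 := by
      obtain ⟨p, hp, hps⟩ := Nat.exists_prime_and_dvd hs1
      refine prod_eq_zero (Nat.mem_primeFactors.2 ⟨hp, hps, by omega⟩) ?_
      have : (p : ℝ) ≠ 0 := by exact_mod_cast hp.ne_zero
      field_simp
      ring
    rw [this, mul_zero]
  · intro h
    have : (1 : ℝ) ≤ x / r := by
      rw [le_div_iff₀ (by exact_mod_cast hr'.1)]
      linarith [hr'.2.1]
    exact absurd (one_mem_sqfCoprime this) h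

/-- When one form takes a prime value, five forms are sieved and the density is 5/(p - 1). Since
h(p)(1 - g'(p)/g(p)) = 1/(p - 1), the diagonal variable at r is, up to an explicit factor, the sum
of y(rs)/φ(s) over s ≤ x/r coprime to rW. Writing l = log(x/r), integrating 1 + 12u against the
lower bound for the sum of 1/φ gives l + 6l²/log x. The bound is nonnegative, so it can be squared.
-/
theorem le_quadratic_form_omit_one {W : ℕ} (hW0 : W ≠ 0) {x : ℝ} (hx : 1 < x)
    (hW : ∀ p, p.Prime → ¬ p ∣ W → 42 < p) :
    primeProd (fun p => 1 - (p : ℝ)⁻¹) W ^ 2 *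
      ∑ r ∈ sqfCoprime W x, primeProd (fun p => 5 / ((p : ℝ) - 6)) r *
        ((Real.log x - Real.log r) + 6 * (Real.log x - Real.log r) ^ 2 / Real.log x) ^ 2
    ≤ ∑ d ∈ sqfCoprime W x, ∑ e ∈ sqfCoprime W x,
        tupleCoeff W x d * tupleCoeff W x e *
          primeProd (fun p => 5 / ((p : ℝ) - 1)) (d.lcm e) := by
  have hW' : ∀ p, p.Prime → ¬ p ∣ W → (42 : ℝ) < p := fun p hp hpW => by
    exact_mod_cast hW p hp hpW
  have hL : 0 < Real.log x := Real.log_pos hx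
  rw [quadratic_form_diagonal _ (fun p hp hpW => by
    have := hW' p hp hpW
    have h1 : (p : ℝ) - 1 ≠ 0 := by linarith
    positivity), mul_sum]
  refine sum_le_sum fun r hr => ?_
  have hr' := mem_sqfCoprime.1 hr
  have hr0 : (0 : ℝ) < r := by exact_mod_cast hr'.1
  unfold tupleCoeff
  rw [sum_sieveCoeff, sum_sqfCoprime_filter_dvd hr]
  set l := Real.log x - Real.log r with hl
  have hX : 1 ≤ x / r := by
    rw [le_div_iff₀ hr0]
    linarith [hr'.2.1]
  have hlX : Real.log (x / r) = l := Real.log_div (by linarith) hr0.ne'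
  have hl0 : 0 ≤ l := hlX ▸ Real.log_nonneg hX
  set c := primeProd (fun p => 1 - (p : ℝ)⁻¹) (r * W) with hc
  have hcsplit : c = primeProd (fun p => 1 - (p : ℝ)⁻¹) r * primeProd (fun p => 1 - (p : ℝ)⁻¹) W :=
    primeProd_mul_of_coprime _ hr'.2.2.2
  set a := primeProd (fun p => ((p : ℝ) - 1)⁻¹) with ha
  have hinner : ∑ s ∈ sqfCoprime (r * W) (x / r), primeProd (fun p => 6 / ((p : ℝ) - 6)) (r * s) *
      diagWeight x (r * s) * primeProd (fun p => 1 - 5 / ((p : ℝ) - 1) / (6 / p)) (r * s / r)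
      = primeProd (fun p => 6 / ((p : ℝ) - 6)) r *
        (∑ s ∈ sqfCoprime (r * W) (x / r), a s + 12 / Real.log x *
          ∑ s ∈ sqfCoprime (r * W) (x / r), a s * (Real.log (x / r) - Real.log s) ^ 1) := by
    rw [mul_sum, ← sum_add_distrib, mul_sum]
    refine sum_congr rfl fun s hs => ?_
    obtain ⟨h1, h2, h3, h4⟩ := mem_sqfCoprime.1 hs
    have h4' := Nat.coprime_mul_iff_right.1 h4
    have hs0 : (0 : ℝ) < s := by exact_mod_cast h1
    rw [Nat.mul_div_cancel_left _ hr'.1, primeProd_mul_of_coprime _ h4'.1.symm]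
    have : a s = primeProd (fun p => 6 / ((p : ℝ) - 6)) s *
        primeProd (fun p => 1 - 5 / ((p : ℝ) - 1) / (6 / p)) s := by
      rw [← primeProd_mul_fun]
      refine primeProd_congr h4'.2 fun p hp hpW => ?_
      have := hW' p hp hpW
      have h1 : (p : ℝ) - 6 ≠ 0 := by linarith
      have h2 : (p : ℝ) ≠ 0 := by linarith
      have h3 : (p : ℝ) - 1 ≠ 0 := by linarith
      field_simp
      ring
    rw [this, diagWeight, hlX, hl]
    push_cast
    rw [Real.log_mul hr0.ne' hs0.ne']
    ring
  have hlow : c * (l + 6 * l ^ 2 / Real.log x) ≤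
      ∑ s ∈ sqfCoprime (r * W) (x / r), a s + 12 / Real.log x *
          ∑ s ∈ sqfCoprime (r * W) (x / r), a s * (Real.log (x / r) - Real.log s) ^ 1 := by
    have hq : r * W ≠ 0 := mul_ne_zero (by have := hr'.1; omega) hW0
    have h1 := log_le_sum_inv_totient hq (x := x / r) (by linarith)
    -- The bound for the sum of 1/φ has no error term, so C = 0 and partial summation loses nothing.
    have h2 := le_sum_sqfCoprime_mul_log_pow (r * W) a (c := c) (C := 0) hX (fun u hu _ => by
      have := log_le_sum_inv_totient hq (x := u) (by linarith)
      rw [sub_zero]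
      exact this) 1
    rw [hlX] at h1 h2
    rw [hlX]
    have h3 := mul_le_mul_of_nonneg_left h2 (show 0 ≤ 12 / Real.log x by positivity)
    have h4 : c * (l + 6 * l ^ 2 / Real.log x) = c * l + 12 / Real.log x *
        (c * l ^ (1 + 1) / ((1 : ℕ) + 1) - 0 * l ^ 1) := by
      push_cast
      field_simp
      ring
    rw [h4]
    exact add_le_add h1 h3
  rw [hinner]
  have hc0 : 0 ≤ c := (primeProd_one_sub_inv_pos _).le
  have hsq := pow_le_pow_left₀ (by positivity) hlow 2
  set S := ∑ s ∈ sqfCoprime (r * W) (x / r), a s + 12 / Real.log x *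
          ∑ s ∈ sqfCoprime (r * W) (x / r), a s * (Real.log (x / r) - Real.log s) ^ 1
  have hid : primeProd (fun p => 5 / ((p : ℝ) - 6)) r
      = primeProd (fun p => (5 / ((p : ℝ) - 1))⁻¹ - 1) r *
        (primeProd (fun p => -(5 / ((p : ℝ) - 1) / (6 / p))) r *
          primeProd (fun p => 6 / ((p : ℝ) - 6)) r) ^ 2 *
        primeProd (fun p => 1 - (p : ℝ)⁻¹) r ^ 2 := by
    simp only [sq, ← primeProd_mul_fun]
    refine primeProd_congr hr'.2.2.2 fun p hp hpW => ?_
    have := hW' p hp hpW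
    have h1 : (p : ℝ) - 6 ≠ 0 := by linarith
    have h2 : (p : ℝ) ≠ 0 := by linarith
    have h3 : (p : ℝ) - 1 ≠ 0 := by linarith
    field_simp
    ring
  have hnn : 0 ≤ primeProd (fun p => (5 / ((p : ℝ) - 1))⁻¹ - 1) r *
        (primeProd (fun p => -(5 / ((p : ℝ) - 1) / (6 / p))) r *
          primeProd (fun p => 6 / ((p : ℝ) - 6)) r) ^ 2 := by
    refine mul_nonneg (primeProd_nonneg hr'.2.2.2 fun p hp hpW => ?_) (sq_nonneg _)
    have := hW' p hp hpW
    rw [inv_div]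
    linarith
  calc _ = primeProd (fun p => (5 / ((p : ℝ) - 1))⁻¹ - 1) r *
        (primeProd (fun p => -(5 / ((p : ℝ) - 1) / (6 / p))) r *
          primeProd (fun p => 6 / ((p : ℝ) - 6)) r) ^ 2 *
        (c * (l + 6 * l ^ 2 / Real.log x)) ^ 2 := by
        rw [hid, hcsplit]
        ring
    _ ≤ _ * S ^ 2 := mul_le_mul_of_nonneg_left hsq hnn
    _ = _ := by ring

end SmoothGaps

/-! ### Chebyshev and Mertens estimates -/

namespace SmoothGaps
open Finset Nat.Prime
open Chebyshev (theta)

theorem log_factorial_eq_sum (N : ℕ) :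
    Real.log (N.factorial : ℝ)
      = ∑ p ∈ Nat.primesLE N, (N.factorial.factorization p : ℝ) * Real.log p := by
  rw [Real.log_nat_eq_sum_factorization, Finsupp.sum]
  refine sum_subset (fun p hp => ?_) (fun p _ hp => ?_)
  · rw [Nat.support_factorization] at hp
    have hp' := Nat.prime_of_mem_primeFactors hp
    exact Nat.mem_primesLE.2 ⟨(hp'.dvd_factorial).1 (Nat.dvd_of_mem_primeFactors hp), hp'⟩
  · rw [Finsupp.notMem_support_iff.1 hp]
    simp

/-- The exponent of p in N! is at most N/(p - 1), while log N! ≥ N log N - N by Stirling. -/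
theorem log_sub_one_le_sum_primes {N : ℕ} (hN : 1 ≤ N) :
    Real.log N - 1 ≤ ∑ p ∈ Nat.primesLE N, Real.log p / ((p : ℝ) - 1) := by
  have hNR : (0 : ℝ) < N := by exact_mod_cast hN
  have h1 := Stirling.le_log_factorial_stirling (n := N) (by omega)
  have h2 : 0 ≤ Real.log N := Real.log_natCast_nonneg N
  have h3 : 0 ≤ Real.log (2 * Real.pi) := Real.log_nonneg (by linarith [Real.pi_gt_three])
  have h4 : Real.log (N.factorial : ℝ) ≤ N * ∑ p ∈ Nat.primesLE N, Real.log p / ((p : ℝ) - 1) := by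
    rw [log_factorial_eq_sum, mul_sum]
    refine sum_le_sum fun p hp => ?_
    have hp' := Nat.prime_of_mem_primesLE hp
    have h5 := Nat.factorization_factorial_le_div_pred hp' N
    have hp1 : (0 : ℝ) < (p : ℝ) - 1 := sub_pos.2 (by exact_mod_cast hp'.one_lt)
    have h6 : (N.factorial.factorization p : ℝ) ≤ N / ((p : ℝ) - 1) := by
      refine le_trans (Nat.cast_le.2 h5) (Nat.cast_div_le.trans (le_of_eq ?_))
      rw [Nat.cast_sub hp'.one_le, Nat.cast_one]
    calc _ ≤ N / ((p : ℝ) - 1) * Real.log p :=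
          mul_le_mul_of_nonneg_right h6 (Real.log_natCast_nonneg p)
      _ = _ := by ring
  have h5 : N * (Real.log N - 1) ≤ N * ∑ p ∈ Nat.primesLE N, Real.log p / ((p : ℝ) - 1) := by
    linarith
  exact le_of_mul_le_mul_left h5 hNR

/-- The exponent of p in N! is at least ⌊N/p⌋ > N/p - 1. The loss is θ(N) ≤ N log 4, and N! ≤ N^N.
-/
theorem sum_primes_log_div_le {N : ℕ} (hN : 1 ≤ N) :
    ∑ p ∈ Nat.primesLE N, Real.log p / p ≤ Real.log N + Real.log 4 := by
  have hNR : (0 : ℝ) < N := by exact_mod_cast hN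
  have h1 : Real.log (N.factorial : ℝ) ≤ N * Real.log N := by
    rw [← Real.log_pow]
    exact Real.log_le_log (by exact_mod_cast N.factorial_pos)
      (by exact_mod_cast Nat.factorial_le_pow N)
  have h2 : ∑ p ∈ Nat.primesLE N, ((N : ℝ) / p - 1) * Real.log p ≤ Real.log (N.factorial : ℝ) := by
    rw [log_factorial_eq_sum]
    refine sum_le_sum fun p hp => ?_
    refine mul_le_mul_of_nonneg_right ?_ (Real.log_natCast_nonneg p)
    have hp' := Nat.prime_of_mem_primesLE hp
    have h3 : N / p ≤ N.factorial.factorization p := by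
      rw [Nat.factorization_factorial hp' (Nat.lt_succ_self _)]
      have hmem : 1 ∈ Ico 1 (Nat.log p N).succ := by
        rw [mem_Ico]
        exact ⟨le_rfl, Nat.succ_lt_succ (Nat.log_pos hp'.one_lt (Nat.le_of_mem_primesLE hp))⟩
      have := single_le_sum (f := fun i => N / p ^ i) (fun i _ => Nat.zero_le _) hmem
      simpa using this
    have h4 : (N : ℝ) / p - 1 ≤ ((N / p : ℕ) : ℝ) := by
      rw [sub_le_iff_le_add, div_le_iff₀ (by exact_mod_cast hp'.pos)]
      have := Nat.lt_div_mul_add (a := N) hp'.pos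
      have h : N ≤ (N / p + 1) * p := by linarith
      exact_mod_cast h
    exact h4.trans (by exact_mod_cast h3)
  have h3 : ∑ p ∈ Nat.primesLE N, ((N : ℝ) / p - 1) * Real.log p
      = N * (∑ p ∈ Nat.primesLE N, Real.log p / p) - theta N := by
    rw [Chebyshev.theta_eq_sum_primesLE_log, mul_sum, ← sum_sub_distrib]
    refine sum_congr rfl fun p _ => ?_
    ring
  have h4 := Chebyshev.theta_le_log4_mul_x hNR.le
  have h5 : N * (∑ p ∈ Nat.primesLE N, Real.log p / p) ≤ N * (Real.log N + Real.log 4) := by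
    linarith
  exact le_of_mul_le_mul_left h5 hNR

/-- From log n ≤ 2√n. The bound absorbs the replacement of p by p - 1 or p - 6 in Mertens' sums, and
the terms with a repeated prime in the recursion for the moments. -/
theorem exists_sum_log_div_sq_le : ∃ B : ℝ, 0 ≤ B ∧ ∀ S : Finset ℕ,
    ∑ n ∈ S, Real.log n / (n : ℝ) ^ 2 ≤ B := by
  have hs : Summable fun n : ℕ => 2 * (n : ℝ) ^ (-(3 / 2) : ℝ) :=
    (Real.summable_nat_rpow.2 (by norm_num)).mul_left 2
  refine ⟨∑' n : ℕ, 2 * (n : ℝ) ^ (-(3 / 2) : ℝ), tsum_nonneg fun n => by positivity,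
    fun S => ?_⟩
  refine (sum_le_sum fun n _ => ?_).trans (hs.sum_le_tsum S fun n _ => by positivity)
  rcases Nat.eq_zero_or_pos n with rfl | hn
  · norm_num
  have hnR : (0 : ℝ) < n := by exact_mod_cast hn
  have h := Real.log_le_rpow_div hnR.le (show (0 : ℝ) < 1 / 2 by norm_num)
  have h2 : (n : ℝ) ^ (-(3 / 2) : ℝ) = (n : ℝ) ^ (1 / 2 : ℝ) / (n : ℝ) ^ 2 := by
    rw [← Real.rpow_natCast (n : ℝ) 2, ← Real.rpow_sub hnR]
    norm_num
  rw [h2, ← mul_div_assoc]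
  refine div_le_div_of_nonneg_right ?_ (by positivity)
  linarith

theorem sum_primesLE_eq (N : ℕ) (F : ℕ → ℝ) :
    ∑ p ∈ Nat.primesLE N, F p = ∑ n ∈ Icc 1 N, if n.Prime then F n else 0 := by
  rw [← sum_filter]
  refine sum_congr ?_ fun _ _ => rfl
  ext p
  simp only [Nat.mem_primesLE, mem_filter, mem_Icc]
  exact ⟨fun h => ⟨⟨h.2.one_le, h.1⟩, h.2⟩, fun h => ⟨h.1.2, h.2⟩⟩

theorem log_floor_bounds {u : ℝ} (hu : 1 ≤ u) :
    Real.log u - Real.log 2 ≤ Real.log (⌊u⌋₊ : ℝ) ∧ Real.log (⌊u⌋₊ : ℝ) ≤ Real.log u := by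
  have h1 : 1 ≤ ⌊u⌋₊ := (Nat.one_le_floor_iff u).2 hu
  have h1R : (1 : ℝ) ≤ (⌊u⌋₊ : ℝ) := by exact_mod_cast h1
  have h2 := Nat.floor_le (zero_le_one.trans hu)
  have h3 := (Nat.lt_floor_add_one u).le
  refine ⟨?_, Real.log_le_log (by linarith) h2⟩
  rw [sub_le_iff_le_add, ← Real.log_mul (by linarith) (by norm_num)]
  exact Real.log_le_log (by linarith) (by linarith)

/-- Mertens' estimate for `∑ κ log p / (p - 6)` over the primes not dividing `W`. -/
theorem exists_mertens {W : ℕ} (hW0 : W ≠ 0) (hW : ∀ p, p.Prime → ¬ p ∣ W → 42 < p) :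
    ∃ C : ℝ, 0 ≤ C ∧ ∀ u : ℝ, 1 ≤ u →
      |∑ n ∈ Icc 1 ⌊u⌋₊, (if n.Prime ∧ ¬ n ∣ W then Real.log n / ((n : ℝ) - 6) else 0)
        - Real.log u| ≤ C := by
  obtain ⟨B, hB0, hB⟩ := exists_sum_log_div_sq_le
  set E := ∑ p ∈ W.primeFactors, Real.log p / ((p : ℝ) - 1) with hE
  have hE0 : 0 ≤ E := sum_nonneg fun p hp => by
    have := (Nat.prime_of_mem_primeFactors hp).one_lt
    have : (1 : ℝ) < p := by exact_mod_cast this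
    exact div_nonneg (Real.log_natCast_nonneg p) (by linarith)
  have hl2 : 0 ≤ Real.log 2 := Real.log_nonneg (by norm_num)
  have hl4 : 0 ≤ Real.log 4 := Real.log_nonneg (by norm_num)
  refine ⟨Real.log 4 + 12 * B + 1 + E + Real.log 2, by positivity, fun u hu => ?_⟩
  set N := ⌊u⌋₊
  have hN : 1 ≤ N := (Nat.one_le_floor_iff u).2 hu
  obtain ⟨hf1, hf2⟩ := log_floor_bounds hu
  have hS : ∑ n ∈ Icc 1 N, (if n.Prime ∧ ¬ n ∣ W then Real.log n / ((n : ℝ) - 6) else 0)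
      = ∑ p ∈ Nat.primesLE N with ¬ p ∣ W, Real.log p / ((p : ℝ) - 6) := by
    rw [sum_filter, sum_primesLE_eq]
    refine sum_congr rfl fun n _ => ?_
    by_cases h1 : n.Prime <;> simp [h1]
  rw [hS]
  have hmem : ∀ p ∈ (Nat.primesLE N).filter (fun p => ¬ p ∣ W), (42 : ℝ) < p := by
    intro p hp
    obtain ⟨h1, h2⟩ := mem_filter.1 hp
    exact_mod_cast hW p (Nat.prime_of_mem_primesLE h1) h2
  have hup : ∑ p ∈ Nat.primesLE N with ¬ p ∣ W, Real.log p / ((p : ℝ) - 6)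
      ≤ Real.log N + Real.log 4 + 12 * B := by
    calc _ ≤ ∑ p ∈ Nat.primesLE N with ¬ p ∣ W,
          (Real.log p / p + 12 * (Real.log p / (p : ℝ) ^ 2)) := by
          refine sum_le_sum fun p hp => ?_
          have h := hmem p hp
          have h3 : 0 ≤ Real.log p := Real.log_natCast_nonneg p
          -- This is 1/(p - 6) ≤ 1/p + 12/p², valid for p ≥ 12.
          have h4 : Real.log p / p + 12 * (Real.log p / (p : ℝ) ^ 2) - Real.log p / ((p : ℝ) - 6)
              = Real.log p * (6 * ((p : ℝ) - 12)) / ((p : ℝ) ^ 2 * ((p : ℝ) - 6)) := by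
            have : (p : ℝ) - 6 ≠ 0 := by linarith
            have : (p : ℝ) ≠ 0 := by linarith
            field_simp
            ring
          have h5 : 0 ≤ Real.log p * (6 * ((p : ℝ) - 12)) / ((p : ℝ) ^ 2 * ((p : ℝ) - 6)) :=
            div_nonneg (mul_nonneg h3 (by linarith)) (mul_nonneg (by positivity) (by linarith))
          linarith
      _ ≤ _ := by
          rw [sum_add_distrib, ← mul_sum]
          have h1 := hB ((Nat.primesLE N).filter fun p => ¬ p ∣ W)
          have h2 := sum_primes_log_div_le hN
          have h3 : ∑ p ∈ Nat.primesLE N with ¬ p ∣ W, Real.log p / (p : ℝ)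
              ≤ ∑ p ∈ Nat.primesLE N, Real.log p / (p : ℝ) :=
            sum_le_sum_of_subset_of_nonneg (filter_subset _ _) fun p _ _ =>
              div_nonneg (Real.log_natCast_nonneg p) (Nat.cast_nonneg p)
          linarith
  have hlow : Real.log N - 1 - E
      ≤ ∑ p ∈ Nat.primesLE N with ¬ p ∣ W, Real.log p / ((p : ℝ) - 6) := by
    have h1 := log_sub_one_le_sum_primes hN
    rw [← sum_filter_not_add_sum_filter _ (fun p => p ∣ W)] at h1
    have h2 : ∑ p ∈ Nat.primesLE N with p ∣ W, Real.log p / ((p : ℝ) - 1) ≤ E := by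
      refine sum_le_sum_of_subset_of_nonneg (fun p hp => ?_) fun p hp _ => ?_
      · obtain ⟨h3, h4⟩ := mem_filter.1 hp
        exact Nat.mem_primeFactors.2 ⟨Nat.prime_of_mem_primesLE h3, h4, hW0⟩
      · have := (Nat.prime_of_mem_primeFactors hp).one_lt
        have : (1 : ℝ) < p := by exact_mod_cast this
        exact div_nonneg (Real.log_natCast_nonneg p) (by linarith)
    have h3 : ∑ p ∈ Nat.primesLE N with ¬ p ∣ W, Real.log p / ((p : ℝ) - 1)
        ≤ ∑ p ∈ Nat.primesLE N with ¬ p ∣ W, Real.log p / ((p : ℝ) - 6) := by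
      refine sum_le_sum fun p hp => ?_
      have h := hmem p hp
      exact div_le_div_of_nonneg_left (Real.log_natCast_nonneg p) (by linarith) (by linarith)
    linarith
  rw [abs_le]
  constructor <;> linarith

/-- A weak lower bound form of the prime number theorem, at infinitely many integers. -/
theorem exists_le_theta {ε : ℝ} (hε : 0 < ε) (hε1 : ε < 1) (N₀ : ℕ) :
    ∃ N : ℕ, N₀ ≤ N ∧ (1 - ε) * N ≤ theta N := by
  by_contra! hcon
  obtain ⟨B, hB0, hB⟩ := exists_sum_log_div_sq_le
  set T : ℕ → ℝ := fun N => ∑ n ∈ Icc 1 N, if n.Prime then Real.log n / n else 0 with hT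
  have hTlow : ∀ N : ℕ, 1 ≤ N → Real.log N - 1 - 2 * B ≤ T N := by
    intro N hN
    have h1 := log_sub_one_le_sum_primes hN
    have h2 : ∑ p ∈ Nat.primesLE N, Real.log p / ((p : ℝ) - 1)
        ≤ ∑ p ∈ Nat.primesLE N, (Real.log p / p + 2 * (Real.log p / (p : ℝ) ^ 2)) := by
      refine sum_le_sum fun p hp => ?_
      have h2 : (2 : ℝ) ≤ p := by exact_mod_cast Nat.two_le_of_mem_primesLE hp
      have h3 : 0 ≤ Real.log p := Real.log_natCast_nonneg p
      have h4 : Real.log p / p + 2 * (Real.log p / (p : ℝ) ^ 2) - Real.log p / ((p : ℝ) - 1)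
          = Real.log p * ((p : ℝ) - 2) / ((p : ℝ) ^ 2 * ((p : ℝ) - 1)) := by
        have : (p : ℝ) - 1 ≠ 0 := by linarith
        have : (p : ℝ) ≠ 0 := by linarith
        field_simp
        ring
      have h5 : 0 ≤ Real.log p * ((p : ℝ) - 2) / ((p : ℝ) ^ 2 * ((p : ℝ) - 1)) :=
        div_nonneg (mul_nonneg h3 (by linarith)) (mul_nonneg (by positivity) (by linarith))
      linarith
    rw [sum_add_distrib, ← mul_sum, sum_primesLE_eq N (fun p => Real.log p / p)] at h2
    have := hB (Nat.primesLE N)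
    simp only [hT]
    linarith
  have hTsucc : ∀ N : ℕ, T (N + 1) - T N = (theta (N + 1 : ℕ) - theta N) / (N + 1) := by
    intro N
    rw [Chebyshev.theta_eq_sum_primesLE_log, Chebyshev.theta_eq_sum_primesLE_log,
      sum_primesLE_eq _ (fun p => Real.log p), sum_primesLE_eq _ (fun p => Real.log p)]
    simp only [hT]
    rw [sum_Icc_succ_top (by omega), sum_Icc_succ_top (by omega)]
    split_ifs <;> push_cast <;> ring
  -- By partial summation T(N) - θ(N)/(N + 1) is the sum of θ(n)/(n(n + 1)) over n ≤ N. If θ(n) < (1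
  -- - ε)n beyond N₀, it grows at most like (1 - ε) log N, against Mertens' lower bound log N -
  -- O(1).
  set V : ℕ → ℝ := fun N => T N - theta N / (N + 1) - (1 - ε) * Real.log (N + 1) with hV
  have hVanti : ∀ N : ℕ, N₀ ≤ N → V (N + 1) ≤ V N := by
    intro N hN
    have h1 := hcon (N + 1) (by omega)
    have h2 := hTsucc N
    have hN1 : (0 : ℝ) < (N : ℝ) + 1 := by positivity
    have h3 : 1 / ((N : ℝ) + 2) ≤ Real.log ((N : ℝ) + 2) - Real.log ((N : ℝ) + 1) := by
      rw [← Real.log_div (by positivity) (by positivity)]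
      have := Real.one_sub_inv_le_log_of_pos (show 0 < ((N : ℝ) + 2) / (N + 1) by positivity)
      refine le_trans (le_of_eq ?_) this
      field_simp
      ring
    have h4 : theta (N + 1 : ℕ) / (((N : ℝ) + 1) * (N + 2)) ≤ (1 - ε) * (1 / ((N : ℝ) + 2)) := by
      rw [div_le_iff₀ (by positivity)]
      have : (1 - ε) * (1 / ((N : ℝ) + 2)) * (((N : ℝ) + 1) * (N + 2)) = (1 - ε) * (N + 1) := by
        field_simp
      rw [this]
      push_cast at h1 ⊢
      exact h1.le
    have h5 : theta (N + 1 : ℕ) / (((N : ℝ) + 1) * (N + 2))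
        = theta (N + 1 : ℕ) / (N + 1) - theta (N + 1 : ℕ) / (N + 2) := by
      field_simp
      ring
    have h6 := mul_le_mul_of_nonneg_left h3 (show 0 ≤ 1 - ε by linarith)
    simp only [hV]
    rw [show ((N + 1 : ℕ) : ℝ) + 1 = (N : ℝ) + 2 by push_cast; ring]
    rw [sub_div] at h2
    linarith
  have hVle : ∀ N : ℕ, N₀ ≤ N → V N ≤ V N₀ := by
    intro N hN
    induction N, hN using Nat.le_induction with
    | base => exact le_rfl
    | succ n hn ih => exact (hVanti n hn).trans ih
  have hfin : ∀ N : ℕ, N₀ + 1 ≤ N →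
      ε * Real.log N ≤ V N₀ + 1 + 2 * B + 2 := by
    intro N hN
    have hNR : (1 : ℝ) ≤ N := by exact_mod_cast (show 1 ≤ N by omega)
    have h1 := hTlow N (by omega)
    have h2 := hVle N (by omega)
    have h3 := hcon N (by omega)
    have h4 : theta N / (N + 1) ≤ 1 := by
      rw [div_le_one (by positivity)]
      nlinarith
    have h5 : Real.log ((N : ℝ) + 1) ≤ Real.log N + 1 := by
      have h6 : Real.log ((N : ℝ) + 1) ≤ Real.log (N * 2) :=
        Real.log_le_log (by positivity) (by linarith)
      rw [Real.log_mul (by positivity) (by norm_num)] at h6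
      have := Real.log_two_lt_d9
      linarith
    have h6 : (1 - ε) * Real.log ((N : ℝ) + 1) ≤ (1 - ε) * (Real.log N + 1) :=
      mul_le_mul_of_nonneg_left h5 (by linarith)
    simp only [hV] at h2 ⊢
    linarith
  have htend : Filter.Tendsto (fun N : ℕ => ε * Real.log N) Filter.atTop Filter.atTop :=
    (Real.tendsto_log_atTop.comp tendsto_natCast_atTop_atTop).const_mul_atTop hε
  obtain ⟨N, hN1, hN2⟩ := ((htend.eventually_gt_atTop (V N₀ + 1 + 2 * B + 2)).and
    (Filter.eventually_ge_atTop (N₀ + 1))).exists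
  exact absurd (hfin N hN2) (not_le.2 hN1)

end SmoothGaps

/-! ### Logarithmic moments and their recursion -/

namespace SmoothGaps
open Finset

/-- Exchanging the sum over squarefree `r ≤ x` with the sum over the prime factors `p` of `r`. -/
theorem sum_sum_primeFactors (W : ℕ) (x : ℝ) (F : ℕ → ℕ → ℝ) :
    ∑ r ∈ sqfCoprime W x, ∑ p ∈ r.primeFactors, F r p
      = ∑ m ∈ sqfCoprime W x,
          ∑ p ∈ Icc 1 ⌊x / m⌋₊ with (p.Prime ∧ ¬ p ∣ W) ∧ ¬ p ∣ m, F (p * m) p := by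
  rw [sum_sigma', sum_sigma']
  refine sum_bij' (fun a _ => ⟨a.1 / a.2, a.2⟩) (fun a _ => ⟨a.2 * a.1, a.2⟩) ?_ ?_ ?_ ?_ ?_
  · rintro ⟨r, p⟩ h
    obtain ⟨hr, hp⟩ := mem_sigma.1 h
    simp only at hr hp
    have hpp := Nat.prime_of_mem_primeFactors hp
    obtain ⟨m, rfl⟩ := Nat.dvd_of_mem_primeFactors hp
    obtain ⟨h1, h2, h3, h4⟩ := mem_sqfCoprime.1 hr
    have hm0 : 0 < m := Nat.pos_of_mul_pos_left h1
    simp only [mem_sigma, mem_filter, mem_Icc]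
    rw [Nat.mul_div_cancel_left _ hpp.pos]
    refine ⟨sqfCoprime_of_dvd hr (dvd_mul_left _ _), ⟨hpp.one_le, ?_⟩,
      ⟨hpp, not_dvd_of_mem_primeFactors h4 hp⟩, ?_⟩
    · refine (Nat.le_floor_iff' hpp.ne_zero).2 ?_
      rw [le_div_iff₀ (by exact_mod_cast hm0)]
      exact_mod_cast h2
    · exact (hpp.coprime_iff_not_dvd).1 (Nat.coprime_of_squarefree_mul h3)
  · rintro ⟨m, p⟩ h
    simp only [mem_sigma, mem_filter, mem_Icc] at h
    obtain ⟨hm, ⟨h1, h2⟩, ⟨hpp, hpW⟩, hpm⟩ := h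
    obtain ⟨g1, g2, g3, g4⟩ := mem_sqfCoprime.1 hm
    have hm0 : (0 : ℝ) < m := by exact_mod_cast g1
    rw [Nat.le_floor_iff' hpp.ne_zero, le_div_iff₀ hm0] at h2
    refine mem_sigma.2 ⟨mem_sqfCoprime.2 ⟨Nat.mul_pos hpp.pos g1, by exact_mod_cast h2, ?_, ?_⟩, ?_⟩
    · exact (Nat.squarefree_mul ((hpp.coprime_iff_not_dvd).2 hpm)).2 ⟨hpp.squarefree, g3⟩
    · exact Nat.Coprime.mul_left ((hpp.coprime_iff_not_dvd).2 hpW) g4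
    · exact Nat.mem_primeFactors.2 ⟨hpp, dvd_mul_right _ _, (Nat.mul_pos hpp.pos g1).ne'⟩
  · rintro ⟨r, p⟩ h
    obtain ⟨hr, hp⟩ := mem_sigma.1 h
    simp only at hr hp ⊢
    rw [Nat.mul_div_cancel' (Nat.dvd_of_mem_primeFactors hp)]
  · rintro ⟨m, p⟩ h
    simp only [mem_sigma, mem_filter, mem_Icc] at h ⊢
    rw [Nat.mul_div_cancel_left _ h.2.2.1.1.pos]
  · rintro ⟨r, p⟩ h
    obtain ⟨hr, hp⟩ := mem_sigma.1 h
    simp only at hr hp ⊢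
    rw [Nat.mul_div_cancel' (Nat.dvd_of_mem_primeFactors hp)]

/-- The sums `∑ κ^ω(r) / ∏ (p - 6) * log (x / r) ^ j` over squarefree `r ≤ x` coprime to `W`. -/
noncomputable def moment (W : ℕ) (κ x : ℝ) (j : ℕ) : ℝ :=
  ∑ r ∈ sqfCoprime W x, primeProd (fun p => κ / ((p : ℝ) - 6)) r * (Real.log x - Real.log r) ^ j

theorem moment_zero (W : ℕ) (κ x : ℝ) :
    moment W κ x 0 = ∑ r ∈ sqfCoprime W x, primeProd (fun p => κ / ((p : ℝ) - 6)) r := by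
  simp [moment]

theorem log_sub_log_nonneg {W r : ℕ} {x : ℝ} (hr : r ∈ sqfCoprime W x) :
    0 ≤ Real.log x - Real.log r ∧ Real.log x - Real.log r ≤ Real.log x := by
  obtain ⟨h1, h2, _⟩ := mem_sqfCoprime.1 hr
  have : (1 : ℝ) ≤ r := by exact_mod_cast h1
  have h3 := Real.log_le_log (by linarith) h2
  have h4 := Real.log_nonneg this
  constructor <;> linarith

theorem primeProd_div_sub_six_nonneg {W r : ℕ} (hW : ∀ p, p.Prime → ¬ p ∣ W → 42 < p) {κ : ℝ}
    (hκ : 0 ≤ κ) (hr : r.Coprime W) : 0 ≤ primeProd (fun p => κ / ((p : ℝ) - 6)) r :=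
  primeProd_nonneg hr fun p hp hpW => by
    have : (42 : ℝ) < p := by exact_mod_cast hW p hp hpW
    exact div_nonneg hκ (by linarith)

theorem one_le_moment_zero {W : ℕ} (hW : ∀ p, p.Prime → ¬ p ∣ W → 42 < p) {κ x : ℝ}
    (hκ : 0 ≤ κ) (hx : 1 ≤ x) : 1 ≤ moment W κ x 0 := by
  rw [moment_zero]
  have := single_le_sum (f := fun r => primeProd (fun p => κ / ((p : ℝ) - 6)) r)
    (fun r hr => primeProd_div_sub_six_nonneg hW hκ (mem_sqfCoprime.1 hr).2.2.2)
    (one_mem_sqfCoprime (W := W) hx)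
  simpa using this

theorem log_eq_sum_primeFactors {r : ℕ} (hr : Squarefree r) :
    Real.log r = ∑ p ∈ r.primeFactors, Real.log p := by
  rw [← Real.log_prod (fun p hp => by
    exact_mod_cast (Nat.prime_of_mem_primeFactors hp).ne_zero), ← Nat.cast_prod,
    Nat.prod_primeFactors_of_squarefree hr]

/-- The recursion satisfied by the moments, a consequence of Mertens' estimate. -/
theorem exists_moment_recursion {W : ℕ} (hW0 : W ≠ 0) (hW : ∀ p, p.Prime → ¬ p ∣ W → 42 < p)
    {κ : ℝ} (hκ : 0 ≤ κ) : ∃ C : ℝ, 0 ≤ C ∧ ∀ x : ℝ, 1 ≤ x → ∀ j : ℕ,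
      |(1 + κ / (j + 1)) * moment W κ x (j + 1) - Real.log x * moment W κ x j|
        ≤ C * Real.log x ^ j * moment W κ x 0 := by
  obtain ⟨B, hB0, hB⟩ := exists_sum_log_div_sq_le
  obtain ⟨C, hC0, hC⟩ := exists_mertens hW0 hW
  refine ⟨κ * C + 4 * κ ^ 2 * B, by positivity, fun x hx j => ?_⟩
  set L := Real.log x with hL
  have hL0 : 0 ≤ L := Real.log_nonneg hx
  set D := sqfCoprime W x with hD
  set G : ℕ → ℝ := primeProd (fun p => κ / ((p : ℝ) - 6)) with hG
  have hG0 : ∀ r ∈ D, 0 ≤ G r := fun r hr =>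
    primeProd_div_sub_six_nonneg hW hκ (mem_sqfCoprime.1 hr).2.2.2
  set b : ℕ → ℝ := fun n => if n.Prime ∧ ¬ n ∣ W then Real.log n / ((n : ℝ) - 6) else 0 with hb
  have hb0 : ∀ n, 0 ≤ b n := by
    intro n
    simp only [hb]
    split_ifs with h
    · have : (42 : ℝ) < n := by exact_mod_cast hW n h.1 h.2
      exact div_nonneg (Real.log_natCast_nonneg n) (by linarith)
    · exact le_rfl
  have hmul : ∀ m p : ℕ, p.Prime → ¬ p ∣ m → G (p * m) = κ / ((p : ℝ) - 6) * G m := by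
    intro m p hp hpm
    simp only [hG]
    rw [primeProd_mul_of_coprime _ ((hp.coprime_iff_not_dvd).2 hpm), primeProd_prime _ hp]
  -- The left side is a sum of G(r) log r (L - log r)^j. Write log r as the sum of log p over p ∣ r,
  -- and r = pm with p ∤ m. The condition p ∤ m is removed and the terms with p ∣ m are subtracted.
  have hid : L * moment W κ x j - moment W κ x (j + 1)
      = κ * ∑ m ∈ D, G m * ∑ n ∈ Icc 1 ⌊x / m⌋₊, b n * (Real.log (x / m) - Real.log n) ^ j
        - κ * ∑ m ∈ D, G m * ∑ n ∈ Icc 1 ⌊x / m⌋₊ with n ∣ m,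
            b n * (Real.log (x / m) - Real.log n) ^ j := by
    have h1 : L * moment W κ x j - moment W κ x (j + 1)
        = ∑ r ∈ D, ∑ p ∈ r.primeFactors, G r * Real.log p * (L - Real.log r) ^ j := by
      unfold moment
      rw [mul_sum, ← sum_sub_distrib]
      refine sum_congr rfl fun r hr => ?_
      rw [← sum_mul, ← mul_sum, ← log_eq_sum_primeFactors (mem_sqfCoprime.1 hr).2.2.1]
      ring
    rw [h1, sum_sum_primeFactors, ← mul_sub, ← sum_sub_distrib, mul_sum]
    refine sum_congr rfl fun m hm => ?_
    obtain ⟨g1, g2, g3, g4⟩ := mem_sqfCoprime.1 hm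
    have hm0 : (0 : ℝ) < m := by exact_mod_cast g1
    rw [← mul_sub, ← sum_filter_not_add_sum_filter (Icc 1 ⌊x / m⌋₊) (fun n => n ∣ m),
      add_sub_cancel_right, mul_sum, mul_sum, ← filter_filter, filter_filter, sum_filter,
      sum_filter]
    refine sum_congr rfl fun p hp => ?_
    by_cases hpm : p ∣ m
    · simp [hpm]
    by_cases hpp : p.Prime ∧ ¬ p ∣ W
    · have hp0 : (p : ℝ) ≠ 0 := by exact_mod_cast hpp.1.ne_zero
      rw [if_pos ⟨hpp, hpm⟩, if_pos hpm, hmul m p hpp.1 hpm, hb]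
      simp only [hpp, not_false_eq_true, and_self, if_true]
      rw [Real.log_div (by linarith) hm0.ne', ← hL]
      push_cast
      rw [Real.log_mul hp0 hm0.ne']
      ring
    · simp [hpp, hb]
  -- By Mertens and partial summation the inner sum is log(x/m)^(j+1)/(j+1) up to C L^j; summed over
  -- m, this reproduces the moment of order j + 1.
  have hfirst : ∀ m ∈ D, |∑ n ∈ Icc 1 ⌊x / m⌋₊, b n * (Real.log (x / m) - Real.log n) ^ j
      - (L - Real.log m) ^ (j + 1) / (j + 1)| ≤ C * L ^ j := by
    intro m hm
    obtain ⟨g1, g2, g3, g4⟩ := mem_sqfCoprime.1 hm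
    have hm0 : (0 : ℝ) < m := by exact_mod_cast g1
    have hX : 1 ≤ x / m := by
      rw [le_div_iff₀ hm0]
      linarith
    have hlX : Real.log (x / m) = L - Real.log m := Real.log_div (by linarith) hm0.ne'
    obtain ⟨hl0, hl1⟩ := log_sub_log_nonneg hm
    have h1 := le_sum_mul_log_pow b (c := 1) (C := C) hX (fun u hu _ => by
      have := (abs_le.1 (hC u hu)).1
      linarith) j
    have h2 := sum_mul_log_pow_le b (c := 1) (C := C) hX (fun u hu _ => by
      have := (abs_le.1 (hC u hu)).2
      linarith) j
    have h3 : C * (L - Real.log m) ^ j ≤ C * L ^ j :=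
      mul_le_mul_of_nonneg_left (pow_le_pow_left₀ hl0 hl1 j) hC0
    rw [one_mul, hlX] at h1 h2
    rw [hlX, abs_le]
    constructor <;> linarith
  have hsecond0 : 0 ≤ ∑ m ∈ D, G m * ∑ n ∈ Icc 1 ⌊x / m⌋₊ with n ∣ m,
            b n * (Real.log (x / m) - Real.log n) ^ j := by
    refine sum_nonneg fun m hm => mul_nonneg (hG0 m hm) (sum_nonneg fun n hn => ?_)
    obtain ⟨hn1, _⟩ := mem_filter.1 hn
    rw [mem_Icc] at hn1
    refine mul_nonneg (hb0 n) (pow_nonneg (sub_nonneg.2 (Real.log_le_log ?_ ?_)) j)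
    · exact_mod_cast hn1.1
    · exact (Nat.le_floor_iff' (by omega)).1 hn1.2
  -- A prime p ∣ m brings a second factor 1/(p - 6), taken out of G(m), so the sum over p converges.
  have hsecond : ∑ m ∈ D, G m * ∑ n ∈ Icc 1 ⌊x / m⌋₊ with n ∣ m,
            b n * (Real.log (x / m) - Real.log n) ^ j
      ≤ L ^ j * (4 * κ * B * moment W κ x 0) := by
    have h1 : ∀ m ∈ D, G m * ∑ n ∈ Icc 1 ⌊x / m⌋₊ with n ∣ m,
            b n * (Real.log (x / m) - Real.log n) ^ j
        ≤ L ^ j * ∑ p ∈ m.primeFactors, G m * b p := by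
      intro m hm
      obtain ⟨g1, g2, g3, g4⟩ := mem_sqfCoprime.1 hm
      have hm0 : (1 : ℝ) ≤ m := by exact_mod_cast g1
      rw [← mul_sum, mul_left_comm]
      refine mul_le_mul_of_nonneg_left ?_ (hG0 m hm)
      rw [mul_sum]
      have h2 : ∀ n ∈ (Icc 1 ⌊x / m⌋₊).filter (fun n => n ∣ m),
          b n * (Real.log (x / m) - Real.log n) ^ j ≤ L ^ j * b n := by
        intro n hn
        obtain ⟨hn1, _⟩ := mem_filter.1 hn
        rw [mem_Icc] at hn1
        have hnR : (1 : ℝ) ≤ n := by exact_mod_cast hn1.1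
        have hnx : (n : ℝ) ≤ x / m := (Nat.le_floor_iff' (by omega)).1 hn1.2
        rw [mul_comm]
        refine mul_le_mul_of_nonneg_right (pow_le_pow_left₀ ?_ ?_ j) (hb0 n)
        · exact sub_nonneg.2 (Real.log_le_log (by linarith) hnx)
        · have h3 : Real.log (x / m) ≤ L :=
            Real.log_le_log (by linarith) (div_le_self (by linarith) hm0)
          have := Real.log_nonneg hnR
          linarith
      refine (sum_le_sum h2).trans ?_
      have h3 : ∑ n ∈ Icc 1 ⌊x / m⌋₊ with n ∣ m, L ^ j * b n
          = ∑ n ∈ (Icc 1 ⌊x / m⌋₊).filter (fun n => n ∣ m) with n.Prime, L ^ j * b n := by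
        refine (sum_filter_of_ne fun n _ hne => ?_).symm
        by_contra hnp
        exact hne (by simp [hb, hnp])
      rw [h3]
      refine sum_le_sum_of_subset_of_nonneg (fun n hn => ?_) fun n _ _ =>
        mul_nonneg (pow_nonneg hL0 j) (hb0 n)
      obtain ⟨h4, h5⟩ := mem_filter.1 hn
      exact Nat.mem_primeFactors.2 ⟨h5, (mem_filter.1 h4).2, by omega⟩
    refine (sum_le_sum h1).trans ?_
    rw [← mul_sum]
    refine mul_le_mul_of_nonneg_left ?_ (pow_nonneg hL0 j)
    rw [sum_sum_primeFactors, moment_zero, mul_sum]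
    refine sum_le_sum fun m hm => ?_
    -- The factor 4 comes from p - 6 ≥ p/2.
    have h2 : ∀ p ∈ (Icc 1 ⌊x / m⌋₊).filter (fun p => (p.Prime ∧ ¬ p ∣ W) ∧ ¬ p ∣ m),
        G (p * m) * b p ≤ 4 * κ * (Real.log p / (p : ℝ) ^ 2) * G m := by
      intro p hp
      obtain ⟨_, hpp, hpm⟩ := mem_filter.1 hp
      rw [hmul m p hpp.1 hpm, hb]
      simp only [hpp, not_false_eq_true, and_self, if_true]
      have h42 : (42 : ℝ) < p := by exact_mod_cast hW p hpp.1 hpp.2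
      rw [mul_right_comm]
      refine mul_le_mul_of_nonneg_right ?_ (hG0 m hm)
      have h3 : κ / ((p : ℝ) - 6) * (Real.log p / ((p : ℝ) - 6))
          = κ * Real.log p * (1 / ((p : ℝ) - 6) ^ 2) := by
        field_simp
      have h4 : 4 * κ * (Real.log p / (p : ℝ) ^ 2) = κ * Real.log p * (4 / (p : ℝ) ^ 2) := by
        field_simp
      rw [h3, h4]
      refine mul_le_mul_of_nonneg_left ?_ (mul_nonneg hκ (Real.log_natCast_nonneg p))
      rw [div_le_div_iff₀ (by nlinarith) (by positivity)]
      nlinarith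
    refine (sum_le_sum h2).trans ?_
    rw [← sum_mul, ← mul_sum]
    refine mul_le_mul_of_nonneg_right ?_ (hG0 m hm)
    exact mul_le_mul_of_nonneg_left (hB _) (by positivity)
  have hmain : |∑ m ∈ D, G m * ∑ n ∈ Icc 1 ⌊x / m⌋₊, b n * (Real.log (x / m) - Real.log n) ^ j
      - moment W κ x (j + 1) / (j + 1)| ≤ C * L ^ j * moment W κ x 0 := by
    rw [moment_zero, mul_sum, moment, sum_div, ← sum_sub_distrib]
    refine (abs_sum_le_sum_abs _ _).trans (sum_le_sum fun m hm => ?_)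
    rw [mul_div_assoc, ← mul_sub, abs_mul, abs_of_nonneg (hG0 m hm), mul_comm]
    exact mul_le_mul_of_nonneg_right (hfirst m hm) (hG0 m hm)
  set S₁ := ∑ m ∈ D, G m * ∑ n ∈ Icc 1 ⌊x / m⌋₊, b n * (Real.log (x / m) - Real.log n) ^ j
  set S₂ := ∑ m ∈ D, G m * ∑ n ∈ Icc 1 ⌊x / m⌋₊ with n ∣ m,
            b n * (Real.log (x / m) - Real.log n) ^ j
  have hexp : (1 + κ / (j + 1)) * moment W κ x (j + 1) - L * moment W κ x j
      = κ * S₂ - κ * (S₁ - moment W κ x (j + 1) / (j + 1)) := by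
    have : (1 + κ / (j + 1)) * moment W κ x (j + 1)
        = moment W κ x (j + 1) + κ * (moment W κ x (j + 1) / (j + 1)) := by ring
    rw [this]
    linarith
  rw [hexp]
  have h1 := mul_le_mul_of_nonneg_left hsecond hκ
  have h2 := mul_nonneg hκ hsecond0
  have h3 := mul_le_mul_of_nonneg_left hmain hκ
  calc |κ * S₂ - κ * (S₁ - moment W κ x (j + 1) / (j + 1))|
      ≤ |κ * S₂| + |κ * (S₁ - moment W κ x (j + 1) / (j + 1))| := abs_sub _ _
    _ = κ * S₂ + κ * |S₁ - moment W κ x (j + 1) / (j + 1)| := by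
        rw [abs_of_nonneg h2, abs_mul, abs_of_nonneg hκ]
    _ ≤ _ := by
        refine (add_le_add h1 h3).trans (le_of_eq ?_)
        ring

end SmoothGaps

/-! ### Comparison of dimensions six and five -/

namespace SmoothGaps
open Finset

/-- With `v` multiplicative, the divisor sum is a product of factors 1 + v(p). Expanding it moves
part of the density to an outer sum, which is how each change of density or dimension below is made.
-/
theorem sum_sqfCoprime_sum_divisors (W : ℕ) (x : ℝ) (u v : ℕ → ℝ) :
    ∑ r ∈ sqfCoprime W x, u r * ∑ a ∈ r.divisors, v a
      = ∑ a ∈ sqfCoprime W x, v a * ∑ s ∈ sqfCoprime (a * W) (x / a), u (a * s) := by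
  calc _ = ∑ r ∈ sqfCoprime W x, ∑ a ∈ r.divisors, v a * u r := by
        refine sum_congr rfl fun r _ => ?_
        rw [mul_sum]
        exact sum_congr rfl fun a _ => mul_comm _ _
    _ = ∑ a ∈ sqfCoprime W x, ∑ r ∈ sqfCoprime W x with a ∣ r, v a * u r := by
        refine sum_comm' fun r a => ?_
        simp only [mem_filter, Nat.mem_divisors]
        constructor
        · rintro ⟨hr, har, _⟩
          exact ⟨⟨hr, har⟩, sqfCoprime_of_dvd hr har⟩
        · rintro ⟨⟨hr, har⟩, _⟩
          exact ⟨hr, har, by have := mem_sqfCoprime.1 hr; omega⟩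
    _ = _ := by
        refine sum_congr rfl fun a ha => ?_
        rw [← mul_sum, sum_sqfCoprime_filter_dvd ha]

/-- The product expands into the sum over all divisors of the product of these primes, and every `e`
is such a divisor. -/
theorem sum_primeProd_le_prod (W : ℕ) (x : ℝ) (f : ℕ → ℝ)
    (hf : ∀ p, p.Prime → ¬ p ∣ W → 0 ≤ f p) :
    ∑ e ∈ sqfCoprime W x, primeProd f e
      ≤ ∏ p ∈ Icc 1 ⌊x⌋₊ with p.Prime ∧ ¬ p ∣ W, (1 + f p) := by
  set P := (Icc 1 ⌊x⌋₊).filter fun p => p.Prime ∧ ¬ p ∣ W with hP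
  have hPp : ∀ p ∈ P, p.Prime := fun p hp => (mem_filter.1 hp).2.1
  have hpf : (∏ p ∈ P, p).primeFactors = P := Nat.primeFactors_prod hPp
  have hsq : Squarefree (∏ p ∈ P, p) := by
    refine Finset.squarefree_prod_of_pairwise_isCoprime ?_ fun p hp => (hPp p hp).squarefree
    intro a ha b hb hab
    exact Nat.coprime_iff_isRelPrime.1 ((Nat.coprime_primes (hPp a ha) (hPp b hb)).2 hab)
  have hcop : (∏ p ∈ P, p).Coprime W := Nat.Coprime.prod_left fun p hp =>
    ((hPp p hp).coprime_iff_not_dvd).2 (mem_filter.1 hp).2.2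
  have h1 : ∏ p ∈ P, (1 + f p) = ∑ d ∈ (∏ p ∈ P, p).divisors, primeProd f d := by
    rw [sum_divisors_primeProd f hsq, primeProd, hpf]
  rw [h1]
  refine sum_le_sum_of_subset_of_nonneg (fun e he => ?_) fun e he _ => ?_
  · obtain ⟨g1, g2, g3, g4⟩ := mem_sqfCoprime.1 he
    refine Nat.mem_divisors.2 ⟨?_, hsq.ne_zero⟩
    rw [← Nat.prod_primeFactors_of_squarefree g3]
    refine prod_dvd_prod_of_subset _ _ _ fun p hp => ?_
    have hpp := Nat.prime_of_mem_primeFactors hp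
    refine mem_filter.2 ⟨mem_Icc.2 ⟨hpp.one_le, (Nat.le_floor_iff' hpp.ne_zero).2 ?_⟩, hpp,
      not_dvd_of_mem_primeFactors g4 hp⟩
    refine le_trans ?_ g2
    exact_mod_cast Nat.le_of_mem_primeFactors hp
  · exact primeProd_nonneg (hcop.coprime_dvd_left (Nat.dvd_of_mem_divisors he)) hf

/-- Here 6/(p(p - 6)) ≤ 12/p², and the sum of 1/n² over n > D₀ is at most 1/D₀. This is the price of
replacing p - 6 by p; it is close to 1 when D₀ is large. -/
theorem sum_primeProd_le_exp {W D₀ : ℕ} (h42 : 42 ≤ D₀) (hW : ∀ p, p.Prime → ¬ p ∣ W → D₀ < p)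
    (x : ℝ) : ∑ e ∈ sqfCoprime W x, primeProd (fun p => 6 / ((p : ℝ) * (p - 6))) e
      ≤ Real.exp (12 / D₀) := by
  have hW' : ∀ p, p.Prime → ¬ p ∣ W → (42 : ℝ) < p := fun p hp hpW => by
    exact_mod_cast h42.trans_lt (hW p hp hpW)
  have hf : ∀ p : ℕ, p.Prime → ¬ p ∣ W → 0 ≤ 6 / ((p : ℝ) * (p - 6)) := fun p hp hpW => by
    have := hW' p hp hpW
    exact div_nonneg (by norm_num) (mul_nonneg (by linarith) (by linarith))
  refine (sum_primeProd_le_prod W x _ hf).trans ?_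
  set P := (Icc 1 ⌊x⌋₊).filter fun p => p.Prime ∧ ¬ p ∣ W
  calc ∏ p ∈ P, (1 + 6 / ((p : ℝ) * (p - 6))) ≤ ∏ p ∈ P, Real.exp (6 / ((p : ℝ) * (p - 6))) := by
        refine prod_le_prod (fun p hp => ?_) fun p _ => ?_
        · obtain ⟨_, h1, h2⟩ := mem_filter.1 hp
          linarith [hf p h1 h2]
        · linarith [Real.add_one_le_exp (6 / ((p : ℝ) * (p - 6)))]
    _ = Real.exp (∑ p ∈ P, 6 / ((p : ℝ) * (p - 6))) := (Real.exp_sum _ _).symm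
    _ ≤ _ := by
        refine Real.exp_le_exp.2 ?_
        have h1 : ∑ p ∈ P, 6 / ((p : ℝ) * (p - 6)) ≤ ∑ p ∈ P, 12 * ((p : ℝ) ^ 2)⁻¹ := by
          refine sum_le_sum fun p hp => ?_
          obtain ⟨_, h1, h2⟩ := mem_filter.1 hp
          have := hW' p h1 h2
          rw [← div_eq_mul_inv, div_le_div_iff₀ (mul_pos (by linarith) (by linarith))
            (by positivity)]
          nlinarith
        -- The maximum keeps the range valid when ⌊x⌋ ≤ D₀.
        have h2 : ∑ p ∈ P, ((p : ℝ) ^ 2)⁻¹ ≤ ∑ p ∈ Ioc D₀ (max (D₀ + 1) ⌊x⌋₊), ((p : ℝ) ^ 2)⁻¹ := by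
          refine sum_le_sum_of_subset_of_nonneg (fun p hp => ?_) fun _ _ _ => by positivity
          obtain ⟨h0, h1, h2⟩ := mem_filter.1 hp
          rw [mem_Icc] at h0
          exact mem_Ioc.2 ⟨hW p h1 h2, h0.2.trans (le_max_right _ _)⟩
        have h3 := sum_Ioc_inv_sq_le_sub (α := ℝ) (k := D₀) (n := max (D₀ + 1) ⌊x⌋₊) (by omega)
          (le_trans (by omega) (le_max_left _ _))
        have h4 : (0 : ℝ) ≤ ((max (D₀ + 1) ⌊x⌋₊ : ℕ) : ℝ)⁻¹ := by positivity
        rw [← mul_sum] at h1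
        rw [div_eq_mul_inv]
        linarith

/-- For q ≥ 1 the block from Wq to W(q + 1) contains φ(W) integers coprime to W, with reciprocals at
most 1/(Wq). The integers below W give the crude extra term W. -/
theorem sum_inv_coprime_le {W : ℕ} (hW0 : 0 < W) {x : ℝ} (hx : 1 ≤ x) :
    ∑ c ∈ Icc 1 ⌊x⌋₊ with c.Coprime W, (c : ℝ)⁻¹
      ≤ primeProd (fun p => 1 - (p : ℝ)⁻¹) W * (1 + Real.log x) + W := by
  rw [primeProd_one_sub_inv_eq W hW0.ne',
    ← sum_filter_add_sum_filter_not _ (fun c => W ≤ c)]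
  have hWR : (0 : ℝ) < W := by exact_mod_cast hW0
  refine add_le_add ?_ ?_
  · rw [filter_filter]
    set F := (Icc 1 ⌊x⌋₊).filter fun c => c.Coprime W ∧ W ≤ c
    have hmaps : ∀ c ∈ F, c / W ∈ Icc 1 ⌊x⌋₊ := by
      intro c hc
      obtain ⟨h1, h2, h3⟩ := mem_filter.1 hc
      rw [mem_Icc] at *
      exact ⟨(Nat.one_le_div_iff hW0).2 h3, (Nat.div_le_self _ _).trans h1.2⟩
    rw [← sum_fiberwise_of_maps_to hmaps]
    calc _ ≤ ∑ q ∈ Icc 1 ⌊x⌋₊, (W.totient : ℝ) / W * (q : ℝ)⁻¹ := by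
          refine sum_le_sum fun q hq => ?_
          have hq0 : (0 : ℝ) < q := by exact_mod_cast (mem_Icc.1 hq).1
          have h1 : ∀ c ∈ F.filter (fun c => c / W = q), (c : ℝ)⁻¹ ≤ ((W : ℝ) * q)⁻¹ := by
            intro c hc
            have hc2 := (mem_filter.1 hc).2
            refine inv_anti₀ (by positivity) ?_
            have := Nat.mul_div_le c W
            rw [hc2] at this
            exact_mod_cast this
          refine (sum_le_card_nsmul _ _ _ h1).trans ?_
          rw [nsmul_eq_mul]
          have h2 : (F.filter fun c => c / W = q).card ≤ W.totient := by
            rw [← Nat.filter_coprime_Ico_eq_totient W (W * q)]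
            refine card_le_card fun c hc => ?_
            obtain ⟨h3, h4⟩ := mem_filter.1 hc
            obtain ⟨_, h5, _⟩ := mem_filter.1 h3
            refine mem_filter.2 ⟨mem_Ico.2 ?_, h5.symm⟩
            have h6 := Nat.div_add_mod c W
            have h7 := Nat.mod_lt c hW0
            rw [h4] at h6
            omega
          have h2R : ((F.filter fun c => c / W = q).card : ℝ) ≤ W.totient := by exact_mod_cast h2
          rw [mul_inv, ← mul_assoc, div_eq_mul_inv]
          gcongr
      _ ≤ _ := by
          rw [← mul_sum]
          exact mul_le_mul_of_nonneg_left (sum_inv_le_one_add_log hx) (by positivity)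
  · rw [filter_filter]
    set F := (Icc 1 ⌊x⌋₊).filter fun c => c.Coprime W ∧ ¬ W ≤ c
    have h1 : ∀ c ∈ F, (c : ℝ)⁻¹ ≤ 1 := by
      intro c hc
      have := (mem_Icc.1 (mem_filter.1 hc).1).1
      exact inv_le_one_of_one_le₀ (by exact_mod_cast this)
    refine (sum_le_card_nsmul _ _ _ h1).trans ?_
    rw [nsmul_eq_mul, mul_one]
    have h2 : F ⊆ range W := fun c hc => by
      have := (mem_filter.1 hc).2.2
      rw [mem_range]
      omega
    have := card_le_card h2
    rw [card_range] at this
    exact_mod_cast this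

/-- From 1/(p - 6) = (1/p)(1 + 6/(p - 6)): the second factor, expanded over divisors, gives a
convergent outer sum. -/
theorem sum_inv_sub_six_le {W D₀ : ℕ} (hW0 : 0 < W) (h42 : 42 ≤ D₀)
    (hW : ∀ p, p.Prime → ¬ p ∣ W → D₀ < p) {x : ℝ} (hx : 1 ≤ x) :
    ∑ b ∈ sqfCoprime W x, primeProd (fun p => ((p : ℝ) - 6)⁻¹) b
      ≤ Real.exp (12 / D₀) *
        (primeProd (fun p => 1 - (p : ℝ)⁻¹) W * (1 + Real.log x) + W) := by
  have hW' : ∀ p, p.Prime → ¬ p ∣ W → (42 : ℝ) < p := fun p hp hpW => by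
    exact_mod_cast h42.trans_lt (hW p hp hpW)
  have h1 : ∑ b ∈ sqfCoprime W x, primeProd (fun p => ((p : ℝ) - 6)⁻¹) b
      = ∑ b ∈ sqfCoprime W x, (b : ℝ)⁻¹ *
        ∑ e ∈ b.divisors, primeProd (fun p => 6 / ((p : ℝ) - 6)) e := by
    refine sum_congr rfl fun b hb => ?_
    obtain ⟨g1, g2, g3, g4⟩ := mem_sqfCoprime.1 hb
    rw [sum_divisors_primeProd _ g3, ← primeProd_natCast g3, primeProd, primeProd, primeProd,
      ← prod_inv_distrib, ← prod_mul_distrib]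
    refine prod_congr rfl fun p hp => ?_
    have := hW' p (Nat.prime_of_mem_primeFactors hp) (not_dvd_of_mem_primeFactors g4 hp)
    have h1 : (p : ℝ) - 6 ≠ 0 := by linarith
    have h2 : (p : ℝ) ≠ 0 := by linarith
    field_simp
    ring
  rw [h1, sum_sqfCoprime_sum_divisors]
  set K := primeProd (fun p => 1 - (p : ℝ)⁻¹) W * (1 + Real.log x) + W with hK
  have hK0 : 0 ≤ K := by
    have := (primeProd_one_sub_inv_pos W).le
    have := Real.log_nonneg hx
    positivity
  calc _ ≤ ∑ a ∈ sqfCoprime W x, primeProd (fun p => 6 / ((p : ℝ) * (p - 6))) a * K := by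
        refine sum_le_sum fun a ha => ?_
        obtain ⟨g1, g2, g3, g4⟩ := mem_sqfCoprime.1 ha
        have ha0 : (1 : ℝ) ≤ a := by exact_mod_cast g1
        have h2 : ∑ s ∈ sqfCoprime (a * W) (x / a), ((a * s : ℕ) : ℝ)⁻¹ ≤ (a : ℝ)⁻¹ * K := by
          simp only [Nat.cast_mul, mul_inv]
          rw [← mul_sum]
          refine mul_le_mul_of_nonneg_left (le_trans ?_ (sum_inv_coprime_le hW0 hx)) (by positivity)
          refine sum_le_sum_of_subset_of_nonneg (fun s hs => ?_) fun _ _ _ => by positivity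
          obtain ⟨k1, k2, k3, k4⟩ := mem_sqfCoprime.1 hs
          refine mem_filter.2 ⟨mem_Icc.2 ⟨k1, (Nat.le_floor_iff' (by omega)).2 ?_⟩,
            (Nat.coprime_mul_iff_right.1 k4).2⟩
          exact k2.trans (div_le_self (by linarith) ha0)
        have h3 : primeProd (fun p => 6 / ((p : ℝ) * (p - 6))) a
            = primeProd (fun p => 6 / ((p : ℝ) - 6)) a * (a : ℝ)⁻¹ := by
          rw [← primeProd_natCast g3]
          rw [primeProd, primeProd, primeProd, ← prod_inv_distrib, ← prod_mul_distrib]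
          refine prod_congr rfl fun p hp => ?_
          have := hW' p (Nat.prime_of_mem_primeFactors hp) (not_dvd_of_mem_primeFactors g4 hp)
          have h1 : (p : ℝ) - 6 ≠ 0 := by linarith
          have h2 : (p : ℝ) ≠ 0 := by linarith
          field_simp
        rw [h3, mul_assoc]
        refine mul_le_mul_of_nonneg_left h2 (primeProd_div_sub_six_nonneg
          (fun p hp hpW => h42.trans_lt (hW p hp hpW)) (by norm_num) g4)
    _ ≤ _ := by
        rw [← sum_mul]
        exact mul_le_mul_of_nonneg_right (sum_primeProd_le_exp h42 hW x) hK0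

/-- Comparison of the sums in dimensions six and five. -/
theorem moment_six_le {W D₀ : ℕ} (hW0 : 0 < W) (h42 : 42 ≤ D₀)
    (hW : ∀ p, p.Prime → ¬ p ∣ W → D₀ < p) {x : ℝ} (hx : 1 ≤ x) :
    moment W 6 x 0 ≤ Real.exp (12 / D₀) * (primeProd (fun p => 1 - (p : ℝ)⁻¹) W * moment W 5 x 1
      + (primeProd (fun p => 1 - (p : ℝ)⁻¹) W + W) * moment W 5 x 0) := by
  have hW42 : ∀ p, p.Prime → ¬ p ∣ W → 42 < p := fun p hp hpW => h42.trans_lt (hW p hp hpW)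
  have hW' : ∀ p, p.Prime → ¬ p ∣ W → (42 : ℝ) < p := fun p hp hpW => by
    exact_mod_cast hW42 p hp hpW
  -- Since 6 = 1 + 5, write r = as with 5^ω(a) on a. Summing over s ≤ x/a produces log(x/a), hence
  -- the first moment in dimension five.
  have h1 : moment W 6 x 0 = ∑ r ∈ sqfCoprime W x, primeProd (fun p => ((p : ℝ) - 6)⁻¹) r *
        ∑ a ∈ r.divisors, primeProd (fun _ => 5) a := by
    rw [moment_zero]
    refine sum_congr rfl fun r hr => ?_
    rw [sum_divisors_primeProd _ (mem_sqfCoprime.1 hr).2.2.1, ← primeProd_mul_fun]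
    congr 1
    ext p
    rw [div_eq_mul_inv]
    norm_num
    ring
  rw [h1, sum_sqfCoprime_sum_divisors]
  set c := primeProd (fun p => 1 - (p : ℝ)⁻¹) W
  have hR : Real.exp (12 / D₀) * (c * moment W 5 x 1 + (c + W) * moment W 5 x 0)
      = ∑ a ∈ sqfCoprime W x, primeProd (fun p => 5 / ((p : ℝ) - 6)) a *
        (Real.exp (12 / D₀) * (c * (1 + (Real.log x - Real.log a)) + W)) := by
    rw [moment_zero, moment, mul_sum, mul_sum, ← sum_add_distrib, mul_sum]
    refine sum_congr rfl fun a _ => ?_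
    ring
  rw [hR]
  refine sum_le_sum fun a ha => ?_
  obtain ⟨g1, g2, g3, g4⟩ := mem_sqfCoprime.1 ha
  have ha0 : (0 : ℝ) < a := by exact_mod_cast g1
  have hX : 1 ≤ x / a := by
    rw [le_div_iff₀ ha0]
    linarith
  have h2 : ∑ s ∈ sqfCoprime (a * W) (x / a), primeProd (fun p => ((p : ℝ) - 6)⁻¹) (a * s)
      ≤ primeProd (fun p => ((p : ℝ) - 6)⁻¹) a *
        (Real.exp (12 / D₀) * (c * (1 + (Real.log x - Real.log a)) + W)) := by
    have h3 : ∀ s ∈ sqfCoprime (a * W) (x / a), primeProd (fun p => ((p : ℝ) - 6)⁻¹) (a * s)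
        = primeProd (fun p => ((p : ℝ) - 6)⁻¹) a * primeProd (fun p => ((p : ℝ) - 6)⁻¹) s := by
      intro s hs
      obtain ⟨k1, k2, k3, k4⟩ := mem_sqfCoprime.1 hs
      exact primeProd_mul_of_coprime _ (Nat.coprime_mul_iff_right.1 k4).1.symm
    have hnn : ∀ s : ℕ, s.Coprime W → 0 ≤ primeProd (fun p => ((p : ℝ) - 6)⁻¹) s := fun s hs =>
      primeProd_nonneg hs fun p hp hpW => inv_nonneg.2 (by linarith [hW' p hp hpW])
    rw [sum_congr rfl h3, ← mul_sum]
    refine mul_le_mul_of_nonneg_left ?_ (hnn a g4)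
    rw [← Real.log_div (by linarith) ha0.ne']
    refine le_trans ?_ (sum_inv_sub_six_le hW0 h42 hW hX)
    refine sum_le_sum_of_subset_of_nonneg (fun s hs => ?_) fun s hs _ =>
      hnn s (mem_sqfCoprime.1 hs).2.2.2
    obtain ⟨k1, k2, k3, k4⟩ := mem_sqfCoprime.1 hs
    exact mem_sqfCoprime.2 ⟨k1, k2, k3, (Nat.coprime_mul_iff_right.1 k4).2⟩
  refine (mul_le_mul_of_nonneg_left h2 (by
    rw [primeProd_const]; positivity)).trans (le_of_eq ?_)
  rw [← mul_assoc, ← primeProd_mul_fun]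
  simp only [div_eq_mul_inv]

end SmoothGaps

/-! ### Limits of the moment ratios and the numerical inequality -/

namespace SmoothGaps
open Finset Filter Topology

/-- Divided by L^(j+1) M₀, where L = log x and M₀ is the moment of order 0, the recursion has an
error of C/L. Iterated from order 0, the limits are the products of i/(i + κ) for i ≤ j. -/
theorem tendsto_moment_succ {W : ℕ} (hW0 : W ≠ 0) (hW : ∀ p, p.Prime → ¬ p ∣ W → 42 < p)
    {κ : ℝ} (hκ : 0 ≤ κ) (j : ℕ) {l : ℝ}
    (h : Tendsto (fun x => moment W κ x j / (Real.log x ^ j * moment W κ x 0)) atTop (𝓝 l)) :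
    Tendsto (fun x => moment W κ x (j + 1) / (Real.log x ^ (j + 1) * moment W κ x 0)) atTop
      (𝓝 (l / (1 + κ / (j + 1)))) := by
  obtain ⟨C, hC0, hC⟩ := exists_moment_recursion hW0 hW hκ
  have hk : 0 < 1 + κ / ((j : ℝ) + 1) := by positivity
  have hzero : Tendsto (fun x => C / Real.log x) atTop (𝓝 0) :=
    Real.tendsto_log_atTop.const_div_atTop C
  have hdiff : Tendsto (fun x => (1 + κ / (j + 1)) *
      (moment W κ x (j + 1) / (Real.log x ^ (j + 1) * moment W κ x 0))
      - moment W κ x j / (Real.log x ^ j * moment W κ x 0)) atTop (𝓝 0) := by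
    refine squeeze_zero_norm' ?_ hzero
    filter_upwards [eventually_gt_atTop 1] with x hx
    have hL : 0 < Real.log x := Real.log_pos hx
    have hM : 0 < moment W κ x 0 := lt_of_lt_of_le one_pos (one_le_moment_zero hW hκ hx.le)
    have h1 : (1 + κ / (j + 1)) * (moment W κ x (j + 1) / (Real.log x ^ (j + 1) * moment W κ x 0))
        - moment W κ x j / (Real.log x ^ j * moment W κ x 0)
        = ((1 + κ / (j + 1)) * moment W κ x (j + 1) - Real.log x * moment W κ x j) /
          (Real.log x ^ (j + 1) * moment W κ x 0) := by
      rw [sub_div, mul_div_assoc, pow_succ]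
      congr 1
      field_simp
    rw [Real.norm_eq_abs, h1, abs_div, abs_of_pos (show 0 < Real.log x ^ (j + 1) * moment W κ x 0 by
      positivity), div_le_div_iff₀ (by positivity) hL]
    calc _ ≤ C * Real.log x ^ j * moment W κ x 0 * Real.log x :=
          mul_le_mul_of_nonneg_right (hC x hx.le j) hL.le
      _ = _ := by ring
  have h2 := (hdiff.add h).div_const (1 + κ / (j + 1))
  rw [zero_add] at h2
  refine h2.congr fun x => ?_
  field_simp
  ring

theorem tendsto_moment_zero {W : ℕ} (hW : ∀ p, p.Prime → ¬ p ∣ W → 42 < p)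
    {κ : ℝ} (hκ : 0 ≤ κ) :
    Tendsto (fun x => moment W κ x 0 / (Real.log x ^ 0 * moment W κ x 0)) atTop (𝓝 1) := by
  refine tendsto_const_nhds.congr' ?_
  filter_upwards [eventually_ge_atTop 1] with x hx
  have hM : 0 < moment W κ x 0 := lt_of_lt_of_le one_pos (one_le_moment_zero hW hκ hx)
  rw [pow_zero, one_mul, div_self hM.ne']

/-- The main terms of the sieve: the six sums over primes exceed the sum over all integers. -/
theorem eventually_main_terms {W D₀ : ℕ} (hW0 : 0 < W) (h42 : 3000 ≤ D₀)
    (hW : ∀ p, p.Prime → ¬ p ∣ W → D₀ < p) :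
    ∀ᶠ x in atTop, 1.004 * ∑ r ∈ sqfCoprime W x,
        primeProd (fun p => 6 / ((p : ℝ) - 6)) r * diagWeight x r ^ 2
      ≤ 2.96 * (primeProd (fun p => 1 - (p : ℝ)⁻¹) W *
        ∑ r ∈ sqfCoprime W x, primeProd (fun p => 5 / ((p : ℝ) - 6)) r *
          ((Real.log x - Real.log r) + 6 * (Real.log x - Real.log r) ^ 2 / Real.log x) ^ 2)
        / Real.log x := by
  have hW42 : ∀ p, p.Prime → ¬ p ∣ W → 42 < p := fun p hp hpW =>
    lt_of_le_of_lt (by omega) (hW p hp hpW)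
  set c := primeProd (fun p => 1 - (p : ℝ)⁻¹) W with hc
  have hc0 : 0 < c := primeProd_one_sub_inv_pos W
  set e := Real.exp (12 / D₀) with he
  -- This is the only place that requires D₀ as large as 3000.
  have he1 : e < 1.005 := by
    have h1 : (12 : ℝ) / D₀ ≤ 0.004 := by
      rw [div_le_iff₀ (by exact_mod_cast (show 0 < D₀ by omega))]
      have : (3000 : ℝ) ≤ D₀ := by exact_mod_cast h42
      linarith
    have h2 := Real.exp_bound_div_one_sub_of_interval (x := 0.004) (by norm_num) (by norm_num)
    exact (Real.exp_le_exp.2 h1).trans_lt (h2.trans_lt (by norm_num))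
  have h6 : (0 : ℝ) ≤ 6 := by norm_num
  have h5 : (0 : ℝ) ≤ 5 := by norm_num
  have s0 := tendsto_moment_zero hW42 h6
  have s1 := tendsto_moment_succ hW0.ne' hW42 h6 0 s0
  have s2 := tendsto_moment_succ hW0.ne' hW42 h6 1 s1
  have f0 := tendsto_moment_zero hW42 h5
  have f1 := tendsto_moment_succ hW0.ne' hW42 h5 0 f0
  have f2 := tendsto_moment_succ hW0.ne' hW42 h5 1 f1
  have f3 := tendsto_moment_succ hW0.ne' hW42 h5 2 f2
  have f4 := tendsto_moment_succ hW0.ne' hW42 h5 3 f3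
  set a : ℝ → ℕ → ℝ := fun x j => moment W 6 x j / (Real.log x ^ j * moment W 6 x 0)
  set b : ℝ → ℕ → ℝ := fun x j => moment W 5 x j / (Real.log x ^ j * moment W 5 x 0)
  -- In dimension six the limits of orders 1 and 2 are 1/7 and 1/28; the coefficients come from (1 +
  -- 12u)².
  have hA : Tendsto (fun x => 1 + 24 * a x 1 + 144 * a x 2) atTop (𝓝 (67 / 7)) := by
    exact (((s1.const_mul 24).const_add 1).add (s2.const_mul 144)).trans (le_of_eq (by norm_num))
  -- In dimension five the limits of orders 2, 3, 4 are 1/21, 1/56, 1/126; the coefficients come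
  -- from (u + 6u²)².
  have hB : Tendsto (fun x => b x 2 + 12 * b x 3 + 36 * b x 4) atTop (𝓝 (23 / 42)) := by
    exact ((f2.add (f3.const_mul 12)).add (f4.const_mul 36)).trans (le_of_eq (by norm_num))
  have hH : Tendsto (fun x => e * (c * b x 1 + (c + W) / Real.log x)) atTop
      (𝓝 (e * (c * (1 / 6) + 0))) := by
    refine ((f1.const_mul c).add (Real.tendsto_log_atTop.const_div_atTop (c + W))).const_mul e
      |>.congr' ?_ |>.trans (le_of_eq ?_)
    · exact Eventually.of_forall fun x => rfl
    · norm_num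
  have hcomb : Tendsto (fun x => 2.96 * (c * (b x 2 + 12 * b x 3 + 36 * b x 4))
      - 1.004 * (e * (c * b x 1 + (c + W) / Real.log x) * (1 + 24 * a x 1 + 144 * a x 2)))
      atTop (𝓝 (2.96 * (c * (23 / 42)) - 1.004 * (e * (c * (1 / 6) + 0) * (67 / 7)))) :=
    ((hB.const_mul c).const_mul 2.96).sub ((hH.mul hA).const_mul 1.004)
  -- This amounts to 2.96·23 > 1.004·1.005·67. For a weight 1 + tu in the ideal case, with 3 for
  -- 2.96 and 1 for the other two constants, the inequality holds exactly when t > 4; t = 12 is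
  -- close to the best choice.
  have hpos : 0 < 2.96 * (c * (23 / 42)) - 1.004 * (e * (c * (1 / 6) + 0) * (67 / 7)) := by
    have : 2.96 * (c * (23 / 42)) - 1.004 * (e * (c * (1 / 6) + 0) * (67 / 7))
        = c * (2.96 * 23 / 42 - 1.004 * e * 67 / 42) := by ring
    rw [this]
    refine mul_pos hc0 ?_
    norm_num at he1 ⊢
    linarith
  filter_upwards [hcomb.eventually_const_lt hpos, eventually_gt_atTop 1] with x hx hx1
  have hL : 0 < Real.log x := Real.log_pos hx1
  have hM6 : 0 < moment W 6 x 0 := lt_of_lt_of_le one_pos (one_le_moment_zero hW42 h6 hx1.le)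
  have hM5 : 0 < moment W 5 x 0 := lt_of_lt_of_le one_pos (one_le_moment_zero hW42 h5 hx1.le)
  have ha : ∀ j, moment W 6 x j = a x j * (Real.log x ^ j * moment W 6 x 0) := fun j =>
    (div_mul_cancel₀ _ (by positivity)).symm
  have hb : ∀ j, moment W 5 x j = b x j * (Real.log x ^ j * moment W 5 x 0) := fun j =>
    (div_mul_cancel₀ _ (by positivity)).symm
  have hSA : ∑ r ∈ sqfCoprime W x, primeProd (fun p => 6 / ((p : ℝ) - 6)) r * diagWeight x r ^ 2
      = (1 + 24 * a x 1 + 144 * a x 2) * moment W 6 x 0 := by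
    have : (1 + 24 * a x 1 + 144 * a x 2) * moment W 6 x 0
        = moment W 6 x 0 + 24 / Real.log x * moment W 6 x 1
          + 144 / Real.log x ^ 2 * moment W 6 x 2 := by
      rw [ha 1, ha 2]
      field_simp
    rw [this]
    unfold moment
    rw [mul_sum, mul_sum, ← sum_add_distrib, ← sum_add_distrib]
    refine sum_congr rfl fun r _ => ?_
    rw [diagWeight]
    field_simp
    ring
  have hSB : ∑ r ∈ sqfCoprime W x, primeProd (fun p => 5 / ((p : ℝ) - 6)) r *
        ((Real.log x - Real.log r) + 6 * (Real.log x - Real.log r) ^ 2 / Real.log x) ^ 2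
      = (b x 2 + 12 * b x 3 + 36 * b x 4) * (Real.log x ^ 2 * moment W 5 x 0) := by
    have : (b x 2 + 12 * b x 3 + 36 * b x 4) * (Real.log x ^ 2 * moment W 5 x 0)
        = moment W 5 x 2 + 12 / Real.log x * moment W 5 x 3
          + 36 / Real.log x ^ 2 * moment W 5 x 4 := by
      rw [hb 2, hb 3, hb 4]
      field_simp
    rw [this]
    unfold moment
    rw [mul_sum, mul_sum, ← sum_add_distrib, ← sum_add_distrib]
    refine sum_congr rfl fun r _ => ?_
    field_simp
    ring
  have hA0 : 0 ≤ 1 + 24 * a x 1 + 144 * a x 2 := by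
    have hnn : ∀ j, 0 ≤ a x j := fun j => by
      refine div_nonneg (sum_nonneg fun r hr => ?_) (by positivity)
      exact mul_nonneg (primeProd_div_sub_six_nonneg hW42 h6 (mem_sqfCoprime.1 hr).2.2.2)
        (pow_nonneg (log_sub_log_nonneg hr).1 j)
    have := hnn 1
    have := hnn 2
    positivity
  have hcmp : moment W 6 x 0
      ≤ e * (c * b x 1 + (c + W) / Real.log x) * (Real.log x * moment W 5 x 0) := by
    refine (moment_six_le hW0 (by omega) hW hx1.le).trans (le_of_eq ?_)
    change e * (c * moment W 5 x 1 + (c + W) * moment W 5 x 0) = _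
    rw [hb 1]
    field_simp
  rw [hSA, hSB]
  calc _ ≤ 1.004 * ((1 + 24 * a x 1 + 144 * a x 2) *
        (e * (c * b x 1 + (c + W) / Real.log x) * (Real.log x * moment W 5 x 0))) := by
        gcongr
    _ = 1.004 * (e * (c * b x 1 + (c + W) / Real.log x) * (1 + 24 * a x 1 + 144 * a x 2)) *
        (Real.log x * moment W 5 x 0) := by ring
    _ ≤ 2.96 * (c * (b x 2 + 12 * b x 3 + 36 * b x 4)) * (Real.log x * moment W 5 x 0) := by
        refine mul_le_mul_of_nonneg_right (by linarith) (by positivity)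
    _ = _ := by
        field_simp

end SmoothGaps

/-! ### Counting integers in the sieve's residue classes -/

namespace SmoothGaps
open Finset

theorem card_filter_range_mul {p m : ℕ} (hp : 0 < p) (hm : 0 < m) (hpm : p.Coprime m)
    (P Q : ℕ → Prop) [DecidablePred P] [DecidablePred Q]
    (hP : ∀ n, P (n % p) ↔ P n) (hQ : ∀ n, Q (n % m) ↔ Q n) :
    ((range (p * m)).filter fun n => P n ∧ Q n).card
      = ((range p).filter P).card * ((range m).filter Q).card := by
  rw [← card_product]
  refine card_bij (fun n _ => (n % p, n % m)) ?_ ?_ ?_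
  · intro n hn
    obtain ⟨_, h1, h2⟩ := mem_filter.1 hn
    exact mem_product.2 ⟨mem_filter.2 ⟨mem_range.2 (Nat.mod_lt _ hp), (hP n).2 h1⟩,
      mem_filter.2 ⟨mem_range.2 (Nat.mod_lt _ hm), (hQ n).2 h2⟩⟩
  · intro a ha b hb hab
    rw [Prod.mk.injEq] at hab
    have ha' := mem_range.1 (mem_filter.1 ha).1
    have hb' := mem_range.1 (mem_filter.1 hb).1
    have : a ≡ b [MOD p * m] := (Nat.modEq_and_modEq_iff_modEq_mul hpm).1 hab
    exact Nat.ModEq.eq_of_lt_of_lt this ha' hb'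
  · rintro ⟨u, v⟩ huv
    obtain ⟨hu, hv⟩ := mem_product.1 huv
    obtain ⟨hu1, hu2⟩ := mem_filter.1 hu
    obtain ⟨hv1, hv2⟩ := mem_filter.1 hv
    simp only [mem_range] at hu1 hu2 hv1 hv2
    obtain ⟨k, hk1, hk2⟩ := Nat.chineseRemainder hpm u v
    have e1 : k % (p * m) % p = u := by
      rw [Nat.mod_mul_right_mod]
      exact Eq.trans hk1 (Nat.mod_eq_of_lt hu1)
    have e2 : k % (p * m) % m = v := by
      rw [Nat.mod_mul_left_mod]
      exact Eq.trans hk2 (Nat.mod_eq_of_lt hv1)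
    refine ⟨k % (p * m), mem_filter.2 ⟨mem_range.2 (Nat.mod_lt _ (Nat.mul_pos hp hm)), ?_, ?_⟩, ?_⟩
    · rw [← hP, e1]
      exact hu2
    · rw [← hQ, e2]
      exact hv2
    · rw [e1, e2]

theorem prod_add_modEq (B : Finset ℕ) {n m k : ℕ} (h : n ≡ m [MOD k]) :
    ∏ b ∈ B, (n + b) ≡ ∏ b ∈ B, (m + b) [MOD k] := by
  induction B using Finset.induction_on with
  | empty => simp [Nat.ModEq.refl]
  | insert a s ha ih =>
    rw [prod_insert ha, prod_insert ha]
    exact (h.add_right a).mul ih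

theorem dvd_prod_add_mod (B : Finset ℕ) {n k d : ℕ} (hd : d ∣ k) :
    d ∣ ∏ b ∈ B, (n % k + b) ↔ d ∣ ∏ b ∈ B, (n + b) :=
  ((prod_add_modEq B (Nat.mod_modEq n k)).of_dvd hd).dvd_iff dvd_rfl

theorem card_roots_prime (B : Finset ℕ) {p : ℕ} (hp : p.Prime) (hB : ∀ b ∈ B, b < p) :
    ((range p).filter fun n => p ∣ ∏ b ∈ B, (n + b)).card = B.card := by
  symm
  -- The roots are the classes of -b, distinct since every b is less than p. The reduction modulo p
  -- matters only for b = 0.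
  refine card_bij (fun b _ => (p - b) % p) ?_ ?_ ?_
  · intro b hb
    refine mem_filter.2 ⟨mem_range.2 (Nat.mod_lt _ hp.pos), ?_⟩
    rw [dvd_prod_add_mod B dvd_rfl]
    refine dvd_trans ?_ (dvd_prod_of_mem _ hb)
    rw [Nat.sub_add_cancel (hB b hb).le]
  · intro a ha b hb hab
    have ha' := hB a ha
    have hb' := hB b hb
    rcases Nat.eq_zero_or_pos a with rfl | ha0 <;> rcases Nat.eq_zero_or_pos b with rfl | hb0
    · rfl
    · rw [Nat.sub_zero, Nat.mod_self, Nat.mod_eq_of_lt (by omega)] at hab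
      omega
    · rw [Nat.sub_zero, Nat.mod_self, Nat.mod_eq_of_lt (by omega)] at hab
      omega
    · rw [Nat.mod_eq_of_lt (by omega), Nat.mod_eq_of_lt (by omega)] at hab
      omega
  · intro n hn
    obtain ⟨h1, h2⟩ := mem_filter.1 hn
    rw [mem_range] at h1
    obtain ⟨b, hb, hdvd⟩ := (Prime.dvd_finsetProd_iff hp.prime _).1 h2
    have hb' := hB b hb
    refine ⟨b, hb, ?_⟩
    obtain ⟨k, hk⟩ := hdvd
    rcases Nat.eq_zero_or_pos n with rfl | hn0
    · have : b = 0 := by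
        rw [zero_add] at hk
        exact Nat.eq_zero_of_dvd_of_lt ⟨k, hk⟩ hb'
      rw [this, Nat.sub_zero, Nat.mod_self]
    · have hk1 : k = 1 := by
        have h3 : k < 2 := by
          by_contra h
          have : p * 2 ≤ p * k := Nat.mul_le_mul_left _ (by omega)
          omega
        have h4 : k ≠ 0 := by
          rintro rfl
          omega
        omega
      rw [hk1, mul_one] at hk
      rw [Nat.mod_eq_of_lt (by omega)]
      omega

/-- The residues modulo `q * W` in the class `ν` modulo `W` at which `q ∣ ∏ (n + b)`. -/
def residues (B : Finset ℕ) (W ν q : ℕ) : Finset ℕ :=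
  (range (q * W)).filter fun n => n ≡ ν [MOD W] ∧ q ∣ ∏ b ∈ B, (n + b)

theorem mod_mem_residues {B : Finset ℕ} {W ν q : ℕ} (hq : 0 < q) (hW : 0 < W) (n : ℕ) :
    n % (q * W) ∈ residues B W ν q ↔ n ≡ ν [MOD W] ∧ q ∣ ∏ b ∈ B, (n + b) := by
  unfold residues
  rw [mem_filter, mem_range, dvd_prod_add_mod B (dvd_mul_right q W)]
  have : n % (q * W) ≡ ν [MOD W] ↔ n ≡ ν [MOD W] := by
    unfold Nat.ModEq
    rw [Nat.mod_mul_left_mod]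
  rw [this]
  exact ⟨fun h => h.2, fun h => ⟨Nat.mod_lt _ (Nat.mul_pos hq hW), h⟩⟩

/-- By the Chinese remainder theorem, each prime factor of `q` contributes `B.card` roots and W a
single class. -/
theorem card_residues (B : Finset ℕ) {W : ℕ} (hW : 0 < W) (ν : ℕ) (q : ℕ) (hq : Squarefree q)
    (hqW : q.Coprime W) (hB : ∀ p, p.Prime → p ∣ q → ∀ b ∈ B, b < p) :
    (residues B W ν q).card = B.card ^ q.primeFactors.card := by
  induction q using induction_on_primes with
  | zero => exact absurd hq not_squarefree_zero
  | one =>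
    have : residues B W ν 1 = {ν % W} := by
      ext n
      simp only [residues, one_mul, mem_filter, mem_range, isUnit_one, IsUnit.dvd, and_true,
        mem_singleton]
      constructor
      · rintro ⟨h1, h2⟩
        rw [← Nat.mod_eq_of_lt h1]
        exact h2
      · rintro rfl
        exact ⟨Nat.mod_lt _ hW, Nat.mod_modEq _ _⟩
    rw [this]
    simp
  | prime_mul p a hp ih =>
    have hcop := Nat.coprime_of_squarefree_mul hq
    have ha := hq.squarefree_of_dvd (dvd_mul_left a p)
    have ha0 : 0 < a := Nat.pos_of_ne_zero ha.ne_zero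
    have haW : a.Coprime W := hqW.coprime_dvd_left (dvd_mul_left a p)
    have hpW : p.Coprime W := hqW.coprime_dvd_left (dvd_mul_right p a)
    have ih' := ih ha haW fun p' h1 h2 => hB p' h1 (h2.mul_left p)
    have h1 : residues B W ν (p * a) = (range (p * (a * W))).filter fun n =>
        (p ∣ ∏ b ∈ B, (n + b)) ∧ (n ≡ ν [MOD W] ∧ a ∣ ∏ b ∈ B, (n + b)) := by
      unfold residues
      rw [mul_assoc]
      refine filter_congr fun n _ => ?_
      constructor
      · rintro ⟨h1, h2⟩
        exact ⟨(dvd_mul_right p a).trans h2, h1, (dvd_mul_left a p).trans h2⟩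
      · rintro ⟨h1, h2, h3⟩
        exact ⟨h2, hcop.mul_dvd_of_dvd_of_dvd h1 h3⟩
    rw [h1, card_filter_range_mul hp.pos (Nat.mul_pos ha0 hW) (Nat.Coprime.mul_right hcop hpW)
      (fun n => p ∣ ∏ b ∈ B, (n + b)) (fun n => n ≡ ν [MOD W] ∧ a ∣ ∏ b ∈ B, (n + b))]
    · rw [card_roots_prime B hp (hB p hp (dvd_mul_right p a)), hcop.primeFactors_mul,
        card_union_of_disjoint hcop.disjoint_primeFactors, hp.primeFactors, card_singleton,
        pow_add, pow_one, ← ih', residues]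
    · intro n
      exact dvd_prod_add_mod B dvd_rfl
    · intro n
      rw [dvd_prod_add_mod B (dvd_mul_right a W)]
      unfold Nat.ModEq
      rw [Nat.mod_mul_left_mod]

theorem abs_card_Ioc_modEq_sub_le {Y N r : ℕ} (hYN : Y ≤ N) (hr : 0 < r) (v : ℕ) :
    |(((Ioc Y N).filter fun n => n ≡ v [MOD r]).card : ℝ) - ((N : ℝ) - Y) / r| ≤ 1 := by
  have h := Nat.Ioc_filter_modEq_card Y N hr v
  have hrQ : (0 : ℚ) < r := by exact_mod_cast hr
  have hmono : ⌊((Y : ℚ) - v) / r⌋ ≤ ⌊((N : ℚ) - v) / r⌋ := by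
    refine Int.floor_le_floor (div_le_div_of_nonneg_right ?_ hrQ.le)
    have : (Y : ℚ) ≤ N := by exact_mod_cast hYN
    linarith
  rw [max_eq_left (by linarith)] at h
  have h2 : |((((Ioc Y N).filter fun n => n ≡ v [MOD r]).card : ℤ) : ℚ) - ((N : ℚ) - Y) / r| ≤ 1 := by
    rw [h]
    push_cast
    have e : ((N : ℚ) - Y) / r = ((N : ℚ) - v) / r - ((Y : ℚ) - v) / r := by ring
    have a1 := Int.floor_le (((N : ℚ) - v) / r)
    have a2 := Int.lt_floor_add_one (((N : ℚ) - v) / r)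
    have a3 := Int.floor_le (((Y : ℚ) - v) / r)
    have a4 := Int.lt_floor_add_one (((Y : ℚ) - v) / r)
    rw [e, abs_le]
    constructor <;> linarith
  have h3 := (Rat.cast_le (K := ℝ)).2 h2
  push_cast at h3
  exact h3

/-- Splitting a count over the residue classes at which a divisibility condition holds. -/
theorem card_filter_dvd_eq_sum (B : Finset ℕ) {W ν q : ℕ} (hq : 0 < q) (hW : 0 < W)
    (T : Finset ℕ) :
    (T.filter fun n => n ≡ ν [MOD W] ∧ q ∣ ∏ b ∈ B, (n + b)).card
      = ∑ a ∈ residues B W ν q, (T.filter fun n => n ≡ a [MOD q * W]).card := by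
  have hmaps : ∀ n ∈ T.filter (fun n => n ≡ ν [MOD W] ∧ q ∣ ∏ b ∈ B, (n + b)),
      n % (q * W) ∈ residues B W ν q := fun n hn =>
    (mod_mem_residues hq hW n).2 (mem_filter.1 hn).2
  rw [card_eq_sum_card_fiberwise hmaps]
  refine sum_congr rfl fun a ha => congrArg card ?_
  ext n
  have ha' : a < q * W := mem_range.1 (mem_filter.1 ha).1
  simp only [mem_filter]
  constructor
  · rintro ⟨⟨h1, _⟩, h2⟩
    exact ⟨h1, by rw [Nat.ModEq, h2, Nat.mod_eq_of_lt ha']⟩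
  · rintro ⟨h1, h2⟩
    rw [Nat.ModEq, Nat.mod_eq_of_lt ha'] at h2
    exact ⟨⟨h1, (mod_mem_residues hq hW n).1 (h2 ▸ ha)⟩, h2⟩

/-- The sextuple of shifts. -/
def tuple : Finset ℕ := {0, 4, 6, 10, 12, 16}

theorem card_tuple : tuple.card = 6 := rfl

theorem le_of_mem_tuple {h : ℕ} (hh : h ∈ tuple) : h ≤ 16 := by
  simp only [tuple, mem_insert, mem_singleton] at hh
  omega

/-- The condition selects 6^ω(q) classes modulo qW, each counted with an error of at most 1. -/
theorem abs_card_dvd_sub_le {W ν q Y N : ℕ} (hW : 0 < W) (hYN : Y ≤ N) (hq : Squarefree q)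
    (hqW : q.Coprime W) (hq42 : ∀ p, p.Prime → ¬ p ∣ W → 42 < p) :
    |((((Ioc Y N).filter fun n => n ≡ ν [MOD W]).filter fun n =>
        q ∣ ∏ h ∈ tuple, (n + h)).card : ℝ)
      - (N - Y) / W * primeProd (fun p => 6 / (p : ℝ)) q| ≤ primeProd (fun _ => 6) q := by
  have hq0 : 0 < q := Nat.pos_of_ne_zero hq.ne_zero
  have hB : ∀ p, p.Prime → p ∣ q → ∀ b ∈ tuple, b < p := fun p hp hpq b hb => by
    have := hq42 p hp (not_dvd_of_mem_primeFactors hqW (Nat.mem_primeFactors.2 ⟨hp, hpq, hq0.ne'⟩))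
    have := le_of_mem_tuple hb
    omega
  have hcard := card_residues tuple hW ν q hq hqW hB
  rw [filter_filter, card_filter_dvd_eq_sum tuple hq0 hW]
  have h6 : primeProd (fun _ => 6) q = ((residues tuple W ν q).card : ℝ) := by
    rw [hcard, primeProd_const, card_tuple]
    push_cast
    rfl
  have hmain : (N - Y : ℝ) / W * primeProd (fun p => 6 / (p : ℝ)) q
      = ∑ _a ∈ residues tuple W ν q, ((N : ℝ) - Y) / (q * W : ℕ) := by
    rw [sum_const, nsmul_eq_mul, ← h6]
    have : primeProd (fun p => 6 / (p : ℝ)) q = primeProd (fun _ => 6) q / q := by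
      rw [← primeProd_natCast hq]
      unfold primeProd
      rw [← prod_div_distrib]
    rw [this]
    push_cast
    field_simp
  rw [hmain, Nat.cast_sum, ← sum_sub_distrib, h6]
  refine (abs_sum_le_sum_abs _ _).trans ?_
  refine (sum_le_card_nsmul _ _ 1 fun a _ =>
    abs_card_Ioc_modEq_sub_le hYN (Nat.mul_pos hq0 hW) a).trans ?_
  rw [nsmul_eq_mul, mul_one]

end SmoothGaps

/-! ### Counting primes in the sieve's residue classes -/

namespace SmoothGaps
open Finset

theorem abs_primesInClass_sub_le_maxPrimeError {q a : ℕ} (hq : 0 < q) (x : ℝ)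
    (ha : a.Coprime q) :
    |(primesInClass x q (a : ZMod q) : ℝ) - (Nat.primeCounting ⌊x⌋₊ : ℝ) / (Nat.totient q : ℝ)|
      ≤ maxPrimeError x q := by
  have : NeZero q := ⟨hq.ne'⟩
  have h := le_ciSup (f := fun a : (ZMod q)ˣ => |(primesInClass x q (a : ZMod q) : ℝ)
    - (Nat.primeCounting ⌊x⌋₊ : ℝ) / (Nat.totient q : ℝ)|) (Set.finite_range _).bddAbove
    (ZMod.unitOfCoprime a ha)
  rw [ZMod.coe_unitOfCoprime] at h
  exact h

theorem maxPrimeError_nonneg (x : ℝ) (q : ℕ) : 0 ≤ maxPrimeError x q :=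
  Real.iSup_nonneg fun _ => abs_nonneg _

/-- The trivial bound, which later pays for divisor-type weights on the moduli. -/
theorem maxPrimeError_le {q N : ℕ} (hq : 0 < q) :
    maxPrimeError (N : ℝ) q ≤ (N / q + 1) + N / (Nat.totient q : ℝ) := by
  have : NeZero q := ⟨hq.ne'⟩
  refine ciSup_le fun a => ?_
  obtain ⟨v, hv⟩ := ZMod.natCast_zmod_surjective (a : ZMod q)
  have h1 : (primesInClass (N : ℝ) q (a : ZMod q) : ℝ) ≤ N / q + 1 := by
    have h2 := (abs_le.1 (abs_card_Ioc_modEq_sub_le (Nat.zero_le N) hq v)).2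
    have h3 : primesInClass (N : ℝ) q (a : ZMod q)
        ≤ ((Ioc 0 N).filter fun n => n ≡ v [MOD q]).card := by
      refine card_le_card fun p hp => ?_
      simp only [Nat.floor_natCast, mem_filter, mem_Icc, mem_Ioc] at hp ⊢
      refine ⟨⟨by omega, hp.1.2⟩, ?_⟩
      rw [← ZMod.natCast_eq_natCast_iff, hv]
      exact hp.2.2
    have h4 : (primesInClass (N : ℝ) q (a : ZMod q) : ℝ)
        ≤ ((Ioc 0 N).filter fun n => n ≡ v [MOD q]).card := by exact_mod_cast h3
    push_cast at h2
    rw [sub_zero] at h2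
    linarith
  have h2 : (Nat.primeCounting ⌊(N : ℝ)⌋₊ : ℝ) / (Nat.totient q : ℝ)
      ≤ N / (Nat.totient q : ℝ) := by
    rw [Nat.floor_natCast]
    refine div_le_div_of_nonneg_right ?_ (Nat.cast_nonneg _)
    have := card_le_card (filter_subset Nat.Prime (Icc 1 N))
    rw [Nat.card_Icc, Nat.add_sub_cancel] at this
    rw [← Nat.primesLE_card_eq_primeCounting, Nat.primesLE_eq_filter_Icc_one]
    exact_mod_cast this
  have h3 : (0 : ℝ) ≤ primesInClass (N : ℝ) q (a : ZMod q) := Nat.cast_nonneg _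
  have h4 : (0 : ℝ) ≤ (Nat.primeCounting ⌊(N : ℝ)⌋₊ : ℝ) / (Nat.totient q : ℝ) := by positivity
  have h5 : (0 : ℝ) ≤ N / q + 1 := by positivity
  have h6 : (0 : ℝ) ≤ N / (Nat.totient q : ℝ) := by positivity
  rw [abs_le]
  constructor <;> linarith

/-- Counting the primes `n + i` with `n ∈ (Y, N]` in a residue class. -/
theorem abs_card_prime_class_sub_le {M a i Y N : ℕ} (hM : 0 < M) (ha : (a + i).Coprime M)
    (hi : i ≤ 16) :
    |((((Ioc Y N).filter fun n => (n + i).Prime).filter fun n => n ≡ a [MOD M]).card : ℝ)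
      - (Nat.primeCounting (N + i) : ℝ) / (Nat.totient M : ℝ)|
      ≤ maxPrimeError ((N + i : ℕ) : ℝ) M + (((Y : ℝ) + 16) / M + 1) := by
  have h1 := abs_primesInClass_sub_le_maxPrimeError hM ((N + i : ℕ) : ℝ) ha
  rw [Nat.floor_natCast] at h1
  set F := ((Ioc Y N).filter fun n => (n + i).Prime).filter fun n => n ≡ a [MOD M]
  set P := (Icc 1 (N + i)).filter fun p : ℕ => p.Prime ∧ (p : ZMod M) = ((a + i : ℕ) : ZMod M)
    with hP
  have hPc : primesInClass ((N + i : ℕ) : ℝ) M ((a + i : ℕ) : ZMod M) = P.card := by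
    unfold primesInClass
    rw [Nat.floor_natCast]
  have hF : F.card = (P.filter fun p => Y + i < p).card := by
    refine card_bij (fun n _ => n + i) ?_ ?_ ?_
    · intro n hn
      simp only [F, mem_filter, mem_Ioc] at hn
      simp only [P, mem_filter, mem_Icc]
      refine ⟨⟨⟨by omega, by omega⟩, hn.1.2, ?_⟩, by omega⟩
      rw [ZMod.natCast_eq_natCast_iff]
      exact hn.2.add_right i
    · intro x _ y _ h
      exact Nat.add_right_cancel h
    · intro p hp
      simp only [P, mem_filter, mem_Icc] at hp
      refine ⟨p - i, ?_, by omega⟩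
      have e : p - i + i = p := by omega
      simp only [F, mem_filter, mem_Ioc]
      rw [e]
      refine ⟨⟨⟨by omega, by omega⟩, hp.1.2.1⟩, ?_⟩
      have := hp.1.2.2
      rw [ZMod.natCast_eq_natCast_iff, ← e] at this
      exact Nat.ModEq.add_right_cancel' i this
  have hsplit := card_filter_add_card_filter_not (s := P) (fun p => Y + i < p)
  -- The primes up to Y + i, absent from the window, are bounded by all integers of the class.
  have hrest : ((P.filter fun p => ¬ Y + i < p).card : ℝ) ≤ ((Y : ℝ) + 16) / M + 1 := by
    have h2 := (abs_le.1 (abs_card_Ioc_modEq_sub_le (Nat.zero_le (Y + i)) hM (a + i))).2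
    have h3 : (P.filter fun p => ¬ Y + i < p).card
        ≤ ((Ioc 0 (Y + i)).filter fun n => n ≡ a + i [MOD M]).card := by
      refine card_le_card fun p hp => ?_
      simp only [P, mem_filter, mem_Icc, mem_Ioc, not_lt] at hp ⊢
      refine ⟨⟨by omega, hp.2⟩, ?_⟩
      rw [← ZMod.natCast_eq_natCast_iff]
      exact hp.1.2.2
    have h4 : ((P.filter fun p => ¬ Y + i < p).card : ℝ)
        ≤ ((Ioc 0 (Y + i)).filter fun n => n ≡ a + i [MOD M]).card := by exact_mod_cast h3
    have h5 : (((Y + i : ℕ) : ℝ) - (0 : ℕ)) / M ≤ ((Y : ℝ) + 16) / M := by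
      refine div_le_div_of_nonneg_right ?_ (Nat.cast_nonneg _)
      push_cast
      have : (i : ℝ) ≤ 16 := by exact_mod_cast hi
      linarith
    linarith
  have hPsum : (P.card : ℝ) = F.card + ((P.filter fun p => ¬ Y + i < p).card : ℝ) := by
    rw [hF]
    exact_mod_cast hsplit.symm
  rw [hPc, hPsum] at h1
  have h0 : (0 : ℝ) ≤ ((P.filter fun p => ¬ Y + i < p).card : ℝ) := Nat.cast_nonneg _
  rw [abs_le] at h1 ⊢
  constructor <;> linarith [h1.1, h1.2]

/-- A prime n + i with n > Y is larger than every prime factor of q, so q must divide the product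
over the other five shifts. This leaves 5^ω(q) classes a modulo qW. Each a + i is coprime to q,
because two shifts differ by at most 16 and the primes dividing q exceed 42. -/
theorem abs_card_prime_dvd_sub_le {W ν q Y N i : ℕ} (hW : 0 < W)
    (hq : Squarefree q) (hqW : q.Coprime W) (hq42 : ∀ p, p.Prime → ¬ p ∣ W → 42 < p)
    (hi : i ∈ tuple) (hν : (ν + i).Coprime W) (hqY : ∀ p, p.Prime → p ∣ q → p ≤ Y) :
    |(((((Ioc Y N).filter fun n => n ≡ ν [MOD W]).filter fun n => (n + i).Prime).filter fun n =>
        q ∣ ∏ h ∈ tuple, (n + h)).card : ℝ)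
      - (Nat.primeCounting (N + i) : ℝ) / (Nat.totient W : ℝ) *
        primeProd (fun p => 5 / ((p : ℝ) - 1)) q|
      ≤ primeProd (fun _ => 5) q *
        (maxPrimeError ((N + i : ℕ) : ℝ) (q * W) + (((Y : ℝ) + 16) / q + 1)) := by
  have hq0 : 0 < q := Nat.pos_of_ne_zero hq.ne_zero
  have hqp : ∀ p, p.Prime → p ∣ q → 42 < p := fun p hp hpq =>
    hq42 p hp (not_dvd_of_mem_primeFactors hqW (Nat.mem_primeFactors.2 ⟨hp, hpq, hq0.ne'⟩))
  set B := tuple.erase i with hB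
  have hBmem : ∀ b ∈ B, b ≠ i ∧ b ≤ 16 := fun b hb =>
    ⟨(mem_erase.1 hb).1, le_of_mem_tuple (mem_erase.1 hb).2⟩
  have hBcard : B.card = 5 := by rw [hB, card_erase_of_mem hi, card_tuple]
  have hcard := card_residues B hW ν q hq hqW fun p hp hpq b hb => by
    have := hqp p hp hpq
    have := (hBmem b hb).2
    omega
  have hset : (((Ioc Y N).filter fun n => n ≡ ν [MOD W]).filter fun n => (n + i).Prime).filter
        (fun n => q ∣ ∏ h ∈ tuple, (n + h))
      = ((Ioc Y N).filter fun n => (n + i).Prime).filter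
        fun n => n ≡ ν [MOD W] ∧ q ∣ ∏ b ∈ B, (n + b) := by
    ext n
    simp only [mem_filter, mem_Ioc]
    have key : Y < n → (n + i).Prime → (q ∣ ∏ h ∈ tuple, (n + h) ↔ q ∣ ∏ b ∈ B, (n + b)) := by
      intro hn hp
      rw [← mul_prod_erase tuple _ hi]
      refine ⟨fun h => ?_, fun h => h.mul_left _⟩
      refine Nat.Coprime.dvd_of_dvd_mul_left ?_ h
      refine ((hp.coprime_iff_not_dvd).2 fun hdvd => ?_).symm
      have := hqY _ hp hdvd
      omega
    constructor
    · rintro ⟨⟨⟨h1, h2⟩, h3⟩, h4⟩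
      exact ⟨⟨h1, h3⟩, h2, (key h1.1 h3).1 h4⟩
    · rintro ⟨⟨h1, h3⟩, h2, h4⟩
      exact ⟨⟨⟨h1, h2⟩, h3⟩, (key h1.1 h3).2 h4⟩
  rw [hset, card_filter_dvd_eq_sum B hq0 hW]
  have h5 : primeProd (fun _ => 5) q = ((residues B W ν q).card : ℝ) := by
    rw [hcard, primeProd_const, hBcard]
    push_cast
    rfl
  have hmain : (Nat.primeCounting (N + i) : ℝ) / (Nat.totient W : ℝ) *
        primeProd (fun p => 5 / ((p : ℝ) - 1)) q
      = ∑ _a ∈ residues B W ν q, (Nat.primeCounting (N + i) : ℝ) / (Nat.totient (q * W) : ℝ) := by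
    rw [sum_const, nsmul_eq_mul, ← h5]
    have h6 : (Nat.totient q : ℝ) = primeProd (fun p => (p : ℝ) - 1) q := by
      have h7 := primeProd_one_sub_inv_eq q hq0.ne'
      rw [eq_div_iff (by exact_mod_cast hq0.ne'), ← primeProd_natCast hq, ← primeProd_mul_fun] at h7
      rw [← h7]
      refine prod_congr rfl fun p hp => ?_
      have : (p : ℝ) ≠ 0 := by exact_mod_cast (Nat.prime_of_mem_primeFactors hp).ne_zero
      change (1 - (p : ℝ)⁻¹) * p = p - 1
      rw [sub_mul, one_mul, inv_mul_cancel₀ this]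
    have : primeProd (fun p => 5 / ((p : ℝ) - 1)) q = primeProd (fun _ => 5) q / Nat.totient q := by
      rw [h6]
      unfold primeProd
      rw [← prod_div_distrib]
    rw [this, Nat.totient_mul hqW]
    push_cast
    have : (Nat.totient q : ℝ) ≠ 0 := by exact_mod_cast (Nat.totient_pos.2 hq0).ne'
    have : (Nat.totient W : ℝ) ≠ 0 := by exact_mod_cast (Nat.totient_pos.2 hW).ne'
    field_simp
  rw [hmain, Nat.cast_sum, ← sum_sub_distrib, h5]
  refine (abs_sum_le_sum_abs _ _).trans ?_
  rw [← nsmul_eq_mul]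
  refine sum_le_card_nsmul _ _ _ fun a ha => ?_
  obtain ⟨_, ha1, ha2⟩ := mem_filter.1 ha
  have hcop : (a + i).Coprime (q * W) := by
    refine Nat.Coprime.mul_right ?_ ?_
    · refine Nat.coprime_of_dvd fun p hp h1 h2 => ?_
      obtain ⟨b, hb, hpb⟩ := (Prime.dvd_finsetProd_iff hp.prime _).1 (h2.trans ha2)
      obtain ⟨hbi, hb16⟩ := hBmem b hb
      have hi16 := le_of_mem_tuple hi
      have h42 := hqp p hp h2
      rcases Nat.lt_or_gt_of_ne hbi with h | h
      · have h3 := Nat.dvd_sub h1 hpb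
        have := Nat.le_of_dvd (by omega) h3
        omega
      · have h3 := Nat.dvd_sub hpb h1
        have := Nat.le_of_dvd (by omega) h3
        omega
    · have := (ha1.add_right i).gcd_eq
      rw [Nat.Coprime, this]
      exact hν
  refine (abs_card_prime_class_sub_le (Nat.mul_pos hq0 hW) hcop (le_of_mem_tuple hi)).trans ?_
  have : ((Y : ℝ) + 16) / (q * W : ℕ) ≤ ((Y : ℝ) + 16) / q := by
    refine div_le_div_of_nonneg_left (by positivity) (by exact_mod_cast hq0) ?_
    exact_mod_cast Nat.le_mul_of_pos_right q hW
  linarith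

end SmoothGaps

/-! ### Divisor sums, size of the coefficients and opening of the square -/

namespace SmoothGaps
open Finset

/-- Since (m + 1)^ω(d) is the sum of m^ω(a) over a ∣ d, each unit of m costs one factor 1 + log x.
For m = 0 only d = 1 contributes. -/
theorem sum_natCast_pow_div_le (W : ℕ) {x : ℝ} (hx : 1 ≤ x) (m : ℕ) :
    ∑ d ∈ sqfCoprime W x, (d : ℝ)⁻¹ * primeProd (fun _ => (m : ℝ)) d ≤ (1 + Real.log x) ^ m := by
  induction m with
  | zero =>
    rw [pow_zero]
    rw [sum_eq_single 1]
    · simp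
    · intro d _ hd1
      rcases Nat.eq_zero_or_pos d with rfl | hd0
      · simp
      · obtain ⟨p, hp, hpd⟩ := Nat.exists_prime_and_dvd hd1
        rw [primeProd, prod_eq_zero (Nat.mem_primeFactors.2 ⟨hp, hpd, hd0.ne'⟩) Nat.cast_zero,
          mul_zero]
    · intro h
      exact absurd (one_mem_sqfCoprime hx) h
  | succ m ih =>
    have hL : 0 ≤ Real.log x := Real.log_nonneg hx
    have h1 : ∑ d ∈ sqfCoprime W x, (d : ℝ)⁻¹ * primeProd (fun _ => ((m + 1 : ℕ) : ℝ)) d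
        = ∑ d ∈ sqfCoprime W x, (d : ℝ)⁻¹ * ∑ a ∈ d.divisors, primeProd (fun _ => (m : ℝ)) a := by
      refine sum_congr rfl fun d hd => ?_
      rw [sum_divisors_primeProd _ (mem_sqfCoprime.1 hd).2.2.1]
      push_cast
      rw [add_comm]
    rw [h1, sum_sqfCoprime_sum_divisors _ _ fun d => (d : ℝ)⁻¹, pow_succ]
    refine le_trans ?_ (mul_le_mul_of_nonneg_right ih (by positivity))
    rw [sum_mul]
    refine sum_le_sum fun a ha => ?_
    have ha1 : (1 : ℝ) ≤ a := by exact_mod_cast (mem_sqfCoprime.1 ha).1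
    have h2 : ∑ s ∈ sqfCoprime (a * W) (x / a), ((a * s : ℕ) : ℝ)⁻¹
        ≤ (a : ℝ)⁻¹ * (1 + Real.log x) := by
      simp only [Nat.cast_mul, mul_inv]
      rw [← mul_sum]
      refine mul_le_mul_of_nonneg_left (le_trans ?_ (sum_inv_le_one_add_log hx)) (by positivity)
      refine sum_le_sum_of_subset_of_nonneg (fun s hs => ?_) fun _ _ _ => by positivity
      obtain ⟨k1, k2, _⟩ := mem_sqfCoprime.1 hs
      exact mem_Icc.2 ⟨k1, (Nat.le_floor_iff' (by omega)).2
        (k2.trans (div_le_self (by linarith) ha1))⟩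
    have h3 : 0 ≤ primeProd (fun _ => (m : ℝ)) a := by
      rw [primeProd_const]
      positivity
    calc _ ≤ primeProd (fun _ => (m : ℝ)) a * ((a : ℝ)⁻¹ * (1 + Real.log x)) :=
          mul_le_mul_of_nonneg_left h2 h3
      _ = _ := by ring

/-- The threshold 42 comes from here: 6/(p - 6) ≤ 7/p is equivalent to p ≥ 42. -/
theorem moment_six_zero_le {W : ℕ} (hW : ∀ p, p.Prime → ¬ p ∣ W → 42 < p) {x : ℝ} (hx : 1 ≤ x) :
    moment W 6 x 0 ≤ (1 + Real.log x) ^ 7 := by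
  refine le_trans ?_ (sum_natCast_pow_div_le W hx 7)
  rw [moment_zero]
  refine sum_le_sum fun r hr => ?_
  obtain ⟨g1, g2, g3, g4⟩ := mem_sqfCoprime.1 hr
  have h1 : (r : ℝ)⁻¹ * primeProd (fun _ => ((7 : ℕ) : ℝ)) r = primeProd (fun p => 7 / (p : ℝ)) r := by
    rw [← primeProd_natCast g3]
    unfold primeProd
    rw [← prod_inv_distrib, ← prod_mul_distrib]
    refine prod_congr rfl fun p _ => ?_
    push_cast
    ring
  rw [h1]
  have h42 : ∀ p : ℕ, p.Prime → ¬ p ∣ W → (43 : ℝ) ≤ p := fun p hp hpW => by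
    exact_mod_cast hW p hp hpW
  refine primeProd_le_primeProd g4 (fun p hp hpW => ?_) fun p hp hpW => ?_
  · have := h42 p hp hpW
    exact div_nonneg (by norm_num) (by linarith)
  · have := h42 p hp hpW
    rw [div_le_div_iff₀ (by linarith) (by linarith)]
    linarith

theorem diagWeight_bounds {W m : ℕ} {x : ℝ} (hm : m ∈ sqfCoprime W x) :
    1 ≤ diagWeight x m ∧ diagWeight x m ≤ 13 := by
  obtain ⟨h1, h2⟩ := log_sub_log_nonneg hm
  have h3 : 0 ≤ Real.log x := h1.trans h2
  have h4 := div_nonneg h1 h3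
  have h5 := div_le_one_of_le₀ h2 h3
  unfold diagWeight
  constructor <;> linarith

/-- Let H be the sum of h over the whole range. The inner sum is at most 13 h(d) H, the weight being
at most 13. Also h(d)/g(d) = ∏ (1 + 6/(p - 6)) is the sum of h over the divisors of d, hence at most
H. Finally H ≤ (1 + log x)^7. -/
theorem abs_tupleCoeff_le {W d : ℕ} (hW : ∀ p, p.Prime → ¬ p ∣ W → 42 < p) {x : ℝ}
    (hx : 1 ≤ x) (hd : d ∈ sqfCoprime W x) :
    |tupleCoeff W x d| ≤ 13 * (1 + Real.log x) ^ 14 := by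
  obtain ⟨g1, g2, g3, g4⟩ := mem_sqfCoprime.1 hd
  have hW' : ∀ p, p.Prime → ¬ p ∣ W → (42 : ℝ) < p := fun p hp hpW => by
    exact_mod_cast hW p hp hpW
  set H := moment W 6 x 0 with hH
  have hH1 : 1 ≤ H := one_le_moment_zero hW (by norm_num) hx
  set h := primeProd fun p => 6 / ((p : ℝ) - 6) with hh
  have hh0 : ∀ m : ℕ, m.Coprime W → 0 ≤ h m := fun m hm =>
    primeProd_div_sub_six_nonneg hW (by norm_num) hm
  have hg0 : 0 < primeProd (fun p => 6 / (p : ℝ)) d := primeProd_pos g4 fun p hp _ => by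
    have : (0 : ℝ) < p := by exact_mod_cast hp.pos
    positivity
  have hsum : |∑ m ∈ sqfCoprime W x with d ∣ m, h m * diagWeight x m| ≤ 13 * (h d * H) := by
    calc _ ≤ ∑ m ∈ sqfCoprime W x with d ∣ m, 13 * h m := by
          refine (abs_sum_le_sum_abs _ _).trans (sum_le_sum fun m hm => ?_)
          have hm' := (mem_filter.1 hm).1
          obtain ⟨h1, h2⟩ := diagWeight_bounds hm'
          rw [abs_mul, abs_of_nonneg (hh0 m (mem_sqfCoprime.1 hm').2.2.2),
            abs_of_nonneg (by linarith), mul_comm]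
          exact mul_le_mul_of_nonneg_right h2 (hh0 m (mem_sqfCoprime.1 hm').2.2.2)
      _ ≤ _ := by
          rw [← mul_sum, sum_sqfCoprime_filter_dvd hd]
          refine mul_le_mul_of_nonneg_left ?_ (by norm_num)
          have h1 : ∀ s ∈ sqfCoprime (d * W) (x / d), h (d * s) = h d * h s := fun s hs =>
            primeProd_mul_of_coprime _
              (Nat.coprime_mul_iff_right.1 (mem_sqfCoprime.1 hs).2.2.2).1.symm
          rw [sum_congr rfl h1, ← mul_sum, hH, moment_zero]
          refine mul_le_mul_of_nonneg_left (sum_le_sum_of_subset_of_nonneg (fun s hs => ?_)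
            fun s hs _ => hh0 s (mem_sqfCoprime.1 hs).2.2.2) (hh0 d g4)
          obtain ⟨k1, k2, k3, k4⟩ := mem_sqfCoprime.1 hs
          exact mem_sqfCoprime.2 ⟨k1, k2.trans (div_le_self (by linarith) (by exact_mod_cast g1)),
            k3, (Nat.coprime_mul_iff_right.1 k4).2⟩
  have hratio : h d / primeProd (fun p => 6 / (p : ℝ)) d ≤ H := by
    have h1 : h d / primeProd (fun p => 6 / (p : ℝ)) d = ∑ e ∈ d.divisors, h e := by
      rw [hh, sum_divisors_primeProd _ g3, div_eq_iff hg0.ne', ← primeProd_mul_fun]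
      refine primeProd_congr g4 fun p hp hpW => ?_
      have := hW' p hp hpW
      have h1 : (p : ℝ) - 6 ≠ 0 := by linarith
      have h2 : (p : ℝ) ≠ 0 := by linarith
      field_simp
      ring
    rw [h1, hH, moment_zero]
    exact sum_le_sum_of_subset_of_nonneg
      (fun e he => sqfCoprime_of_dvd hd (Nat.dvd_of_mem_divisors he))
      fun s hs _ => hh0 s (mem_sqfCoprime.1 hs).2.2.2
  have hsign : |primeProd (fun _ => (-1 : ℝ)) d| = 1 := by
    rw [primeProd_const, abs_pow, abs_neg, abs_one, one_pow]
  unfold tupleCoeff sieveCoeff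
  rw [abs_mul, abs_div, hsign, abs_of_pos hg0]
  calc _ ≤ 1 / primeProd (fun p => 6 / (p : ℝ)) d * (13 * (h d * H)) :=
        mul_le_mul_of_nonneg_left hsum (by positivity)
    _ = 13 * (h d / primeProd (fun p => 6 / (p : ℝ)) d * H) := by ring
    _ ≤ 13 * (H * H) := by
        gcongr
    _ ≤ 13 * ((1 + Real.log x) ^ 7 * (1 + Real.log x) ^ 7) := by
        have := moment_six_zero_le hW hx
        have hL : 0 ≤ Real.log x := Real.log_nonneg hx
        gcongr
    _ = _ := by ring

theorem lcm_mem_sqfCoprime {W d e : ℕ} {x : ℝ} (hd : d ∈ sqfCoprime W x)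
    (he : e ∈ sqfCoprime W x) : d.lcm e ∈ sqfCoprime W (x ^ 2) := by
  obtain ⟨g1, g2, g3, g4⟩ := mem_sqfCoprime.1 hd
  obtain ⟨k1, k2, k3, k4⟩ := mem_sqfCoprime.1 he
  have hpos : 0 < d.lcm e := Nat.lcm_pos g1 k1
  refine mem_sqfCoprime.2 ⟨hpos, ?_, ?_, ?_⟩
  · have h1 : d.lcm e ≤ d * e := Nat.le_of_dvd (Nat.mul_pos g1 k1)
      (Nat.lcm_dvd (dvd_mul_right _ _) (dvd_mul_left _ _))
    have h2 : ((d.lcm e : ℕ) : ℝ) ≤ d * e := by exact_mod_cast h1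
    refine h2.trans ?_
    rw [sq]
    exact mul_le_mul g2 k2 (Nat.cast_nonneg _) (le_trans (Nat.cast_nonneg _) g2)
  · rw [Nat.squarefree_iff_factorization_le_one hpos.ne']
    intro p
    rw [Nat.factorization_lcm (by omega) (by omega), Finsupp.sup_apply]
    exact sup_le (g3.natFactorization_le_one p) (k3.natFactorization_le_one p)
  · exact Nat.Coprime.coprime_dvd_left (Nat.lcm_dvd (dvd_mul_right _ _) (dvd_mul_left _ _))
      (Nat.Coprime.mul_left g4 k4)

/-- A sum over pairs is bounded by a sum over their least common multiple. -/
theorem sum_sum_lcm_le {W : ℕ} {x : ℝ} (F : ℕ → ℝ) (hF : ∀ q ∈ sqfCoprime W (x ^ 2), 0 ≤ F q) :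
    ∑ d ∈ sqfCoprime W x, ∑ e ∈ sqfCoprime W x, F (d.lcm e)
      ≤ ∑ q ∈ sqfCoprime W (x ^ 2), primeProd (fun _ => 4) q * F q := by
  refine (sum_product _ _ fun a : ℕ × ℕ => F (a.1.lcm a.2)).symm.le.trans ?_
  have hmaps : ∀ a ∈ sqfCoprime W x ×ˢ sqfCoprime W x, a.1.lcm a.2 ∈ sqfCoprime W (x ^ 2) :=
    fun a h => lcm_mem_sqfCoprime (mem_product.1 h).1 (mem_product.1 h).2
  rw [← sum_fiberwise_of_maps_to hmaps]
  refine sum_le_sum fun q hq => ?_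
  obtain ⟨g1, g2, g3, g4⟩ := mem_sqfCoprime.1 hq
  have h1 : ∀ a ∈ (sqfCoprime W x ×ˢ sqfCoprime W x).filter (fun a => a.1.lcm a.2 = q),
      F (a.1.lcm a.2) ≤ F q := fun a ha => by rw [(mem_filter.1 ha).2]
  refine (sum_le_card_nsmul _ _ _ h1).trans ?_
  rw [nsmul_eq_mul]
  refine mul_le_mul_of_nonneg_right ?_ (hF q hq)
  -- Both entries of a pair with lcm q divide q, so there are at most 4^ω(q) pairs.
  have h2 : (sqfCoprime W x ×ˢ sqfCoprime W x).filter (fun a => a.1.lcm a.2 = q)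
      ⊆ q.divisors ×ˢ q.divisors := by
    rintro ⟨d, e⟩ h
    have h3 := (mem_filter.1 h).2
    simp only at h3
    exact mem_product.2 ⟨Nat.mem_divisors.2 ⟨h3 ▸ Nat.dvd_lcm_left d e, by omega⟩,
      Nat.mem_divisors.2 ⟨h3 ▸ Nat.dvd_lcm_right d e, by omega⟩⟩
  have h3 := card_le_card h2
  rw [card_product] at h3
  have h4 : (q.divisors.card : ℝ) = primeProd (fun _ => 2) q := by
    have := sum_divisors_primeProd (fun _ => 1) g3
    simp only [primeProd_const, one_pow, sum_const, nsmul_eq_mul, mul_one] at this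
    rw [this, primeProd_const]
    norm_num
  have h5 : primeProd (fun _ => 4) q = primeProd (fun _ => 2) q * primeProd (fun _ => 2) q := by
    rw [← primeProd_mul_fun]
    norm_num
  rw [h5, ← h4]
  exact_mod_cast h3

/-- The square of a divisor sum, opened. -/
theorem sum_sq_divisor_sum (T D : Finset ℕ) (l : ℕ → ℝ) (A : ℕ → ℕ) :
    ∑ n ∈ T, (∑ d ∈ D with d ∣ A n, l d) ^ 2
      = ∑ d ∈ D, ∑ e ∈ D, l d * l e * ((T.filter fun n => d.lcm e ∣ A n).card : ℝ) := by
  have h1 : ∀ n ∈ T, (∑ d ∈ D with d ∣ A n, l d) ^ 2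
      = ∑ d ∈ D, ∑ e ∈ D, l d * l e * (if d.lcm e ∣ A n then 1 else 0) := by
    intro n _
    rw [sq, sum_mul_sum, sum_filter]
    refine sum_congr rfl fun d _ => ?_
    split_ifs with hd
    · rw [sum_filter]
      refine sum_congr rfl fun e _ => ?_
      by_cases he : e ∣ A n
      · simp [Nat.lcm_dvd hd he, he]
      · have : ¬ d.lcm e ∣ A n := fun h => he ((Nat.dvd_lcm_right d e).trans h)
        simp [this, he]
    · refine (sum_eq_zero fun e _ => ?_).symm
      have : ¬ d.lcm e ∣ A n := fun h => hd ((Nat.dvd_lcm_left d e).trans h)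
      simp [this]
  rw [sum_congr rfl h1, sum_comm]
  refine sum_congr rfl fun d _ => ?_
  rw [sum_comm]
  refine sum_congr rfl fun e _ => ?_
  rw [← mul_sum, sum_boole]

/-- The sieve weights summed over a set in which divisibility has density `g`. -/
theorem abs_sum_weights_sub_le {W : ℕ} (hW : ∀ p, p.Prime → ¬ p ∣ W → 42 < p) {x : ℝ}
    (hx : 1 ≤ x) (T : Finset ℕ) (A : ℕ → ℕ) (X : ℝ) (g : ℕ → ℝ) (err : ℕ → ℝ)
    (herr : ∀ d ∈ sqfCoprime W x, ∀ e ∈ sqfCoprime W x,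
      |((T.filter fun n => d.lcm e ∣ A n).card : ℝ) - X * primeProd g (d.lcm e)|
        ≤ err (d.lcm e)) (herr0 : ∀ q ∈ sqfCoprime W (x ^ 2), 0 ≤ err q) :
    |∑ n ∈ T, (∑ d ∈ sqfCoprime W x with d ∣ A n, tupleCoeff W x d) ^ 2
      - X * ∑ d ∈ sqfCoprime W x, ∑ e ∈ sqfCoprime W x,
        tupleCoeff W x d * tupleCoeff W x e * primeProd g (d.lcm e)|
      ≤ (13 * (1 + Real.log x) ^ 14) ^ 2 *
        ∑ q ∈ sqfCoprime W (x ^ 2), primeProd (fun _ => 4) q * err q := by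
  set K := 13 * (1 + Real.log x) ^ 14
  have hK : ∀ d ∈ sqfCoprime W x, |tupleCoeff W x d| ≤ K := fun d hd => abs_tupleCoeff_le hW hx hd
  calc _ ≤ ∑ d ∈ sqfCoprime W x, ∑ e ∈ sqfCoprime W x, K ^ 2 * err (d.lcm e) := by
        rw [sum_sq_divisor_sum, mul_sum, ← sum_sub_distrib]
        refine (abs_sum_le_sum_abs _ _).trans (sum_le_sum fun d hd => ?_)
        rw [mul_sum, ← sum_sub_distrib]
        refine (abs_sum_le_sum_abs _ _).trans (sum_le_sum fun e he => ?_)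
        rw [mul_left_comm, ← mul_sub, abs_mul, abs_mul, sq]
        have h1 := hK d hd
        have h2 := hK e he
        have h3 := herr d hd e he
        have h4 : 0 ≤ K := (abs_nonneg _).trans h1
        gcongr
    _ ≤ _ := by
        simp only [← mul_sum]
        exact mul_le_mul_of_nonneg_left (sum_sum_lcm_le err herr0) (sq_nonneg K)

end SmoothGaps

/-! ### The level of the sieve and the total error -/

namespace SmoothGaps
open Finset Filter Topology

/-- The level of the sieve. -/
noncomputable def level (N : ℕ) : ℝ := (N : ℝ) ^ (0.495 : ℝ)

theorem log_level {N : ℕ} (hN : 0 < N) : Real.log (level N) = 0.495 * Real.log N :=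
  Real.log_rpow (by exact_mod_cast hN) _

/-- The moduli in the opened square are bounded by the square of the level. The exponent 0.99 leaves
room for the factor W and for powers of the logarithm. -/
theorem level_sq (N : ℕ) : level N ^ 2 = (N : ℝ) ^ (0.99 : ℝ) := by
  unfold level
  rw [← Real.rpow_natCast, ← Real.rpow_mul (Nat.cast_nonneg N)]
  norm_num

theorem tendsto_level : Tendsto level atTop atTop :=
  (tendsto_rpow_atTop (by norm_num)).comp tendsto_natCast_atTop_atTop

theorem one_le_level {N : ℕ} (hN : 1 ≤ N) : 1 ≤ level N :=
  Real.one_le_rpow (by exact_mod_cast hN) (by norm_num)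

theorem tendsto_log_natCast : Tendsto (fun N : ℕ => Real.log N) atTop atTop :=
  Real.tendsto_log_atTop.comp tendsto_natCast_atTop_atTop

theorem sq_coeff_bound_le {N : ℕ} (hN : 0 < N) (hl : 1 ≤ Real.log N) :
    (13 * (1 + Real.log (level N)) ^ 14) ^ 2 ≤ 169 * 2 ^ 28 * Real.log N ^ 28 := by
  rw [log_level hN]
  have h1 : 1 + 0.495 * Real.log N ≤ 2 * Real.log N := by linarith
  have h2 : 0 ≤ 1 + 0.495 * Real.log N := by linarith
  calc (13 * (1 + 0.495 * Real.log N) ^ 14) ^ 2 = 169 * (1 + 0.495 * Real.log N) ^ 28 := by ring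
    _ ≤ 169 * (2 * Real.log N) ^ 28 := by gcongr
    _ = _ := by ring

theorem one_add_log_level_sq_le {N : ℕ} (hN : 0 < N) (hl : 1 ≤ Real.log N) :
    0 ≤ 1 + Real.log (level N ^ 2) ∧ 1 + Real.log (level N ^ 2) ≤ 2 * Real.log N := by
  rw [Real.log_pow, log_level hN]
  push_cast
  constructor <;> linarith

/-- Errors of size a power of the logarithm times the square of the level are negligible. -/
theorem eventually_small_error (W m : ℕ) {ε : ℝ} (hε : 0 < ε) :
    ∀ᶠ N : ℕ in atTop, (13 * (1 + Real.log (level N)) ^ 14) ^ 2 *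
      (19 * level N ^ 2 * ∑ q ∈ sqfCoprime W (level N ^ 2),
        (q : ℝ)⁻¹ * primeProd (fun _ => (m : ℝ)) q) ≤ ε * N := by
  set K : ℝ := 169 * 2 ^ 28 * 19 * 2 ^ m with hK
  have hK0 : 0 < K := by positivity
  -- The spare N^0.01 absorbs 28 logarithms from the two coefficients and m from the divisor sum.
  have h1 := (isLittleO_log_rpow_rpow_atTop ((28 + m : ℕ) : ℝ) (show (0 : ℝ) < 0.01 by norm_num)).bound
    (show 0 < ε / K by positivity)
  filter_upwards [tendsto_natCast_atTop_atTop.eventually h1,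
    tendsto_log_natCast.eventually_ge_atTop 1, eventually_ge_atTop 1] with N hN hl hN1
  have hNR : (0 : ℝ) < N := by exact_mod_cast hN1
  have hsum := sum_natCast_pow_div_le W (one_le_pow₀ (n := 2) (one_le_level hN1)) m
  obtain ⟨h2, h3⟩ := one_add_log_level_sq_le hN1 hl
  have h4 := sq_coeff_bound_le hN1 hl
  have h5 : (1 + Real.log (level N ^ 2)) ^ m ≤ 2 ^ m * Real.log N ^ m := by
    rw [← mul_pow]
    exact pow_le_pow_left₀ h2 h3 m
  rw [Real.rpow_natCast, Real.norm_of_nonneg (by positivity),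
    Real.norm_of_nonneg (by positivity)] at hN
  calc _ ≤ (169 * 2 ^ 28 * Real.log N ^ 28) * (19 * level N ^ 2 * (2 ^ m * Real.log N ^ m)) := by
        have h6 := hsum.trans h5
        have h7 : 0 ≤ ∑ q ∈ sqfCoprime W (level N ^ 2),
            (q : ℝ)⁻¹ * primeProd (fun _ => (m : ℝ)) q :=
          sum_nonneg fun q _ => by rw [primeProd_const]; positivity
        gcongr
    _ = K * (level N ^ 2) * Real.log N ^ (28 + m) := by rw [pow_add, hK]; ring
    _ ≤ K * (level N ^ 2) * (ε / K * (N : ℝ) ^ (0.01 : ℝ)) := by gcongr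
    _ = ε * ((N : ℝ) ^ (0.99 : ℝ) * (N : ℝ) ^ (0.01 : ℝ)) := by
        rw [level_sq]
        field_simp
    _ = ε * N := by
        rw [← Real.rpow_add hNR]
        norm_num

/-- As φ(q) ≥ q/2^ω(q), the trivial bound is at most 3z 2^ω(q)/q, and 400·2 = 800. -/
theorem sum_maxPrimeError_trivial_le {W z : ℕ} (hW : 0 < W) {y : ℝ} (hy : 1 ≤ y)
    (hz : y * W ≤ z) :
    ∑ q ∈ sqfCoprime W y, primeProd (fun _ => 400) q * maxPrimeError (z : ℝ) (q * W)
      ≤ 3 * z * (1 + Real.log y) ^ 800 := by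
  have h800 := sum_natCast_pow_div_le W hy 800
  have hz0 : (0 : ℝ) ≤ z := Nat.cast_nonneg z
  calc _ ≤ ∑ q ∈ sqfCoprime W y,
        3 * z * ((q : ℝ)⁻¹ * primeProd (fun _ => ((800 : ℕ) : ℝ)) q) := by
        refine sum_le_sum fun q hq => ?_
        obtain ⟨g1, g2, g3, g4⟩ := mem_sqfCoprime.1 hq
        have hq0 : (0 : ℝ) < q := by exact_mod_cast g1
        have hW1 : (1 : ℝ) ≤ W := by exact_mod_cast hW
        have h2 : 1 ≤ primeProd (fun _ => 2) q := by
          rw [primeProd_const]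
          exact one_le_pow₀ (by norm_num)
        have hqW : (q : ℝ) * W ≤ z := (mul_le_mul_of_nonneg_right g2 (by linarith)).trans hz
        have hqz : (q : ℝ) ≤ z := (le_mul_of_one_le_right hq0.le hW1).trans hqW
        have hE := maxPrimeError_le (N := z) (Nat.mul_pos g1 hW)
        have e1 : (z : ℝ) / (q * W : ℕ) ≤ z / q := by
          refine div_le_div_of_nonneg_left hz0 hq0 ?_
          push_cast
          exact le_mul_of_one_le_right hq0.le hW1
        have e2 : (1 : ℝ) ≤ z / q := (one_le_div hq0).2 hqz
        have e3 : (z : ℝ) / (Nat.totient (q * W) : ℝ) ≤ z / q * primeProd (fun _ => 2) q := by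
          have h3 : (q : ℝ) ≤ primeProd (fun _ => 2) q * (Nat.totient q : ℝ) := by
            have h4 := primeProd_one_sub_inv_eq q (by omega)
            rw [eq_div_iff hq0.ne'] at h4
            rw [← h4, ← mul_assoc, ← primeProd_mul_fun]
            refine le_mul_of_one_le_left hq0.le ?_
            calc (1 : ℝ) = ∏ _p ∈ q.primeFactors, (1 : ℝ) := prod_const_one.symm
              _ ≤ ∏ p ∈ q.primeFactors, 2 * (1 - (p : ℝ)⁻¹) := by
                  refine prod_le_prod (fun _ _ => zero_le_one) fun p hp => ?_
                  have hp2 : (2 : ℝ) ≤ p := by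
                    exact_mod_cast (Nat.prime_of_mem_primeFactors hp).two_le
                  have : (p : ℝ)⁻¹ ≤ 2⁻¹ := inv_anti₀ (by norm_num) hp2
                  linarith
          have h5 : (0 : ℝ) < Nat.totient q := by exact_mod_cast Nat.totient_pos.2 g1
          have h6 : (Nat.totient q : ℝ) ≤ (Nat.totient (q * W) : ℝ) := by
            rw [Nat.totient_mul g4]
            exact_mod_cast Nat.le_mul_of_pos_right _ (Nat.totient_pos.2 hW)
          calc (z : ℝ) / (Nat.totient (q * W) : ℝ) ≤ z / Nat.totient q :=
                div_le_div_of_nonneg_left hz0 h5 h6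
            _ ≤ _ := by
                rw [div_mul_eq_mul_div, div_le_div_iff₀ h5 hq0, mul_assoc]
                exact mul_le_mul_of_nonneg_left h3 hz0
        have e4 : (z : ℝ) / q ≤ z / q * primeProd (fun _ => 2) q :=
          le_mul_of_one_le_right (by positivity) h2
        have h7 : maxPrimeError (z : ℝ) (q * W) ≤ 3 * (z / q * primeProd (fun _ => 2) q) := by
          linarith
        have h8 : (0 : ℝ) ≤ primeProd (fun _ => 400) q := by
          rw [primeProd_const]
          positivity
        refine (mul_le_mul_of_nonneg_left h7 h8).trans (le_of_eq ?_)
        have h9 : primeProd (fun _ => ((800 : ℕ) : ℝ)) q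
            = primeProd (fun _ => 400) q * primeProd (fun _ => 2) q := by
          rw [← primeProd_mul_fun]
          norm_num
        rw [h9]
        ring
    _ ≤ _ := by
        rw [← mul_sum]
        exact mul_le_mul_of_nonneg_left h800 (by positivity)

theorem sum_maxPrimeError_mul_le {W : ℕ} (hW : 0 < W) {x θ y : ℝ} (hy : y * W ≤ x ^ θ) :
    ∑ q ∈ sqfCoprime W y, maxPrimeError x (q * W)
      ≤ ∑ q ∈ Icc 1 ⌊x ^ θ⌋₊, maxPrimeError x q := by
  rw [← sum_image (g := fun q => q * W) (f := fun q => maxPrimeError x q)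
    (fun a _ b _ h => Nat.eq_of_mul_eq_mul_right hW h)]
  refine sum_le_sum_of_subset_of_nonneg (fun m hm => ?_) fun _ _ _ => maxPrimeError_nonneg _ _
  obtain ⟨q, hq, rfl⟩ := mem_image.1 hm
  obtain ⟨g1, g2, _⟩ := mem_sqfCoprime.1 hq
  have h : 1 ≤ q * W := Nat.mul_pos g1 hW
  refine mem_Icc.2 ⟨h, (Nat.le_floor_iff' (by omega)).2 (le_trans ?_ hy)⟩
  push_cast
  exact mul_le_mul_of_nonneg_right g2 (Nat.cast_nonneg _)

set_option exponentiation.threshold 1000 in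
/-- The contribution of the error terms in the distribution of primes. -/
theorem eventually_EH_error (hEH : ElliottHalberstamConjecture) {W : ℕ} (hW : 0 < W) {ε : ℝ}
    (hε : 0 < ε) :
    ∀ᶠ N : ℕ in atTop, ∀ i ≤ 16, (13 * (1 + Real.log (level N)) ^ 14) ^ 2 *
      ∑ q ∈ sqfCoprime W (level N ^ 2),
        primeProd (fun _ => 20) q * maxPrimeError ((N + i : ℕ) : ℝ) (q * W) ≤ ε * N := by
  -- The exponent is 860 = 800 + 60: the trivial bound costs 800 logarithms, a square root turns 60
  -- into 30, and the coefficients use 28 of these.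
  obtain ⟨C, hC⟩ := hEH 0.995 (by norm_num) (by norm_num) 860 (by norm_num)
  -- Adding 1 ensures K ≤ K², used when square roots are taken.
  set K : ℝ := 12 * |C| * 2 ^ 800 + 1 with hK
  have hK1 : 1 ≤ K := by
    have : 0 ≤ 12 * |C| * 2 ^ 800 := by positivity
    linarith
  have hW1 : ∀ᶠ N : ℕ in atTop, (W : ℝ) ≤ (N : ℝ) ^ (0.005 : ℝ) :=
    ((tendsto_rpow_atTop (show (0 : ℝ) < 0.005 by norm_num)).comp
      tendsto_natCast_atTop_atTop).eventually_ge_atTop _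
  filter_upwards [hW1, eventually_ge_atTop 16, tendsto_log_natCast.eventually_ge_atTop 1,
    tendsto_log_natCast.eventually_ge_atTop (169 * 2 ^ 28 * K / ε)] with N hNW hN16 hl hlK i hi
  have hN0 : 0 < N := by omega
  have hNR : (1 : ℝ) ≤ N := by exact_mod_cast hN0
  set z : ℝ := ((N + i : ℕ) : ℝ) with hz
  have hNz : (N : ℝ) ≤ z := by
    rw [hz]
    exact_mod_cast Nat.le_add_right N i
  have hz2 : z ≤ 2 * N := by
    rw [hz]
    exact_mod_cast (show N + i ≤ 2 * N by omega)
  have hlz : Real.log N ≤ Real.log z := Real.log_le_log (by linarith) hNz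
  have hyW : level N ^ 2 * W ≤ (N : ℝ) ^ (0.995 : ℝ) := by
    rw [level_sq]
    calc (N : ℝ) ^ (0.99 : ℝ) * W ≤ (N : ℝ) ^ (0.99 : ℝ) * (N : ℝ) ^ (0.005 : ℝ) := by gcongr
      _ = _ := by
          rw [← Real.rpow_add (by linarith)]
          norm_num
  have hyz : level N ^ 2 * W ≤ z ^ (0.995 : ℝ) :=
    hyW.trans (Real.rpow_le_rpow (by linarith) hNz (by norm_num))
  have hyN : level N ^ 2 * W ≤ z := by
    refine hyz.trans ?_
    nth_rewrite 2 [← Real.rpow_one z]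
    exact Real.rpow_le_rpow_of_exponent_le (by linarith) (by norm_num)
  set D := sqfCoprime W (level N ^ 2) with hD
  have h1 : ∑ q ∈ D, maxPrimeError z (q * W) ≤ |C| * (2 * N / Real.log N ^ 860) := by
    refine (sum_maxPrimeError_mul_le hW hyz).trans ((hC z ?_).trans ?_)
    · have : (16 : ℝ) ≤ N := by exact_mod_cast hN16
      linarith
    · rw [show (860 : ℝ) = ((860 : ℕ) : ℝ) by norm_num, Real.rpow_natCast]
      have h2 : z / Real.log z ^ 860 ≤ 2 * N / Real.log N ^ 860 := by gcongr
      have h3 : 0 ≤ z / Real.log z ^ 860 := by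
        have : 0 ≤ Real.log z := by linarith
        positivity
      exact (mul_le_mul_of_nonneg_right (le_abs_self C) h3).trans
        (mul_le_mul_of_nonneg_left h2 (abs_nonneg C))
  have h2 : ∑ q ∈ D, primeProd (fun _ => 400) q * maxPrimeError z (q * W)
      ≤ 6 * N * (2 * Real.log N) ^ 800 := by
    refine (sum_maxPrimeError_trivial_le hW (one_le_pow₀ (one_le_level hN0)) hyN).trans ?_
    obtain ⟨h3, h4⟩ := one_add_log_level_sq_le hN0 hl
    have h5 := pow_le_pow_left₀ h3 h4 800
    have h6 : 3 * z ≤ 6 * N := by linarith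
    exact mul_le_mul h6 h5 (pow_nonneg h3 _) (by positivity)
  set S := ∑ q ∈ D, primeProd (fun _ => 20) q * maxPrimeError z (q * W) with hS
  -- The conjecture bounds only the unweighted sum. Cauchy–Schwarz, with 20^ω E = (20^ω √E)·√E,
  -- leaves the weight 400^ω to the trivial bound.
  have hCS : S ^ 2 ≤ (∑ q ∈ D, primeProd (fun _ => 400) q * maxPrimeError z (q * W)) *
      ∑ q ∈ D, maxPrimeError z (q * W) := by
    have h := sum_mul_sq_le_sq_mul_sq D
      (fun q => primeProd (fun _ => 20) q * √(maxPrimeError z (q * W)))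
      (fun q => √(maxPrimeError z (q * W)))
    refine le_trans (le_of_eq ?_) (h.trans (le_of_eq ?_))
    · congr 1
      refine sum_congr rfl fun q _ => ?_
      rw [mul_assoc, Real.mul_self_sqrt (maxPrimeError_nonneg _ _)]
    · congr 1
      · refine sum_congr rfl fun q _ => ?_
        rw [mul_pow, Real.sq_sqrt (maxPrimeError_nonneg _ _), sq, ← primeProd_mul_fun]
        norm_num
      · exact sum_congr rfl fun q _ => Real.sq_sqrt (maxPrimeError_nonneg _ _)
  have hl0 : 0 < Real.log N := by linarith
  have hSle : S ≤ K * N / Real.log N ^ 30 := by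
    refine le_of_sq_le_sq ?_ (by positivity)
    calc S ^ 2 ≤ (6 * N * (2 * Real.log N) ^ 800) * (|C| * (2 * N / Real.log N ^ 860)) :=
          hCS.trans (mul_le_mul h2 h1 (sum_nonneg fun q _ => maxPrimeError_nonneg _ _)
            (by positivity))
      _ = (12 * |C| * 2 ^ 800) * (N ^ 2 / Real.log N ^ 60) := by
          rw [show (860 : ℕ) = 800 + 60 from rfl, pow_add, mul_pow]
          field_simp
          ring
      _ ≤ K ^ 2 * (N ^ 2 / Real.log N ^ 60) := by
          refine mul_le_mul_of_nonneg_right ?_ (by positivity)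
          nlinarith
      _ = _ := by ring
  have hS0 : 0 ≤ S := sum_nonneg fun q _ => mul_nonneg (by rw [primeProd_const]; positivity)
    (maxPrimeError_nonneg _ _)
  rw [div_le_iff₀ hε] at hlK
  calc _ ≤ (169 * 2 ^ 28 * Real.log N ^ 28) * (K * N / Real.log N ^ 30) :=
        mul_le_mul (sq_coeff_bound_le hN0 hl) hSle hS0 (by positivity)
    _ = 169 * 2 ^ 28 * K * N / Real.log N ^ 2 := by
        rw [show (30 : ℕ) = 28 + 2 from rfl, pow_add]
        field_simp
    _ ≤ ε * N := by
        rw [div_le_iff₀ (by positivity)]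
        have h3 : 169 * 2 ^ 28 * K ≤ ε * Real.log N ^ 2 := by
          have : Real.log N * ε ≤ ε * Real.log N ^ 2 := by
            rw [mul_comm, sq]
            refine mul_le_mul_of_nonneg_left ?_ hε.le
            exact le_mul_of_one_le_right hl0.le hl
          linarith
        calc 169 * 2 ^ 28 * K * N ≤ (ε * Real.log N ^ 2) * N := by gcongr
          _ = _ := by ring

end SmoothGaps

/-! ### The admissible class and the two primes -/

namespace SmoothGaps
open Finset Filter Topology

theorem dvd_primorial_iff {D₀ p : ℕ} (hp : p.Prime) : p ∣ primorial D₀ ↔ p ≤ D₀ := by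
  rw [primorial, hp.prime.dvd_finsetProd_iff]
  constructor
  · rintro ⟨q, hq, hpq⟩
    obtain ⟨h1, h2⟩ := mem_filter.1 hq
    rw [(Nat.prime_dvd_prime_iff_eq hp h2).1 hpq]
    exact Nat.lt_succ_iff.1 (mem_range.1 h1)
  · exact fun h => ⟨p, mem_filter.2 ⟨mem_range.2 (by omega), hp⟩, dvd_rfl⟩

/-- The translates of the tuple by `7` and by `97` consist of primes, so the tuple has an
admissible residue class modulo every primorial. -/
theorem exists_residue_coprime (D₀ : ℕ) :
    ∃ ν : ℕ, ∀ i ∈ tuple, (ν + i).Coprime (primorial D₀) := by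
  -- For p ≤ 23 the values ν + i are congruent to primes of at least 97, and for p > 23 to primes of
  -- at most 23; in neither case can p divide them.
  obtain ⟨ν, hν⟩ := Nat.chineseRemainderOfFinset (fun p => if p ≤ 23 then 97 else 7)
    (fun p : ℕ => p) ((range (D₀ + 1)).filter Nat.Prime)
    (fun p hp => (mem_filter.1 hp).2.ne_zero)
    (fun p hp q hq hpq => (Nat.coprime_primes (mem_filter.1 hp).2 (mem_filter.1 hq).2).2 hpq)
  refine ⟨ν, fun i hi => Nat.Coprime.symm (Nat.coprime_of_dvd fun p hp hpW hpi => ?_)⟩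
  have hpD := (dvd_primorial_iff hp).1 hpW
  have h1 := (hν p (mem_filter.2 ⟨mem_range.2 (by omega), hp⟩)).add_right i
  have h2 := (h1.dvd_iff dvd_rfl).1 hpi
  have h7 : ∀ i ∈ tuple, (7 + i).Prime ∧ (97 + i).Prime ∧ 7 + i ≤ 23 := by
    intro i hi
    simp only [tuple, mem_insert, mem_singleton] at hi
    rcases hi with rfl | rfl | rfl | rfl | rfl | rfl <;> norm_num
  obtain ⟨k1, k2, k3⟩ := h7 i hi
  split_ifs at h2 with h
  · have := (Nat.prime_dvd_prime_iff_eq hp k2).1 h2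
    omega
  · have := (Nat.prime_dvd_prime_iff_eq hp k1).1 h2
    omega

/-- The sieve weights, the square of a divisor sum. -/
noncomputable def sieveWeight (W : ℕ) (x : ℝ) (n : ℕ) : ℝ :=
  (∑ d ∈ sqfCoprime W x with d ∣ ∏ h ∈ tuple, (n + h), tupleCoeff W x d) ^ 2

/-- The integers in `(Y, N]` in a residue class. -/
def candidates (W ν Y N : ℕ) : Finset ℕ := (Ioc Y N).filter fun n => n ≡ ν [MOD W]

theorem level_le {N : ℕ} (hN : 1 ≤ N) : level N ≤ N := by
  have h : (1 : ℝ) ≤ N := by exact_mod_cast hN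
  simpa [level] using Real.rpow_le_rpow_of_exponent_le h (show (0.495 : ℝ) ≤ 1 by norm_num)

/-- The weights 4^ω for pairs with a given lcm and 6^ω for residue classes combine to 24^ω. Omitting
n up to the level only lowers the main term. -/
theorem eventually_sum_sieveWeight_le {W : ℕ} (hW0 : 0 < W)
    (hW : ∀ p, p.Prime → ¬ p ∣ W → 42 < p) (ν : ℕ) {ε : ℝ} (hε : 0 < ε) :
    ∀ᶠ N : ℕ in atTop, ∑ n ∈ candidates W ν ⌈level N⌉₊ N, sieveWeight W (level N) n
      ≤ N / W * ∑ r ∈ sqfCoprime W (level N),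
          primeProd (fun p => 6 / ((p : ℝ) - 6)) r * diagWeight (level N) r ^ 2 + ε * N := by
  filter_upwards [eventually_small_error W 24 hε, eventually_ge_atTop 1] with N hE hN
  have hx := one_le_level hN
  have h1 := abs_sum_weights_sub_le hW hx (candidates W ν ⌈level N⌉₊ N)
    (fun n => ∏ h ∈ tuple, (n + h)) (((N : ℝ) - ⌈level N⌉₊) / W) (fun p => 6 / (p : ℝ))
    (primeProd fun _ => 6) (fun d hd e he => by
      obtain ⟨_, _, g3, g4⟩ := mem_sqfCoprime.1 (lcm_mem_sqfCoprime hd he)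
      exact abs_card_dvd_sub_le hW0 (Nat.ceil_le.2 (level_le hN)) g3 g4 hW)
    (fun q _ => by rw [primeProd_const]; positivity)
  have h2 := (abs_le.1 h1).2
  rw [quadratic_form_all hW] at h2
  set S := ∑ r ∈ sqfCoprime W (level N),
    primeProd (fun p => 6 / ((p : ℝ) - 6)) r * diagWeight (level N) r ^ 2
  have hS : 0 ≤ S := sum_nonneg fun r hr => mul_nonneg
    (primeProd_div_sub_six_nonneg hW (by norm_num) (mem_sqfCoprime.1 hr).2.2.2) (sq_nonneg _)
  have h3 : ((N : ℝ) - ⌈level N⌉₊) / W * S ≤ N / W * S := by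
    gcongr
    have : (0 : ℝ) ≤ (⌈level N⌉₊ : ℝ) := Nat.cast_nonneg _
    linarith
  have h4 : (13 * (1 + Real.log (level N)) ^ 14) ^ 2 *
      ∑ q ∈ sqfCoprime W (level N ^ 2), primeProd (fun _ => 4) q * primeProd (fun _ => 6) q
      ≤ ε * N := by
    refine le_trans (mul_le_mul_of_nonneg_left ?_ (sq_nonneg _)) hE
    rw [mul_sum]
    refine sum_le_sum fun q hq => ?_
    obtain ⟨g1, g2, _⟩ := mem_sqfCoprime.1 hq
    have hq0 : (0 : ℝ) < q := by exact_mod_cast g1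
    have h5 : 1 ≤ 19 * level N ^ 2 * (q : ℝ)⁻¹ := by
      rw [← div_eq_mul_inv, one_le_div hq0]
      nlinarith
    rw [← primeProd_mul_fun, ← mul_assoc]
    norm_num
    exact le_mul_of_one_le_left (by rw [primeProd_const]; positivity) h5
  unfold sieveWeight
  linarith

/-- The window starts at the rounded-up level so that no prime n + i in it divides a sieve modulus.
The weights combine to 4·5 = 20, and the error splits into an Elliott–Halberstam part and a part of
size x² up to logarithms. -/
theorem eventually_le_sum_sieveWeight_prime (hEH : ElliottHalberstamConjecture) {W : ℕ}
    (hW0 : 0 < W) (hW : ∀ p, p.Prime → ¬ p ∣ W → 42 < p) {ν : ℕ}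
    (hν : ∀ i ∈ tuple, (ν + i).Coprime W) {ε : ℝ} (hε : 0 < ε) :
    ∀ᶠ N : ℕ in atTop, ∀ i ∈ tuple,
      (Nat.primeCounting N : ℝ) / (Nat.totient W : ℝ) *
        (primeProd (fun p => 1 - (p : ℝ)⁻¹) W ^ 2 *
          ∑ r ∈ sqfCoprime W (level N), primeProd (fun p => 5 / ((p : ℝ) - 6)) r *
            ((Real.log (level N) - Real.log r)
              + 6 * (Real.log (level N) - Real.log r) ^ 2 / Real.log (level N)) ^ 2)
        - ε * N
      ≤ ∑ n ∈ (candidates W ν ⌈level N⌉₊ N).filter fun n => (n + i).Prime,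
          sieveWeight W (level N) n := by
  filter_upwards [eventually_small_error W 20 (half_pos hε),
    eventually_EH_error hEH hW0 (half_pos hε), eventually_ge_atTop 1,
    tendsto_level.eventually_gt_atTop 1] with N hE hEH' hN hx1 i hi
  have hx := hx1.le
  set x := level N with hxdef
  have h1 := abs_sum_weights_sub_le hW hx
    ((candidates W ν ⌈x⌉₊ N).filter fun n => (n + i).Prime)
    (fun n => ∏ h ∈ tuple, (n + h)) ((Nat.primeCounting (N + i) : ℝ) / (Nat.totient W : ℝ))
    (fun p => 5 / ((p : ℝ) - 1))
    (fun q => primeProd (fun _ => 5) q *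
        (maxPrimeError ((N + i : ℕ) : ℝ) (q * W) + (((⌈x⌉₊ : ℝ) + 16) / q + 1)))
    (fun d hd e he => by
      obtain ⟨_, _, g3, g4⟩ := mem_sqfCoprime.1 (lcm_mem_sqfCoprime hd he)
      refine abs_card_prime_dvd_sub_le hW0 g3 g4 hW hi (hν i hi) fun p hp hpq => ?_
      have key : ∀ d ∈ sqfCoprime W x, p ∣ d → p ≤ ⌈x⌉₊ := fun d hd hpd => by
        obtain ⟨k1, k2, _⟩ := mem_sqfCoprime.1 hd
        exact (Nat.le_of_dvd k1 hpd).trans (by exact_mod_cast k2.trans (Nat.le_ceil x))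
      rcases (hp.dvd_mul.1 (hpq.trans (Nat.lcm_dvd (dvd_mul_right _ _) (dvd_mul_left _ _)))) with
        h | h
      · exact key d hd h
      · exact key e he h)
    (fun q _ => mul_nonneg (by rw [primeProd_const]; positivity)
      (add_nonneg (maxPrimeError_nonneg _ _) (by positivity)))
  have h2 := (abs_le.1 h1).1
  have hform := le_quadratic_form_omit_one hW0.ne' hx1 hW
  have hpi : (Nat.primeCounting N : ℝ) / (Nat.totient W : ℝ)
      ≤ (Nat.primeCounting (N + i) : ℝ) / (Nat.totient W : ℝ) := by
    gcongr
    exact Nat.monotone_primeCounting (Nat.le_add_right _ _)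
  have hB : 0 ≤ primeProd (fun p => 1 - (p : ℝ)⁻¹) W ^ 2 *
      ∑ r ∈ sqfCoprime W x, primeProd (fun p => 5 / ((p : ℝ) - 6)) r *
        ((Real.log x - Real.log r) + 6 * (Real.log x - Real.log r) ^ 2 / Real.log x) ^ 2 :=
    mul_nonneg (sq_nonneg _) (sum_nonneg fun r hr => mul_nonneg
      (primeProd_div_sub_six_nonneg hW (by norm_num) (mem_sqfCoprime.1 hr).2.2.2) (sq_nonneg _))
  have h3 := mul_le_mul hpi hform hB (by positivity)
  have h4 : (13 * (1 + Real.log x) ^ 14) ^ 2 *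
      ∑ q ∈ sqfCoprime W (x ^ 2), primeProd (fun _ => 4) q * (primeProd (fun _ => 5) q *
        (maxPrimeError ((N + i : ℕ) : ℝ) (q * W) + (((⌈x⌉₊ : ℝ) + 16) / q + 1))) ≤ ε * N := by
    have h5 : ∑ q ∈ sqfCoprime W (x ^ 2), primeProd (fun _ => 4) q * (primeProd (fun _ => 5) q *
        (maxPrimeError ((N + i : ℕ) : ℝ) (q * W) + (((⌈x⌉₊ : ℝ) + 16) / q + 1)))
        ≤ ∑ q ∈ sqfCoprime W (x ^ 2),
            primeProd (fun _ => 20) q * maxPrimeError ((N + i : ℕ) : ℝ) (q * W)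
          + 19 * x ^ 2 * ∑ q ∈ sqfCoprime W (x ^ 2),
            (q : ℝ)⁻¹ * primeProd (fun _ => ((20 : ℕ) : ℝ)) q := by
      rw [mul_sum, ← sum_add_distrib]
      refine sum_le_sum fun q hq => ?_
      obtain ⟨g1, g2, _⟩ := mem_sqfCoprime.1 hq
      have hq0 : (0 : ℝ) < q := by exact_mod_cast g1
      have h20 : primeProd (fun _ => (4 : ℝ)) q * primeProd (fun _ => 5) q
          = primeProd (fun _ => 20) q := by
        rw [← primeProd_mul_fun]
        norm_num
      have h20' : (0 : ℝ) ≤ primeProd (fun _ => 20) q := by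
        rw [primeProd_const]
        positivity
      -- Since q ≤ x² and x ≥ 1, the numerator ⌈x⌉ + 16 + q is at most 19x².
      have h6 : ((⌈x⌉₊ : ℝ) + 16) / q + 1 ≤ 19 * x ^ 2 * (q : ℝ)⁻¹ := by
        rw [← div_eq_mul_inv, div_add_one hq0.ne']
        have := Nat.ceil_lt_add_one (zero_le_one.trans hx)
        gcongr
        nlinarith
      rw [← mul_assoc, h20, mul_add]
      have := mul_le_mul_of_nonneg_left h6 h20'
      push_cast
      linarith
    have h7 := mul_le_mul_of_nonneg_left h5 (sq_nonneg (13 * (1 + Real.log x) ^ 14))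
    have h8 := hEH' i (le_of_mem_tuple hi)
    rw [mul_add] at h7
    linarith
  unfold sieveWeight
  linarith

/-- Each n makes at most one n + i prime, so its nonnegative weight is counted at most once on the
left. -/
theorem sum_sieveWeight_prime_le {W : ℕ} {x : ℝ} (T : Finset ℕ)
    (hT : ∀ n ∈ T, ∀ i ∈ tuple, ∀ j ∈ tuple, (n + i).Prime → (n + j).Prime → i = j) :
    ∑ i ∈ tuple, ∑ n ∈ T.filter (fun n => (n + i).Prime), sieveWeight W x n
      ≤ ∑ n ∈ T, sieveWeight W x n := by
  simp_rw [sum_filter]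
  rw [sum_comm]
  refine sum_le_sum fun n hn => ?_
  rw [← sum_filter, sum_const, nsmul_eq_mul]
  refine mul_le_of_le_one_left (sq_nonneg _) ?_
  exact_mod_cast card_le_one.2 fun i hi j hj => hT n hn i (mem_filter.1 hi).1 j (mem_filter.1 hj).1
    (mem_filter.1 hi).2 (mem_filter.1 hj).2

/-- Under the Elliott–Halberstam conjecture, infinitely many translates of the tuple contain two
primes. -/
theorem exists_two_primes_in_translate (hEH : ElliottHalberstamConjecture) (N₀ : ℕ) :
    ∃ n, N₀ < n ∧ ∃ i ∈ tuple, ∃ j ∈ tuple, i < j ∧ (n + i).Prime ∧ (n + j).Prime := by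
  by_contra! hcon
  obtain ⟨ν, hν⟩ := exists_residue_coprime 3000
  have hW0 : 0 < primorial 3000 := primorial_pos 3000
  have hWD : ∀ p, p.Prime → ¬ p ∣ primorial 3000 → 3000 < p := fun p hp h =>
    not_le.1 fun h' => h ((dvd_primorial_iff hp).2 h')
  generalize primorial 3000 = W at hν hW0 hWD
  have hW : ∀ p, p.Prime → ¬ p ∣ W → 42 < p := fun p hp h =>
    lt_trans (by norm_num) (hWD p hp h)
  have hWR : (0 : ℝ) < W := by exact_mod_cast hW0
  -- Seven such errors, one from all integers and six from primes, total 0.0035 N/W, within the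
  -- margin 0.004 left in the main terms.
  have hε : (0 : ℝ) < 0.0005 / W := by positivity
  obtain ⟨N₁, hN₁⟩ := eventually_atTop.1 <|
    (eventually_sum_sieveWeight_le hW0 hW ν hε).and <|
    (eventually_le_sum_sieveWeight_prime hEH hW0 hW hν hε).and <|
    (tendsto_level.eventually (eventually_main_terms hW0 le_rfl hWD)).and <|
    (tendsto_level.eventually_gt_atTop (N₀ : ℝ)).and <|
    (tendsto_log_natCast.eventually_gt_atTop 0).and (eventually_ge_atTop 1)
  -- All other conditions hold for every large N, so one suitable N with θ(N) ≥ 0.997 N is enough.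
  obtain ⟨N, hN, hθ⟩ := exists_le_theta (show (0 : ℝ) < 0.003 by norm_num) (by norm_num) N₁
  obtain ⟨hS1, hS2, hmain, hlev, hlog, hN1⟩ := hN₁ N hN
  set T := candidates W ν ⌈level N⌉₊ N
  have hT := sum_sieveWeight_prime_le (W := W) (x := level N) T (by
    intro n hn i hi j hj hni hnj
    have hn' : N₀ < n := by
      have h1 := (mem_Ioc.1 (mem_filter.1 hn).1).1
      have h2 : (N₀ : ℝ) < (n : ℝ) :=
        (hlev.trans_le (Nat.le_ceil _)).trans (by exact_mod_cast h1)
      exact_mod_cast h2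
    rcases lt_trichotomy i j with h | h | h
    · exact absurd hnj (hcon n hn' i hi j hj h hni)
    · exact h
    · exact absurd hni (hcon n hn' j hj i hi h hnj))
  set A := ∑ r ∈ sqfCoprime W (level N),
    primeProd (fun p => 6 / ((p : ℝ) - 6)) r * diagWeight (level N) r ^ 2
  set B := ∑ r ∈ sqfCoprime W (level N), primeProd (fun p => 5 / ((p : ℝ) - 6)) r *
    ((Real.log (level N) - Real.log r)
      + 6 * (Real.log (level N) - Real.log r) ^ 2 / Real.log (level N)) ^ 2
  set c := primeProd (fun p => 1 - (p : ℝ)⁻¹) W with hc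
  have hc0 : 0 < c := primeProd_one_sub_inv_pos W
  have hNR : (0 : ℝ) < N := by exact_mod_cast hN1
  have hA : 1 ≤ A := by
    refine (one_le_moment_zero hW (show (0 : ℝ) ≤ 6 by norm_num) (one_le_level hN1)).trans ?_
    rw [moment_zero]
    refine sum_le_sum fun r hr => le_mul_of_one_le_right
      (primeProd_div_sub_six_nonneg hW (by norm_num) (mem_sqfCoprime.1 hr).2.2.2) ?_
    exact one_le_pow₀ (diagWeight_bounds hr).1
  have hB : 0 ≤ B := sum_nonneg fun r hr => mul_nonneg
    (primeProd_div_sub_six_nonneg hW (by norm_num) (mem_sqfCoprime.1 hr).2.2.2) (sq_nonneg _)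
  have hφ : (Nat.totient W : ℝ) = c * W := by
    rw [hc, primeProd_one_sub_inv_eq W hW0.ne', div_mul_cancel₀ _ hWR.ne']
  have hπ : 0.997 * N / Real.log N ≤ (Nat.primeCounting N : ℝ) := by
    have h1 := Chebyshev.theta_le_pi_mul_log N
    rw [div_le_iff₀ hlog]
    linarith
  have hsum : 6 * ((Nat.primeCounting N : ℝ) / (Nat.totient W : ℝ) * (c ^ 2 * B)
      - 0.0005 / W * N) ≤ N / W * A + 0.0005 / W * N := by
    have h1 := card_nsmul_le_sum tuple _ _ hS2
    rw [card_tuple, nsmul_eq_mul] at h1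
    push_cast at h1
    linarith
  -- The constant 0.4935 is 0.495·0.997 rounded down.
  have hlower : N / W * (0.4935 * (c * B) / Real.log (level N))
      ≤ (Nat.primeCounting N : ℝ) / (Nat.totient W : ℝ) * (c ^ 2 * B) := by
    rw [hφ, log_level hN1]
    calc (N : ℝ) / W * (0.4935 * (c * B) / (0.495 * Real.log N))
        = (0.4935 / 0.495) * N / Real.log N / (c * W) * (c ^ 2 * B) := by
          field_simp
      _ ≤ 0.997 * N / Real.log N / (c * W) * (c ^ 2 * B) := by
          gcongr
          norm_num
      _ ≤ _ := by gcongr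
  have hNW : 0 < (N : ℝ) / W := by positivity
  have h1 := mul_le_mul_of_nonneg_left hmain hNW.le
  have h2 := mul_le_mul_of_nonneg_left hA hNW.le
  have h3 : 0.0005 / W * N = 0.0005 * ((N : ℝ) / W) := by ring
  rw [h3] at hsum
  have h4 : N / W * (0.4935 * (c * B) / Real.log (level N))
      = 0.4935 * (N / W * ((c * B) / Real.log (level N))) := by ring
  have h5 : N / W * (2.96 * (c * B) / Real.log (level N))
      = 2.96 * (N / W * ((c * B) / Real.log (level N))) := by ring
  have h6 : 0 ≤ N / W * ((c * B) / Real.log (level N)) := by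
    rw [log_level hN1]
    positivity
  -- With X = (N/W) cB/log(level), the facts read 1.004 A N/W ≤ 2.96 X and 6·0.4935 X ≤ (A + 0.0035)
  -- N/W, which is impossible for A ≥ 1.
  nlinarith

end SmoothGaps

/-! ### Conclusion -/

theorem theorem1p3 (hEH : ElliottHalberstamConjecture) :
    {pq : ℕ × ℕ | pq.1.Prime ∧ pq.2.Prime ∧ pq.2 < pq.1 ∧
      IsSmooth 5 ((pq.1 : ℤ) - (pq.2 : ℤ))}.Infinite := by
  -- It suffices that the smaller prime of the pair is unbounded.
  refine Set.Infinite.of_image Prod.snd (Set.infinite_of_forall_exists_gt fun N₀ => ?_)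
  obtain ⟨n, hn, i, hi, j, hj, hij, hpi, hpj⟩ := SmoothGaps.exists_two_primes_in_translate hEH N₀
  refine ⟨n + i, ⟨(n + j, n + i), ⟨hpj, hpi, by simpa using hij, ?_⟩, rfl⟩, by omega⟩
  -- The positive differences are 2, 4, 6, 8, 10, 12, 16, with least common multiple 240.
  have hdvd : j - i ∣ 240 := by
    simp only [SmoothGaps.tuple, Finset.mem_insert, Finset.mem_singleton] at hi hj
    rcases hi with rfl | rfl | rfl | rfl | rfl | rfl <;>
      rcases hj with rfl | rfl | rfl | rfl | rfl | rfl <;> omega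
  have hcast : ((n + j : ℕ) : ℤ) - ((n + i : ℕ) : ℤ) = ((j - i : ℕ) : ℤ) := by omega
  refine ⟨by rw [hcast]; omega, fun p hp hpd => ?_⟩
  simp only [hcast] at hpd
  have h : p ∣ 2 ^ 4 * 3 * 5 := (Int.natCast_dvd_natCast.1 hpd).trans hdvd
  have h5 : p ≤ 5 := by
    rcases hp.dvd_mul.1 h with h | h
    · rcases hp.dvd_mul.1 h with h | h
      · exact (Nat.le_of_dvd (by norm_num) (hp.dvd_of_dvd_pow h)).trans (by norm_num)
      · exact (Nat.le_of_dvd (by norm_num) h).trans (by norm_num)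
    · exact Nat.le_of_dvd (by norm_num) h
  exact_mod_cast h5
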